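/- For an even integer $k\ge 2$ let $\mathcal H_k$ be the (finite) set of Hecke cusp forms of weight $k$ for $SL(2,\mathbb Z)$, i.e. the holomorphic cusp forms $f$ that are eigenfunctions of all Hecke operators $T_n$ $(n\ge1)$, normalized so that $$f(z)=\sum_{n\ge 1}\lambda_f(n)\,n^{(k-1)/2}e^{2\pi i n z},\qquad \lambda_f(1)=1 .$$ Let $\omega_f=\dfrac{\Gamma(k-1)}{(4\pi)^{k-1}\langle f,f\rangle}$ be the harmonic weight, where $\langle f,f\rangle=\int_{SL(2,\mathbb Z)\backslash\mathbb H}|f(z)|^2y^{k}\,\frac{dx\,dy}{y^2}$ is the Petersson inner product, and put $$\sideset{}{^h}\sum_{f\in\mathcal H_k}\alpha_f=\sum_{f\in\mathcal H_k}\omega_f\alpha_f,\qquad |\mathcal H_k|_h=\sum_{f\in\mathcal H_k}\omega_f .$$ Let $\{g_p^\natural\}_{p\text{ prime}}$ be independent random variables with values in the set $G^\natural$ of conjugacy classes of $G=SU(2)$, each distributed according to the Sato–Tate measure (the direct image on $G^\natural$ of the Haar probability measure of $G$). Put $\mathbb X(1)=1$ and, if $n>1$ has the prime factorization $n=p_1^{a_1}\cdots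 p_r^{a_r}$, $$\mathbb X(n)=\prod_{j=1}^{r}\operatorname{tr}\bigl(\operatorname{Sym}^{a_j}(g_{p_j}^\natural)\bigr),$$ where $\operatorname{Sym}^a$ is the $a$-th symmetric power of the standard representation of $GL_2$. **Proposition.** There are absolute constants $C$ and $k_0$ such that for every even integer $k\ge k_0$, every real $x\ge 2$ and every positive integer $\ell$ with $x^{6\ell}\le k$, $$\left|\frac{1}{|\mathcal H_k|_h}\sideset{}{^h}\sum_{f\in\mathcal H_k}\Bigl|\sum_{n\le x}\lambda_f(n)\Bigr|^{2\ell}-\mathbb E\Bigl(\Bigl|\sum_{n\le x}\mathbb X(n)\Bigr|^{2\ell}\Bigr)\right|\le C\,k^{-1/3}.$$ -/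

import Mathlib

open scoped MatrixGroups UpperHalfPlane

noncomputable section

namespace HeckeMoments

/-! ### Hecke cusp forms of level one -/

/-- The `n`-th Hecke operator of weight `k` and level one,
`(T_n f)(z) = n^(k-1) ∑_{ad = n} ∑_{0 ≤ b < d} d^(-k) f((az + b)/d)`. -/
def heckeOperator (k : ℤ) (n : ℕ) (f : ℍ → ℂ) (z : ℍ) : ℂ :=
  (n : ℂ) ^ (k - 1) * ∑ ad ∈ n.divisorsAntidiagonal, ∑ b ∈ Finset.range ad.2,
    (ad.2 : ℂ) ^ (-k) * f (UpperHalfPlane.ofComplex (((ad.1 : ℂ) * z + b) / ad.2))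

/-- `H_k`: the cusp forms of weight `k` for `SL(2, ℤ)` which are eigenfunctions of all the Hecke
operators `T_n`, `n ≥ 1`, normalized so that the first Fourier coefficient is `1`. -/
def heckeForms (k : ℕ) : Set (CuspForm 𝒮ℒ (k : ℤ)) :=
  {f | (UpperHalfPlane.qExpansion 1 f).coeff 1 = 1 ∧
    ∀ n : ℕ, 1 ≤ n → ∃ c : ℂ, ∀ z : ℍ, heckeOperator k n f z = c * f z}

/-- `λ_f(n)`, where `f(z) = ∑_{n ≥ 1} λ_f(n) n^((k-1)/2) e(nz)`. -/
def eigenvalue {k : ℕ} (f : CuspForm 𝒮ℒ (k : ℤ)) (n : ℕ) : ℂ :=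
  (UpperHalfPlane.qExpansion 1 f).coeff n / (((n : ℝ) ^ (((k : ℝ) - 1) / 2) : ℝ) : ℂ)

/-- The Petersson inner product `⟨f, g⟩`: the integral of `conj (f z) * g z * y ^ k` over the
standard fundamental domain of `SL(2, ℤ)`, with respect to `dx dy / y ^ 2` (which is the measure
`volume` on `ℍ`). -/
def peterssonInner {k : ℕ} (f g : CuspForm 𝒮ℒ (k : ℤ)) : ℂ :=
  ∫ z in ModularGroup.fd, UpperHalfPlane.petersson k f g z

/-- The harmonic weight `ω_f = Γ(k - 1) / ((4π)^(k-1) ⟨f, f⟩)`. -/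
def harmonicWeight {k : ℕ} (f : CuspForm 𝒮ℒ (k : ℤ)) : ℝ :=
  Real.Gamma ((k : ℝ) - 1) / ((4 * Real.pi) ^ ((k : ℤ) - 1) * (peterssonInner f f).re)

/-- The harmonic sum `∑^h_{f ∈ H_k} α_f = ∑_{f ∈ H_k} ω_f α_f` (the set `H_k` is finite). -/
def harmonicSum (k : ℕ) (α : CuspForm 𝒮ℒ (k : ℤ) → ℝ) : ℝ :=
  ∑ᶠ f ∈ heckeForms k, harmonicWeight f * α f

/-! ### Conjugacy classes of `SU(2)` and the Sato–Tate measure -/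

/-- The group `SU(2)`. -/
abbrev SU2 : Type := Matrix.specialUnitaryGroup (Fin 2) ℂ

instance : IsTopologicalGroup SU2 where
  continuous_inv := by
    refine Continuous.subtype_mk ?_ _
    exact continuous_star.comp continuous_subtype_val

instance : CompactSpace SU2 := by
  have hK : IsCompact {A : Matrix (Fin 2) (Fin 2) ℂ | ∀ i j, A i j ∈ Metric.closedBall 0 1} := by
    have h := isCompact_univ_pi (s := fun _ : Fin 2 ↦
      Set.univ.pi fun _ : Fin 2 ↦ Metric.closedBall (0 : ℂ) 1)
      fun _ ↦ isCompact_univ_pi fun _ ↦ isCompact_closedBall _ _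
    have he : {A : Matrix (Fin 2) (Fin 2) ℂ | ∀ i j, A i j ∈ Metric.closedBall 0 1} =
        (Set.univ.pi fun _ ↦ Set.univ.pi fun _ ↦ Metric.closedBall 0 1 :
          Set (Fin 2 → Fin 2 → ℂ)) := by
      ext A
      exact ⟨fun hA i _ j _ ↦ hA i j, fun hA i j ↦ hA i trivial j trivial⟩
    rw [he]
    exact h
  refine isCompact_iff_compactSpace.mp (hK.of_isClosed_subset ?_ ?_)
  · have : ((Matrix.specialUnitaryGroup (Fin 2) ℂ : Submonoid _) :
        Set (Matrix (Fin 2) (Fin 2) ℂ)) = {A | A * star A = 1} ∩ {A | A.det = 1} := by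
      ext A
      simp [Matrix.mem_specialUnitaryGroup_iff, Matrix.mem_unitaryGroup_iff]
    rw [this]
    exact (isClosed_eq (by fun_prop) (by fun_prop)).inter (isClosed_eq (by fun_prop) (by fun_prop))
  · intro A hA i j
    simpa using entry_norm_bound_of_unitary (Matrix.mem_specialUnitaryGroup_iff.mp hA).1 i j

instance : MeasurableSpace SU2 := borel SU2

instance : BorelSpace SU2 := ⟨rfl⟩

/-- The quotient `σ`-algebra on the set of conjugacy classes. -/
instance : MeasurableSpace (ConjClasses SU2) :=
  MeasurableSpace.map ConjClasses.mk inferInstance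

/-- The Sato–Tate measure: the direct image of the Haar probability measure of `SU(2)`. -/
def satoTate : MeasureTheory.Measure (ConjClasses SU2) :=
  (MeasureTheory.Measure.haarMeasure (⊤ : TopologicalSpace.PositiveCompacts SU2)).map
    ConjClasses.mk

/-! ### Symmetric powers -/

/-- The linear substitution `X_j ↦ ∑_i g_{ij} X_i` in polynomials in two variables. -/
def substitution (g : Matrix (Fin 2) (Fin 2) ℂ) :
    MvPolynomial (Fin 2) ℂ →ₐ[ℂ] MvPolynomial (Fin 2) ℂ :=
  MvPolynomial.aeval fun j ↦ ∑ i, MvPolynomial.C (g i j) * MvPolynomial.X i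

lemma substitution_one : substitution 1 = AlgHom.id ℂ _ := by
  ext j : 1
  fin_cases j <;> simp [substitution]

lemma substitution_mul (g h : Matrix (Fin 2) (Fin 2) ℂ) :
    substitution (g * h) = (substitution g).comp (substitution h) := by
  ext j : 1
  simp [substitution, Matrix.mul_apply, MvPolynomial.algebraMap_eq]
  ring

lemma substitution_mem (g : Matrix (Fin 2) (Fin 2) ℂ) (a : ℕ) (P : MvPolynomial (Fin 2) ℂ)
    (hP : P ∈ MvPolynomial.homogeneousSubmodule (Fin 2) ℂ a) :
    substitution g P ∈ MvPolynomial.homogeneousSubmodule (Fin 2) ℂ a := by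
  have h := MvPolynomial.IsHomogeneous.aeval (n := 1) hP
    (fun j ↦ ∑ i, MvPolynomial.C (g i j) * MvPolynomial.X i) fun j ↦
      MvPolynomial.IsHomogeneous.sum _ _ _ fun i _ ↦ MvPolynomial.isHomogeneous_C_mul_X _ _
  rwa [one_mul] at h

/-- The symmetric `a`-th power of the standard representation on `ℂ²`, realized on the space of
homogeneous polynomials of degree `a` in the basis vectors `X_0, X_1` of `ℂ²`. -/
def symPow (a : ℕ) : Representation ℂ (Matrix (Fin 2) (Fin 2) ℂ)
    (MvPolynomial.homogeneousSubmodule (Fin 2) ℂ a) where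
  toFun g := (substitution g).toLinearMap.restrict (substitution_mem g a)
  map_one' := by
    ext P : 2
    simp [substitution_one]
  map_mul' g h := by
    ext P : 2
    simp only [substitution_mul]
    rfl

/-- `tr(Sym^a(c))` for a conjugacy class `c` of `SU(2)`. -/
def trSym (a : ℕ) : ConjClasses SU2 → ℂ :=
  Quotient.lift (fun g : SU2 ↦ LinearMap.trace ℂ _ (symPow a (g : Matrix (Fin 2) (Fin 2) ℂ)))
    (by
      intro g h hgh
      obtain ⟨c, rfl⟩ := isConj_iff.mp hgh
      simp only [Submonoid.coe_mul, map_mul]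
      rw [LinearMap.trace_mul_comm, ← mul_assoc, ← map_mul, ← Submonoid.coe_mul, inv_mul_cancel]
      simp)

/-- The random multiplicative function `X(n) = ∏_{p^a ∥ n} tr(Sym^a(g_p))`, given a sequence `g`
of conjugacy classes of `SU(2)` indexed by the primes. -/
def randomX (g : Nat.Primes → ConjClasses SU2) (n : ℕ) : ℂ :=
  ∏ p ∈ n.primeFactors.attach,
    trSym (n.factorization p) (g ⟨p, Nat.prime_of_mem_primeFactors p.2⟩)

end HeckeMoments

end

/-! Both L = λ_f and L = X are real and satisfy the Hecke relations L(m)L(n) = ∑_{d ∣ (m,n)}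
L(mn/d²). So one universal multiset of indices, `heckeExpansion N (2ℓ)` with N = ⌊x⌋, linearizes
both moments (`IsHeckeMultiplicative.sum_pow`). It has at most N^(4ℓ) ≤ k^(2/3) elements, all of
them at most N^(2ℓ) ≤ k^(1/3). It remains to compare the averages of a single L(m).

Random side: the Hecke relations for X are the Clebsch–Gordan rule, and E X(m) is exactly 1 if m = 1
and 0 otherwise, since nontrivial irreducible characters of SU(2) integrate to zero and distinct
primes are independent (`integral_randomX`).

Modular side: the harmonic sum of λ_f(m) is the same indicator up to e^(4πm) · `cellBound` · 2^(4-k)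
(`norm_sum_harmonicWeight_mul_eigenvalue_sub_le`). No Kloosterman sums or Bessel functions enter:
the coefficients of the Poincaré series P_1 are integrals along Im z = 2, where the terms with c ≠ 0
contribute O(2^(4-k)). For m ≤ k^(1/3) this is exponentially small in k, which beats the number of
terms and the division by |H_k|_h = 1 + O(ε).

The Poincaré series P_m also carry the Hecke theory. Unfolding makes ⟨P_m, f⟩ a positive multiple of
the m-th coefficient of f. Hence the Petersson form is definite and the P_m span. As T_n P_m is an
explicit combination of Poincaré series (`heckeOperator_poincare`), T_n preserves cusp forms and is
self-adjoint. Commutation of the T_n is checked on sequences of coefficients. The spectral theorem,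
with a_1(T_n f) = a_n(f) for multiplicity one, gives an orthogonal basis of normalized eigenforms,
in which P_1 = ∑ 2ω_f f. Its m-th coefficient yields Petersson's formula. -/

open scoped MatrixGroups UpperHalfPlane

noncomputable section

namespace HeckeMoments

/-! ### Hecke multiplicativity -/

/-- The Hecke relations `L m * L n = ∑_{d ∣ (m, n)} L (m n / d²)`, with `L 1 = 1`. -/
structure IsHeckeMultiplicative {R : Type*} [CommRing R] (L : ℕ → R) : Prop where
  map_one : L 1 = 1
  map_mul : ∀ m n, m ≠ 0 → n ≠ 0 →
    L m * L n = ∑ d ∈ (m.gcd n).divisors, L (m * n / d ^ 2)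

/-- The multiset of indices occurring when `(∑_{n ≤ N} L n) ^ j` is linearized by means of the
Hecke relations. -/
def heckeExpansion (N : ℕ) : ℕ → Multiset ℕ
  | 0 => {1}
  | j + 1 => (heckeExpansion N j).bind fun m ↦ (Finset.Icc 1 N).val.bind fun n ↦
      (m.gcd n).divisors.val.map fun d ↦ m * n / d ^ 2

lemma sq_dvd_mul_of_mem_divisors_gcd {m n d : ℕ} (hd : d ∈ (m.gcd n).divisors) :
    d ^ 2 ∣ m * n := by
  have h := Nat.dvd_of_mem_divisors hd
  rw [pow_two]
  exact mul_dvd_mul (h.trans (Nat.gcd_dvd_left m n)) (h.trans (Nat.gcd_dvd_right m n))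

lemma ne_zero_and_le_of_mem_heckeExpansion (N j : ℕ) :
    ∀ m ∈ heckeExpansion N j, m ≠ 0 ∧ m ≤ N ^ j := by
  induction j with
  | zero => simp [heckeExpansion]
  | succ j ih =>
    intro m hm
    simp only [heckeExpansion, Multiset.mem_bind, Multiset.mem_map, Finset.mem_val,
      Finset.mem_Icc] at hm
    obtain ⟨r, hr, n, ⟨hn1, hnN⟩, d, hd, rfl⟩ := hm
    obtain ⟨hr0, hrN⟩ := ih r hr
    have hpos : 0 < r * n := Nat.mul_pos (Nat.pos_of_ne_zero hr0) hn1
    refine ⟨?_, (Nat.div_le_self _ _).trans ?_⟩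
    · exact (Nat.div_pos (Nat.le_of_dvd hpos (sq_dvd_mul_of_mem_divisors_gcd hd))
        (pow_pos (Nat.pos_of_mem_divisors hd) 2)).ne'
    · rw [pow_succ]
      exact Nat.mul_le_mul hrN hnN

/-- Each new factor offers N choices of n and at most d((m,n)) ≤ n ≤ N divisors. The crude N² is
affordable because the error per term is exponentially small. -/
lemma card_heckeExpansion_le (N j : ℕ) : (heckeExpansion N j).card ≤ (N ^ 2) ^ j := by
  induction j with
  | zero => simp [heckeExpansion]
  | succ j ih =>
    rw [heckeExpansion, Multiset.card_bind, pow_succ]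
    have key : ∀ m : ℕ, ((Finset.Icc 1 N).val.bind fun n ↦
        (m.gcd n).divisors.val.map fun d ↦ m * n / d ^ 2).card ≤ N ^ 2 := by
      intro m
      rw [Multiset.card_bind]
      change ∑ n ∈ Finset.Icc 1 N, _ ≤ _
      calc _ ≤ ∑ n ∈ Finset.Icc 1 N, N := by
            refine Finset.sum_le_sum fun n hn ↦ ?_
            simp only [Function.comp_apply, Multiset.card_map, Finset.card_val]
            have h1 := (Finset.mem_Icc.mp hn)
            calc _ ≤ m.gcd n := Nat.card_divisors_le_self _
              _ ≤ n := Nat.gcd_le_right _ h1.1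
              _ ≤ N := h1.2
        _ = N ^ 2 := by simp [pow_two]
    calc _ ≤ (Multiset.map (fun _ ↦ N ^ 2) (heckeExpansion N j)).sum :=
          Multiset.sum_map_le_sum_map _ _ fun m _ ↦ key m
      _ = (heckeExpansion N j).card * N ^ 2 := by simp
      _ ≤ _ := Nat.mul_le_mul_right _ ih

/-- The multiset depends on N and j only, not on L, so it serves eigenvalues and random variables
alike. -/
lemma IsHeckeMultiplicative.sum_pow {R : Type*} [CommRing R] {L : ℕ → R}
    (hL : IsHeckeMultiplicative L) (N j : ℕ) :
    (∑ n ∈ Finset.Icc 1 N, L n) ^ j = ((heckeExpansion N j).map L).sum := by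
  induction j with
  | zero => simp [heckeExpansion, hL.map_one]
  | succ j ih =>
    rw [pow_succ, ih, heckeExpansion, Multiset.map_bind, Multiset.sum_bind,
      ← Multiset.sum_map_mul_right]
    refine congrArg Multiset.sum (Multiset.map_congr rfl fun m hm ↦ ?_)
    rw [Multiset.map_bind, Multiset.sum_bind, Finset.mul_sum]
    change _ = ∑ n ∈ Finset.Icc 1 N, _
    refine Finset.sum_congr rfl fun n hn ↦ ?_
    rw [hL.map_mul m n (ne_zero_and_le_of_mem_heckeExpansion N j m hm).1
      (Nat.one_le_iff_ne_zero.mp (Finset.mem_Icc.mp hn).1), Multiset.map_map]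
    rfl

/-! ### Hecke relations from their prime power case -/

lemma sum_divisors_mul_of_coprime {M : Type*} [AddCommMonoid M] {m n : ℕ} (h : m.Coprime n)
    (f : ℕ → M) :
    ∑ d ∈ (m * n).divisors, f d = ∑ d ∈ m.divisors, ∑ e ∈ n.divisors, f (d * e) := by
  rw [← Finset.sum_product', Nat.divisors_mul, Finset.mul_def, Finset.sum_image]
  exact h.mul_injOn_divisors

lemma factorization_prod_prime_pow_mul {R : Type*} [CommRing R] {S : ℕ → ℕ → R}
    (h0 : ∀ p, S p 0 = 1) {p m : ℕ} (hp : p.Prime) (hm : ¬ p ∣ m) (a : ℕ) :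
    (p ^ a * m).factorization.prod S = S p a * m.factorization.prod S := by
  have hc : (p ^ a).Coprime m := Nat.Coprime.pow_left _ ((Nat.Prime.coprime_iff_not_dvd hp).mpr hm)
  rw [Nat.factorization_mul_of_coprime hc, Finsupp.prod_add_index_of_disjoint, hp.factorization_pow,
    Finsupp.prod_single_index (h0 p)]
  simpa only [Nat.support_factorization] using hc.disjoint_primeFactors

/-- The relations factor over primes. Splitting p^a and p^b off m and n, the divisors of the gcd
become p^i d with i ≤ min a b; `hmul` handles p^i and induction on the product mn handles the part
prime to p. -/
lemma isHeckeMultiplicative_of_prime_pow {R : Type*} [CommRing R] {S : ℕ → ℕ → R}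
    (h0 : ∀ p, S p 0 = 1)
    (hmul : ∀ p, p.Prime → ∀ a b,
      S p a * S p b = ∑ i ∈ Finset.range (min a b + 1), S p (a + b - 2 * i)) :
    IsHeckeMultiplicative fun n ↦ n.factorization.prod S := by
  refine ⟨by simp, ?_⟩
  suffices H : ∀ N m n, m * n = N → m ≠ 0 → n ≠ 0 →
      m.factorization.prod S * n.factorization.prod S =
        ∑ d ∈ (m.gcd n).divisors, (m * n / d ^ 2).factorization.prod S from
    fun m n hm hn ↦ H _ m n rfl hm hn
  intro N
  induction N using Nat.strong_induction_on with
  | _ N ih =>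
    intro m n hN hm hn
    by_cases h1 : N = 1
    · rw [h1, mul_eq_one] at hN
      simp [hN.1, hN.2]
    · obtain ⟨p, hp, hpN⟩ := Nat.exists_prime_and_dvd h1
      obtain ⟨a, m', hm', rfl⟩ := Nat.exists_eq_pow_mul_and_not_dvd hm p hp.ne_one
      obtain ⟨b, n', hn', rfl⟩ := Nat.exists_eq_pow_mul_and_not_dvd hn p hp.ne_one
      have hm'0 : m' ≠ 0 := fun h ↦ hm (by simp [h])
      have hn'0 : n' ≠ 0 := fun h ↦ hn (by simp [h])
      have hmn' : ¬ p ∣ m' * n' := fun h ↦ (hp.dvd_mul.mp h).elim hm' hn'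
      have hab : a + b ≠ 0 := by
        intro h
        obtain ⟨rfl, rfl⟩ := Nat.add_eq_zero_iff.mp h
        rw [← hN] at hpN
        simp only [pow_zero, one_mul] at hpN
        exact hmn' hpN
      have hlt : m' * n' < N := by
        have : N = p ^ (a + b) * (m' * n') := by rw [← hN, pow_add]; ring
        rw [this]
        exact lt_mul_of_one_lt_left (Nat.pos_of_ne_zero (mul_ne_zero hm'0 hn'0))
          (Nat.one_lt_pow hab hp.one_lt)
      have hIH := ih _ hlt m' n' rfl hm'0 hn'0
      have hcm : ∀ c, (p ^ c).Coprime m' := fun c ↦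
        Nat.Coprime.pow_left _ ((Nat.Prime.coprime_iff_not_dvd hp).mpr hm')
      have hcn : ∀ c, (p ^ c).Coprime n' := fun c ↦
        Nat.Coprime.pow_left _ ((Nat.Prime.coprime_iff_not_dvd hp).mpr hn')
      have hgcd : (p ^ a * m').gcd (p ^ b * n') = p ^ (min a b) * m'.gcd n' := by
        rw [Nat.Coprime.gcd_mul _ (hcn b), Nat.gcd_comm, Nat.Coprime.gcd_mul _ (hcm a),
          Nat.gcd_comm (p ^ a * m') n', Nat.Coprime.gcd_mul _ (hcm a)]
        rw [Nat.Coprime.gcd_eq_one (hcm b), Nat.Coprime.gcd_eq_one (hcn a).symm, mul_one, one_mul,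
          Nat.gcd_comm n' m']
        congr 1
        rcases le_total a b with h | h
        · rw [min_eq_left h]
          exact Nat.gcd_eq_right (pow_dvd_pow p h)
        · rw [min_eq_right h]
          exact Nat.gcd_eq_left (pow_dvd_pow p h)
      have hcg : (p ^ (min a b)).Coprime (m'.gcd n') := (hcm _).coprime_dvd_right
        (Nat.gcd_dvd_left _ _)
      rw [factorization_prod_prime_pow_mul h0 hp hm', factorization_prod_prime_pow_mul h0 hp hn',
        hgcd, sum_divisors_mul_of_coprime hcg, Nat.sum_divisors_prime_pow hp, mul_mul_mul_comm,
        hIH, hmul p hp, Finset.sum_mul_sum]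
      refine Finset.sum_congr rfl fun i hi ↦ Finset.sum_congr rfl fun d hd ↦ ?_
      have hi' : i ≤ min a b := Nat.lt_succ_iff.mp (Finset.mem_range.mp hi)
      have hia : i ≤ a := hi'.trans (min_le_left _ _)
      have hib : i ≤ b := hi'.trans (min_le_right _ _)
      have hdd := sq_dvd_mul_of_mem_divisors_gcd hd
      have hdiv : p ^ a * m' * (p ^ b * n') / (p ^ i * d) ^ 2 =
          p ^ (a + b - 2 * i) * (m' * n' / d ^ 2) := by
        apply Nat.div_eq_of_eq_mul_left
        · exact pow_pos (Nat.mul_pos (pow_pos hp.pos _) (Nat.pos_of_mem_divisors hd)) 2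
        · have e1 : p ^ (a + b) = p ^ (a + b - 2 * i) * p ^ (2 * i) := by
            rw [← pow_add]; congr 1; omega
          calc p ^ a * m' * (p ^ b * n') = p ^ (a + b) * (m' * n') := by rw [pow_add]; ring
            _ = p ^ (a + b - 2 * i) * p ^ (2 * i) * (m' * n' / d ^ 2 * d ^ 2) := by
              rw [Nat.div_mul_cancel hdd, ← e1]
            _ = _ := by rw [mul_pow, ← pow_mul, mul_comm i 2]; ring
      rw [hdiv, factorization_prod_prime_pow_mul h0 hp]
      exact fun h ↦ hmn' (h.trans (Nat.div_dvd_of_dvd hdd))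

/-! ### The Hecke algebra acting on sequences of coefficients -/

/-- The operator `(a_r) ↦ (a_{er})`. -/
def seqU (e : ℕ) : Module.End ℂ (ℕ → ℂ) where
  toFun a r := a (e * r)
  map_add' _ _ := rfl
  map_smul' _ _ := rfl

/-- The operator `(a_r) ↦ (a_{r/d})`, where `a_{r/d}` is read as zero if `d` does not divide `r`. -/
def seqV (d : ℕ) : Module.End ℂ (ℕ → ℂ) where
  toFun a r := if d ∣ r then a (r / d) else 0
  map_add' a b := by ext r; by_cases h : d ∣ r <;> simp [h]
  map_smul' c a := by ext r; by_cases h : d ∣ r <;> simp [h]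

/-- The action of the Hecke operator `T_n` of weight `w + 1` on Fourier coefficients. -/
def seqHecke (w n : ℕ) : Module.End ℂ (ℕ → ℂ) :=
  ∑ d ∈ n.divisors, (d : ℂ) ^ w • (seqV d * seqU (n / d))

lemma seqU_mul (d e : ℕ) : seqU d * seqU e = seqU (d * e) := by
  ext a r
  simp only [Module.End.mul_apply, seqU, LinearMap.coe_mk, AddHom.coe_mk]
  ring_nf

lemma seqV_mul {d e : ℕ} (hd : d ≠ 0) : seqV d * seqV e = seqV (d * e) := by
  refine LinearMap.ext fun a ↦ funext fun r ↦ ?_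
  simp only [Module.End.mul_apply, seqV, LinearMap.coe_mk, AddHom.coe_mk]
  by_cases h : d ∣ r
  · obtain ⟨s, rfl⟩ := h
    simp [Nat.pos_of_ne_zero hd, Nat.mul_dvd_mul_iff_left, Nat.mul_div_mul_left]
  · rw [if_neg h, if_neg fun h' ↦ h ((dvd_mul_right d e).trans h')]

lemma seqU_mul_seqV {d e : ℕ} (hde : e.Coprime d) :
    seqU e * seqV d = seqV d * seqU e := by
  refine LinearMap.ext fun a ↦ funext fun r ↦ ?_
  simp only [Module.End.mul_apply, seqV, seqU, LinearMap.coe_mk, AddHom.coe_mk]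
  by_cases h : d ∣ r
  · rw [if_pos h, if_pos (h.mul_left e), Nat.mul_div_assoc _ h]
  · rw [if_neg h, if_neg fun h' ↦ h (hde.symm.dvd_of_dvd_mul_left h')]

/-- One-sided only: the product in the other order erases the entries at indices not divisible by d.
This cancellation is the source of the second term in the recursion for T_{p^a}. -/
lemma seqU_mul_seqV_self {d : ℕ} (hd : d ≠ 0) : seqU d * seqV d = 1 := by
  refine LinearMap.ext fun a ↦ funext fun r ↦ ?_
  simp [seqV, seqU, Nat.pos_of_ne_zero hd]

/-- `seqV d` kills the terms with d ∤ r. The case r = 1 says that the first coefficient of T_n f is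
the n-th coefficient of f. -/
lemma seqHecke_apply (w n : ℕ) (hn : n ≠ 0) (a : ℕ → ℂ) (r : ℕ) :
    seqHecke w n a r = ∑ d ∈ (r.gcd n).divisors, (d : ℂ) ^ w * a (r * n / d ^ 2) := by
  simp only [seqHecke, LinearMap.sum_apply, Finset.sum_apply, LinearMap.smul_apply,
    Module.End.mul_apply, Pi.smul_apply, smul_eq_mul, seqV, seqU, LinearMap.coe_mk, AddHom.coe_mk]
  symm
  refine Finset.sum_subset_zero_on_sdiff (Nat.divisors_subset_of_dvd hn (Nat.gcd_dvd_right r n))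
    (fun d hd ↦ ?_) (fun d hd ↦ ?_)
  · rw [Finset.mem_sdiff, Nat.mem_divisors, Nat.mem_divisors] at hd
    rw [if_neg, mul_zero]
    intro h
    exact hd.2 ⟨Nat.dvd_gcd h hd.1.1, (Nat.gcd_pos_of_pos_right _ (Nat.pos_of_ne_zero hn)).ne'⟩
  · have h := Nat.dvd_of_mem_divisors hd
    have h1 := h.trans (Nat.gcd_dvd_left r n)
    have h2 := h.trans (Nat.gcd_dvd_right r n)
    rw [if_pos h1, mul_comm (n / d), Nat.div_mul_div_comm h1 h2, pow_two]

lemma seqHecke_mul_of_coprime (w : ℕ) {m n : ℕ} (h : m.Coprime n) :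
    seqHecke w m * seqHecke w n = seqHecke w (m * n) := by
  rw [seqHecke, seqHecke, seqHecke, sum_divisors_mul_of_coprime h, Finset.sum_mul_sum]
  refine Finset.sum_congr rfl fun d hd ↦ Finset.sum_congr rfl fun e he ↦ ?_
  have hd' := Nat.dvd_of_mem_divisors hd
  have he' := Nat.dvd_of_mem_divisors he
  have hd0 := (Nat.pos_of_mem_divisors hd).ne'
  rw [smul_mul_smul_comm, Nat.cast_mul, mul_pow, ← Nat.div_mul_div_comm hd' he',
    ← seqU_mul, ← seqV_mul hd0, mul_assoc (seqV d), ← mul_assoc (seqU _) (seqV e),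
    seqU_mul_seqV ((h.coprime_dvd_left (Nat.div_dvd_of_dvd hd')).coprime_dvd_right he')]
  simp only [mul_assoc]

lemma seqU_pow {p : ℕ} (i : ℕ) : seqU p ^ i = seqU (p ^ i) := by
  induction i with
  | zero => ext a r; simp [seqU]
  | succ i ih => rw [pow_succ, ih, seqU_mul, pow_succ]

lemma seqV_pow {p : ℕ} (hp : p ≠ 0) (i : ℕ) : seqV p ^ i = seqV (p ^ i) := by
  induction i with
  | zero => ext a r; simp [seqV]
  | succ i ih => rw [pow_succ, ih, seqV_mul (pow_ne_zero _ hp), pow_succ]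

lemma seqHecke_prime_pow (w : ℕ) {p : ℕ} (hp : p.Prime) (a : ℕ) :
    seqHecke w (p ^ a) =
      ∑ i ∈ Finset.range (a + 1), ((p : ℂ) ^ w) ^ i • (seqV p ^ i * seqU p ^ (a - i)) := by
  rw [seqHecke, Nat.sum_divisors_prime_pow hp]
  refine Finset.sum_congr rfl fun i hi ↦ ?_
  rw [seqU_pow, seqV_pow hp.ne_zero, Nat.pow_div (Nat.lt_succ_iff.mp (Finset.mem_range.mp hi))
    hp.pos, Nat.cast_pow, ← pow_mul, ← pow_mul, mul_comm i w]

lemma seqHecke_one (w : ℕ) : seqHecke w 1 = 1 := by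
  refine LinearMap.ext fun a ↦ funext fun r ↦ ?_
  simp [seqHecke, seqV, seqU]

/-- Here T_p = U + p^w V with UV = 1. Multiplying T_{p^(a+1)} by U cancels one V in every term that
has one, which leaves p^w T_{p^a} and U^(a+2); multiplying by p^w V gives the other terms of
T_{p^(a+2)}. -/
lemma seqHecke_prime_pow_succ_succ (w : ℕ) {p : ℕ} (hp : p.Prime) (a : ℕ) :
    seqHecke w (p ^ (a + 2)) =
      seqHecke w p * seqHecke w (p ^ (a + 1)) - (p : ℂ) ^ w • seqHecke w (p ^ a) := by
  have h1 : seqHecke w p = seqU p + (p : ℂ) ^ w • seqV p := by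
    have := seqHecke_prime_pow w hp 1
    rw [pow_one] at this
    rw [this]
    simp [Finset.sum_range_succ]
  rw [eq_sub_iff_add_eq, h1, add_mul, seqHecke_prime_pow w hp, seqHecke_prime_pow w hp,
    seqHecke_prime_pow w hp, Finset.sum_range_succ' _ (a + 2)]
  conv_rhs => rw [Finset.sum_range_succ' _ (a + 1)]
  have h2 : seqU p * (∑ k ∈ Finset.range (a + 1),
      ((p : ℂ) ^ w) ^ (k + 1) • (seqV p ^ (k + 1) * seqU p ^ (a + 1 - (k + 1))) +
      ((p : ℂ) ^ w) ^ 0 • (seqV p ^ 0 * seqU p ^ (a + 1 - 0))) =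
      (p : ℂ) ^ w • ∑ i ∈ Finset.range (a + 1),
        ((p : ℂ) ^ w) ^ i • (seqV p ^ i * seqU p ^ (a - i)) + seqU p ^ (a + 2) := by
    rw [mul_add, Finset.mul_sum, Finset.smul_sum]
    congr 1
    · refine Finset.sum_congr rfl fun i _ ↦ ?_
      rw [mul_smul_comm, smul_smul, ← pow_succ', ← mul_assoc, pow_succ' (seqV p), ← mul_assoc,
        seqU_mul_seqV_self hp.ne_zero, one_mul, Nat.add_sub_add_right]
    · simp [← pow_succ']
  rw [h2, ← Finset.sum_range_succ' (fun i ↦ ((p : ℂ) ^ w) ^ i •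
    (seqV p ^ i * seqU p ^ (a + 1 - i))) (a + 1), smul_mul_assoc]
  simp only [Finset.mul_sum, Finset.smul_sum]
  have h3 : ∀ i ∈ Finset.range (a + 1 + 1),
      (p : ℂ) ^ w • (seqV p * ((p : ℂ) ^ w) ^ i • (seqV p ^ i * seqU p ^ (a + 1 - i))) =
      ((p : ℂ) ^ w) ^ (i + 1) • (seqV p ^ (i + 1) * seqU p ^ (a + 2 - (i + 1))) := by
    intro i _
    rw [mul_smul_comm, smul_smul, ← pow_succ', ← mul_assoc, ← pow_succ']
    congr 3
    omega
  rw [Finset.sum_congr rfl h3]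
  simp only [pow_zero, one_mul, one_smul, Nat.sub_zero]
  abel

/-- By the recursion T_{p^a} is a polynomial in T_p. -/
lemma commute_seqHecke_prime_pow {w p : ℕ} (hp : p.Prime) {X : Module.End ℂ (ℕ → ℂ)}
    (hX : Commute X (seqHecke w p)) (a : ℕ) : Commute X (seqHecke w (p ^ a)) := by
  induction a using Nat.strong_induction_on with
  | _ a ih =>
    match a with
    | 0 => rw [pow_zero, seqHecke_one]; exact Commute.one_right X
    | 1 => rwa [pow_one]
    | a + 2 =>
      rw [seqHecke_prime_pow_succ_succ w hp]
      exact (hX.mul_right (ih (a + 1) (by omega))).sub_right ((ih a (by omega)).smul_right _)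

lemma commute_seqHecke (w : ℕ) {m n : ℕ} (hm : m ≠ 0) (hn : n ≠ 0) :
    Commute (seqHecke w m) (seqHecke w n) := by
  induction m using Nat.recOnPosPrimePosCoprime with
  | zero => exact absurd rfl hm
  | one => rw [seqHecke_one]; exact Commute.one_left _
  | prime_pow p a hp ha =>
    obtain ⟨b, n', hn', rfl⟩ := Nat.exists_eq_pow_mul_and_not_dvd hn p hp.ne_one
    have hc : ∀ c, (p ^ c).Coprime n' := fun c ↦
      Nat.Coprime.pow_left _ ((Nat.Prime.coprime_iff_not_dvd hp).mpr hn')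
    rw [← seqHecke_mul_of_coprime w (hc b)]
    refine Commute.mul_right ?_ ?_
    · exact commute_seqHecke_prime_pow hp (commute_seqHecke_prime_pow hp rfl a).symm b
    · rw [commute_iff_eq, seqHecke_mul_of_coprime w (hc a),
        seqHecke_mul_of_coprime w (hc a).symm, mul_comm]
  | coprime u v hu hv huv ihu ihv =>
    rw [← seqHecke_mul_of_coprime w huv]
    exact (ihu (by omega)).mul_left (ihv (by omega))

end HeckeMoments

end

open scoped MatrixGroups UpperHalfPlane

noncomputable section

namespace HeckeMoments

open MvPolynomial MeasureTheory

/-! ### Traces of the symmetric powers -/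

/-- The exponent of the monomial `X_0 ^ i * X_1 ^ (a - i)`. -/
def binaryExponent (a i : ℕ) : Fin 2 →₀ ℕ := Finsupp.single 0 i + Finsupp.single 1 (a - i)

@[simp] lemma binaryExponent_zero (a i : ℕ) : binaryExponent a i 0 = i := by
  simp [binaryExponent]

@[simp] lemma binaryExponent_one (a i : ℕ) : binaryExponent a i 1 = a - i := by
  simp [binaryExponent]

lemma degree_binaryExponent {a i : ℕ} (hi : i ≤ a) : (binaryExponent a i).degree = a := by
  simp [Finsupp.degree_eq_sum, hi]

lemma eq_binaryExponent {a : ℕ} {s : Fin 2 →₀ ℕ} (hs : s.degree = a) :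
    s = binaryExponent a (s 0) := by
  rw [Finsupp.degree_eq_sum, Fin.sum_univ_two] at hs
  ext j
  fin_cases j
  · simp
  · simp
    omega

lemma sum_coeff_binaryExponent {a : ℕ} {P : MvPolynomial (Fin 2) ℂ} (hP : P.IsHomogeneous a) :
    P = ∑ i : Fin (a + 1), coeff (binaryExponent a i) P • monomial (binaryExponent a i) 1 := by
  ext s
  simp only [coeff_sum, coeff_smul, coeff_monomial, smul_eq_mul, mul_ite, mul_one, mul_zero]
  by_cases hs : s.degree = a
  · have h0 : s 0 < a + 1 := by
      rw [Finsupp.degree_eq_sum, Fin.sum_univ_two] at hs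
      omega
    rw [Finset.sum_eq_single ⟨s 0, h0⟩]
    · rw [if_pos (eq_binaryExponent hs).symm, ← eq_binaryExponent hs]
    · intro i _ hi
      rw [if_neg]
      rintro rfl
      exact hi (Fin.ext (by simp))
    · simp
  · rw [hP.coeff_eq_zero hs, Finset.sum_eq_zero]
    intro i _
    rw [if_neg]
    rintro rfl
    exact hs (degree_binaryExponent (Nat.lt_succ_iff.mp i.2))

/-- The monomial basis of the space of binary forms of degree `a`. -/
def binaryBasis (a : ℕ) : Module.Basis (Fin (a + 1)) ℂ (homogeneousSubmodule (Fin 2) ℂ a) :=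
  Module.Basis.ofEquivFun
    { toFun := fun P i ↦ coeff (binaryExponent a i) P.1
      map_add' := fun _ _ ↦ by ext; simp
      map_smul' := fun _ _ ↦ by ext; simp
      invFun := fun c ↦ ∑ i, c i • ⟨monomial (binaryExponent a i) 1,
        isHomogeneous_monomial _ (degree_binaryExponent (Nat.lt_succ_iff.mp i.2))⟩
      left_inv := fun P ↦ by
        ext1
        simp only [Submodule.coe_sum, Submodule.coe_smul]
        exact (sum_coeff_binaryExponent P.2).symm
      right_inv := fun c ↦ by
        ext j
        simp only [Submodule.coe_sum, Submodule.coe_smul, coeff_sum, coeff_smul, coeff_monomial,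
          smul_eq_mul, mul_ite, mul_one, mul_zero]
        rw [Finset.sum_eq_single j]
        · simp
        · intro i _ hi
          rw [if_neg]
          intro h
          exact hi (Fin.ext (by simpa using DFunLike.congr_fun h 0))
        · simp }

lemma binaryBasis_repr (a : ℕ) (P : homogeneousSubmodule (Fin 2) ℂ a) (i : Fin (a + 1)) :
    (binaryBasis a).repr P i = coeff (binaryExponent a i) P.1 := rfl

lemma binaryBasis_apply (a : ℕ) (i : Fin (a + 1)) :
    ((binaryBasis a i : homogeneousSubmodule (Fin 2) ℂ a) : MvPolynomial (Fin 2) ℂ) =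
      monomial (binaryExponent a i) 1 := by
  rw [binaryBasis, Module.Basis.coe_ofEquivFun]
  simp only [LinearEquiv.coe_symm_mk', Submodule.coe_sum, Submodule.coe_smul]
  rw [Finset.sum_eq_single i]
  · simp
  · intro j _ hj
    simp [Pi.single_eq_of_ne hj]
  · simp

lemma trace_symPow (a : ℕ) (g : Matrix (Fin 2) (Fin 2) ℂ) :
    LinearMap.trace ℂ _ (symPow a g) = ∑ i : Fin (a + 1),
      coeff (binaryExponent a i) (substitution g (monomial (binaryExponent a i) 1)) := by
  rw [LinearMap.trace_eq_matrix_trace ℂ (binaryBasis a), Matrix.trace]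
  refine Finset.sum_congr rfl fun i _ ↦ ?_
  rw [Matrix.diag_apply, LinearMap.toMatrix_apply, binaryBasis_repr]
  change coeff _ (substitution g ((binaryBasis a i : homogeneousSubmodule (Fin 2) ℂ a) :
    MvPolynomial (Fin 2) ℂ)) = _
  rw [binaryBasis_apply]

lemma substitution_monomial (g : Matrix (Fin 2) (Fin 2) ℂ) (s : Fin 2 →₀ ℕ) :
    substitution g (monomial s 1) =
      (C (g 0 0) * X 0 + C (g 1 0) * X 1) ^ s 0 * (C (g 0 1) * X 0 + C (g 1 1) * X 1) ^ s 1 := by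
  rw [monomial_eq, Finsupp.prod_fintype _ _ (by simp)]
  simp [substitution, Fin.sum_univ_two]

/-- The image of X_0^i X_1^(a-i) is (g_00 X_0)^i (g_01 X_0 + g_11 X_1)^(a-i). Only the pure X_1 term
of the second factor returns to the same monomial. -/
lemma trace_symPow_of_upper (a : ℕ) {g : Matrix (Fin 2) (Fin 2) ℂ} (hg : g 1 0 = 0) :
    LinearMap.trace ℂ _ (symPow a g) = ∑ i ∈ Finset.range (a + 1), g 0 0 ^ i * g 1 1 ^ (a - i) := by
  rw [trace_symPow, Finset.sum_range]
  refine Finset.sum_congr rfl fun i _ ↦ ?_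
  rw [substitution_monomial, hg, binaryExponent_zero, binaryExponent_one]
  simp only [map_zero, zero_mul, add_zero]
  have h1 : binaryExponent a i = Finsupp.single 0 (i : ℕ) + Finsupp.single 1 (a - i) := rfl
  rw [mul_pow, ← map_pow, mul_assoc, coeff_C_mul, h1, X_pow_eq_monomial,
    coeff_monomial_mul, one_mul]
  congr 1
  rw [add_pow, coeff_sum, Finset.sum_eq_single 0]
  · rw [pow_zero, one_mul, Nat.sub_zero, Nat.choose_zero_right, Nat.cast_one, mul_one, mul_pow,
      ← map_pow, coeff_C_mul, coeff_X_pow, if_pos rfl, mul_one]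
  · intro j _ hj
    rw [mul_pow, mul_pow, ← map_pow, ← map_pow]
    have : C (g 0 1 ^ j) * X 0 ^ j * (C (g 1 1 ^ (a - i - j)) * X 1 ^ (a - i - j)) *
        (((a - i).choose j : ℕ) : MvPolynomial (Fin 2) ℂ) =
        monomial (Finsupp.single 0 j + Finsupp.single 1 (a - i - j))
          (g 0 1 ^ j * g 1 1 ^ (a - i - j) * ((a - i).choose j : ℕ)) := by
      rw [X_pow_eq_monomial, X_pow_eq_monomial, C_mul_monomial, C_mul_monomial, monomial_mul,
        ← map_natCast (C : ℂ →+* MvPolynomial (Fin 2) ℂ), mul_comm _ (C _), C_mul_monomial]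
      congr 1
      ring
    rw [this, coeff_monomial, if_neg]
    intro h
    exact hj (by simpa using DFunLike.congr_fun h 0)
  · simp

/-! ### Characters of the symmetric powers in terms of eigenvalues -/

/-- An eigenvector v becomes the first basis vector: scaled to (1, v_1/v_0) if v_0 ≠ 0, and by
swapping the coordinates otherwise. Diagonalizability is not needed. -/
lemma exists_conj_upper (g : Matrix (Fin 2) (Fin 2) ℂ) :
    ∃ P Q : Matrix (Fin 2) (Fin 2) ℂ, P * Q = 1 ∧ Q * P = 1 ∧ (Q * g * P) 1 0 = 0 := by
  obtain ⟨α, hα⟩ := Module.End.exists_eigenvalue (Matrix.toLin' g)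
  obtain ⟨v, hv⟩ := hα.exists_hasEigenvector
  have hv0 := hv.2
  have hv1 : g.mulVec v = α • v := by simpa using hv.apply_eq_smul
  have e0 : g 0 0 * v 0 + g 0 1 * v 1 = α * v 0 := by
    simpa [Matrix.mulVec, dotProduct, Fin.sum_univ_two] using congrFun hv1 0
  have e1 : g 1 0 * v 0 + g 1 1 * v 1 = α * v 1 := by
    simpa [Matrix.mulVec, dotProduct, Fin.sum_univ_two] using congrFun hv1 1
  by_cases h : v 0 = 0
  · have h1 : v 1 ≠ 0 := fun h1 ↦ hv0 (by ext j; fin_cases j <;> simp [h, h1])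
    have hg : g 0 1 = 0 := by
      rw [h] at e0
      simpa [h1] using e0
    refine ⟨!![0, 1; 1, 0], !![0, 1; 1, 0], ?_, ?_, ?_⟩
    · ext i j; fin_cases i <;> fin_cases j <;> simp
    · ext i j; fin_cases i <;> fin_cases j <;> simp
    · simp only [Matrix.mul_apply, Fin.sum_univ_two]
      simp [hg]
  · refine ⟨!![1, 0; v 1 / v 0, 1], !![1, 0; -(v 1 / v 0), 1], ?_, ?_, ?_⟩
    · ext i j; fin_cases i <;> fin_cases j <;> simp
    · ext i j; fin_cases i <;> fin_cases j <;> simp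
    · simp only [Matrix.mul_apply, Fin.sum_univ_two]
      simp only [Matrix.of_apply, Matrix.cons_val', Matrix.cons_val_zero, Matrix.cons_val_one,
        Matrix.cons_val_fin_one]
      field_simp
      linear_combination v 0 * e1 - v 1 * e0

/-- The trace of the `a`-th symmetric power of an element of `SL(2, ℂ)` in terms of one of its
eigenvalues. -/
lemma exists_trace_symPow_eq {g : Matrix (Fin 2) (Fin 2) ℂ} (hg : g.det = 1) :
    ∃ α β : ℂ, α * β = 1 ∧ α + β = g.trace ∧ ∀ a, LinearMap.trace ℂ _ (symPow a g) =
      ∑ i ∈ Finset.range (a + 1), α ^ i * β ^ (a - i) := by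
  obtain ⟨P, Q, hPQ, hQP, h⟩ := exists_conj_upper g
  refine ⟨(Q * g * P) 0 0, (Q * g * P) 1 1, ?_, ?_, fun a ↦ ?_⟩
  · have hdet : (Q * g * P).det = 1 := by
      rw [Matrix.det_mul, Matrix.det_mul, hg, mul_one, ← Matrix.det_mul, hQP, Matrix.det_one]
    rw [Matrix.det_fin_two, h] at hdet
    simpa using hdet
  · rw [← Matrix.trace_fin_two, Matrix.mul_assoc, Matrix.trace_mul_comm, Matrix.mul_assoc, hPQ,
      Matrix.mul_one]
  · rw [← trace_symPow_of_upper a h, (symPow a).map_mul, LinearMap.trace_mul_comm,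
      ← (symPow a).map_mul, ← Matrix.mul_assoc, hPQ, Matrix.one_mul]

/-- The complete homogeneous symmetric polynomial of degree `a` in two variables. -/
def completeSymm (α β : ℂ) (a : ℕ) : ℂ := ∑ i ∈ Finset.range (a + 1), α ^ i * β ^ (a - i)

lemma completeSymm_zero (α β : ℂ) : completeSymm α β 0 = 1 := by simp [completeSymm]

lemma completeSymm_succ (α β : ℂ) (a : ℕ) :
    completeSymm α β (a + 1) = β * completeSymm α β a + α ^ (a + 1) := by
  rw [completeSymm, Finset.sum_range_succ, completeSymm, Finset.mul_sum, Nat.sub_self, pow_zero,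
    mul_one]
  congr 1
  refine Finset.sum_congr rfl fun i hi ↦ ?_
  rw [Nat.sub_add_comm (Nat.lt_succ_iff.mp (Finset.mem_range.mp hi)), pow_succ]
  ring

/-- The monomials of degree a + b + 1 are split according to whether the exponent of α exceeds a. -/
lemma completeSymm_add_add_one (α β : ℂ) (a b : ℕ) :
    completeSymm α β (a + b + 1) =
      α ^ (a + 1) * completeSymm α β b + β ^ (b + 1) * completeSymm α β a := by
  induction b with
  | zero => rw [add_zero, completeSymm_succ, completeSymm_zero]; ring
  | succ b ih => rw [completeSymm_succ, ← add_assoc, ih, completeSymm_succ]; ring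

/-- The top constituent of Clebsch–Gordan splits off; iteration gives the full rule. -/
lemma completeSymm_succ_mul_succ {α β : ℂ} (h : α * β = 1) (a b : ℕ) :
    completeSymm α β (a + 1) * completeSymm α β (b + 1) =
      completeSymm α β (a + b + 2) + completeSymm α β a * completeSymm α β b := by
  have h1 : completeSymm α β (b + 1) = α * completeSymm α β b + β ^ (b + 1) := by
    have := completeSymm_add_add_one α β 0 b
    rw [completeSymm_zero] at this
    simpa using this
  rw [show a + b + 2 = a + (b + 1) + 1 by ring, completeSymm_add_add_one, h1,
    completeSymm_succ α β a]
  linear_combination completeSymm α β a * completeSymm α β b * h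

lemma completeSymm_mul {α β : ℂ} (h : α * β = 1) (a b : ℕ) :
    completeSymm α β a * completeSymm α β b =
      ∑ i ∈ Finset.range (min a b + 1), completeSymm α β (a + b - 2 * i) := by
  induction a generalizing b with
  | zero => simp [completeSymm_zero]
  | succ a ih =>
    cases b with
    | zero => simp [completeSymm_zero]
    | succ b =>
      rw [completeSymm_succ_mul_succ h, ih, Nat.succ_min_succ,
        Finset.sum_range_succ' _ (min a b).succ]
      rw [add_comm, show a + 1 + (b + 1) - 2 * 0 = a + b + 2 by omega]
      refine congrArg (· + completeSymm α β (a + b + 2)) (Finset.sum_congr rfl fun i _ ↦ ?_)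
      rw [show a + 1 + (b + 1) - 2 * (i + 1) = a + b - 2 * i by omega]

lemma trSym_mk (a : ℕ) (g : SU2) : trSym a (ConjClasses.mk g) =
    LinearMap.trace ℂ _ (symPow a (g : Matrix (Fin 2) (Fin 2) ℂ)) := rfl

lemma det_coe_SU2 (g : SU2) : (g : Matrix (Fin 2) (Fin 2) ℂ).det = 1 :=
  (Matrix.mem_specialUnitaryGroup_iff.mp g.2).2

/-- For a unitary matrix of determinant one the adjoint is the adjugate, and a 2 × 2 adjugate has
the trace of the original matrix; hence α + β is real. -/
lemma exists_trSym_eq (c : ConjClasses SU2) :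
    ∃ α β : ℂ, α * β = 1 ∧ starRingEnd ℂ (α + β) = α + β ∧ ∀ a, trSym a c = completeSymm α β a := by
  obtain ⟨g, rfl⟩ := ConjClasses.mk_surjective c
  obtain ⟨α, β, h, ht, hs⟩ := exists_trace_symPow_eq (det_coe_SU2 g)
  refine ⟨α, β, h, ?_, fun a ↦ by rw [trSym_mk, hs, completeSymm]⟩
  have hg := (Matrix.mem_specialUnitaryGroup_iff.mp g.2).1
  have hinv : star (g : Matrix (Fin 2) (Fin 2) ℂ) = (g : Matrix (Fin 2) (Fin 2) ℂ).adjugate := by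
    have h1 := Matrix.mem_unitaryGroup_iff'.mp hg
    have h2 : (g : Matrix (Fin 2) (Fin 2) ℂ) * (g : Matrix (Fin 2) (Fin 2) ℂ).adjugate = 1 := by
      rw [Matrix.mul_adjugate, det_coe_SU2, one_smul]
    calc _ = star (g : Matrix (Fin 2) (Fin 2) ℂ) * ((g : Matrix (Fin 2) (Fin 2) ℂ) *
          (g : Matrix (Fin 2) (Fin 2) ℂ).adjugate) := by rw [h2, Matrix.mul_one]
      _ = _ := by rw [← Matrix.mul_assoc, h1, Matrix.one_mul]
  rw [ht]
  have h3 : starRingEnd ℂ (g : Matrix (Fin 2) (Fin 2) ℂ).trace =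
      (star (g : Matrix (Fin 2) (Fin 2) ℂ)).trace := (Matrix.trace_conjTranspose _).symm
  rw [h3, hinv, Matrix.adjugate_fin_two, Matrix.trace_fin_two, Matrix.trace_fin_two]
  simp [add_comm]

lemma trSym_zero (c : ConjClasses SU2) : trSym 0 c = 1 := by
  obtain ⟨α, β, -, -, h⟩ := exists_trSym_eq c
  rw [h, completeSymm_zero]

/-- The Clebsch–Gordan formula. -/
lemma trSym_mul (a b : ℕ) (c : ConjClasses SU2) :
    trSym a c * trSym b c = ∑ i ∈ Finset.range (min a b + 1), trSym (a + b - 2 * i) c := by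
  obtain ⟨α, β, h, -, hs⟩ := exists_trSym_eq c
  simp only [hs]
  exact completeSymm_mul h a b

/-- The Chebyshev recursion makes every character an integral polynomial in the real number α + β.
-/
lemma conj_trSym (a : ℕ) (c : ConjClasses SU2) : starRingEnd ℂ (trSym a c) = trSym a c := by
  obtain ⟨α, β, h, ht, hs⟩ := exists_trSym_eq c
  rw [hs]
  have h1 : completeSymm α β 1 = α + β := by simp [completeSymm, Finset.sum_range_succ, add_comm]
  induction a using Nat.strong_induction_on with
  | _ a ih =>
    match a with
    | 0 => simp [completeSymm_zero]
    | 1 => rw [h1, ht]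
    | a + 2 =>
      have hr : completeSymm α β (a + 2) =
          (α + β) * completeSymm α β (a + 1) - completeSymm α β a := by
        have := completeSymm_succ_mul_succ h 0 a
        rw [zero_add, h1, zero_add, completeSymm_zero, one_mul] at this
        rw [this]
        ring
      rw [hr, map_sub, map_mul, ht, ih (a + 1) (by omega), ih a (by omega)]

/-! ### Integration over `SU(2)` -/

lemma continuous_coeff_substitution (P : MvPolynomial (Fin 2) ℂ) (s : Fin 2 →₀ ℕ) :
    Continuous fun g : SU2 ↦ coeff s (substitution (g : Matrix (Fin 2) (Fin 2) ℂ) P) := by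
  induction P using MvPolynomial.induction_on generalizing s with
  | C a => simpa [substitution] using continuous_const
  | add P Q hP hQ =>
    simp only [map_add, coeff_add]
    exact (hP s).add (hQ s)
  | mul_X P j hP =>
    simp only [map_mul, coeff_mul]
    refine continuous_finsetSum _ fun t _ ↦ (hP t.1).mul ?_
    simp only [substitution, aeval_X, coeff_sum, coeff_C_mul]
    refine continuous_finsetSum _ fun i _ ↦ Continuous.mul ?_ continuous_const
    exact (continuous_apply_apply i j).comp continuous_subtype_val

/-- The Haar probability measure on `SU(2)`. -/
abbrev haarSU2 : Measure SU2 := Measure.haarMeasure (⊤ : TopologicalSpace.PositiveCompacts SU2)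

lemma integrable_coeff_substitution (P : MvPolynomial (Fin 2) ℂ) (s : Fin 2 →₀ ℕ) :
    Integrable (fun g : SU2 ↦ coeff s (substitution (g : Matrix (Fin 2) (Fin 2) ℂ) P)) haarSU2 :=
  (continuous_coeff_substitution P s).integrable_of_hasCompactSupport
    (HasCompactSupport.of_compactSpace _)

/-- The average of a binary form of degree `a` over `SU(2)`. -/
def averageForm (a : ℕ) (P : MvPolynomial (Fin 2) ℂ) : MvPolynomial (Fin 2) ℂ :=
  ∑ i : Fin (a + 1), monomial (binaryExponent a i)
    (∫ g : SU2, coeff (binaryExponent a i) (substitution (g : Matrix (Fin 2) (Fin 2) ℂ) P) ∂haarSU2)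

lemma coeff_averageForm {a : ℕ} (P : MvPolynomial (Fin 2) ℂ) {i : ℕ} (hi : i ≤ a) :
    coeff (binaryExponent a i) (averageForm a P) =
      ∫ g : SU2, coeff (binaryExponent a i)
        (substitution (g : Matrix (Fin 2) (Fin 2) ℂ) P) ∂haarSU2 := by
  simp only [averageForm, coeff_sum, coeff_monomial]
  rw [Finset.sum_eq_single ⟨i, Nat.lt_succ_iff.mpr hi⟩]
  · simp
  · intro j _ hj
    rw [if_neg]
    intro h
    exact hj (Fin.ext (by simpa using DFunLike.congr_fun h 0))
  · simp

lemma isHomogeneous_averageForm (a : ℕ) (P : MvPolynomial (Fin 2) ℂ) :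
    (averageForm a P).IsHomogeneous a :=
  IsHomogeneous.sum _ _ _ fun i _ ↦
    isHomogeneous_monomial _ (degree_binaryExponent (Nat.lt_succ_iff.mp i.2))

/-- Substitution by h acts on coefficients by a fixed finite linear map, which passes through the
integral; left invariance of Haar measure absorbs h. -/
lemma substitution_averageForm {a : ℕ} {P : MvPolynomial (Fin 2) ℂ} (hP : P.IsHomogeneous a)
    (h : SU2) :
    substitution (h : Matrix (Fin 2) (Fin 2) ℂ) (averageForm a P) = averageForm a P := by
  have h1 : (substitution (h : Matrix (Fin 2) (Fin 2) ℂ) (averageForm a P)).IsHomogeneous a :=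
    substitution_mem _ a _ (isHomogeneous_averageForm a P)
  rw [sum_coeff_binaryExponent h1, sum_coeff_binaryExponent (isHomogeneous_averageForm a P)]
  refine Finset.sum_congr rfl fun i _ ↦ ?_
  congr 1
  rw [← sum_coeff_binaryExponent (isHomogeneous_averageForm a P),
    coeff_averageForm P (Nat.lt_succ_iff.mp i.2)]
  have h2 : ∀ g : SU2, coeff (binaryExponent a i)
      (substitution ((h * g : SU2) : Matrix (Fin 2) (Fin 2) ℂ) P) =
      ∑ j : Fin (a + 1), coeff (binaryExponent a j)
        (substitution (g : Matrix (Fin 2) (Fin 2) ℂ) P) * coeff (binaryExponent a i)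
          (substitution (h : Matrix (Fin 2) (Fin 2) ℂ) (monomial (binaryExponent a j) 1)) := by
    intro g
    have hgP : (substitution (g : Matrix (Fin 2) (Fin 2) ℂ) P).IsHomogeneous a :=
      substitution_mem _ a _ hP
    rw [Submonoid.coe_mul, substitution_mul, AlgHom.comp_apply]
    conv_lhs => rw [sum_coeff_binaryExponent hgP]
    simp [coeff_sum]
  rw [← integral_mul_left_eq_self (μ := haarSU2) _ h]
  simp only [h2]
  rw [integral_finsetSum _ fun j _ ↦ (integrable_coeff_substitution P _).mul_const _]
  simp only [integral_mul_const]
  conv_lhs => rw [averageForm]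
  rw [map_sum, coeff_sum]
  refine Finset.sum_congr rfl fun j _ ↦ ?_
  rw [← mul_one (∫ g : SU2, _ ∂haarSU2), ← smul_eq_mul, ← smul_monomial, map_smul, coeff_smul,
    smul_eq_mul, smul_eq_mul, mul_one]

/-- The diagonal element of `SU(2)` with eigenvalues `u` and `u⁻¹`. -/
lemma diag_mem_SU2 {u : ℂ} (hu : ‖u‖ = 1) :
    !![u, 0; 0, starRingEnd ℂ u] ∈ Matrix.specialUnitaryGroup (Fin 2) ℂ := by
  have h : u * starRingEnd ℂ u = 1 := by rw [Complex.mul_conj, Complex.normSq_eq_norm_sq, hu]; simp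
  rw [Matrix.mem_specialUnitaryGroup_iff, Matrix.mem_unitaryGroup_iff]
  refine ⟨?_, by simp [Matrix.det_fin_two, h]⟩
  ext i j
  fin_cases i <;> fin_cases j <;>
    simp [Matrix.mul_apply, Fin.sum_univ_two, Matrix.star_apply, h, mul_comm]

lemma rotation_mem_SU2 :
    !![((√2 : ℝ) : ℂ)⁻¹, -((√2 : ℝ) : ℂ)⁻¹; ((√2 : ℝ) : ℂ)⁻¹, ((√2 : ℝ) : ℂ)⁻¹] ∈
      Matrix.specialUnitaryGroup (Fin 2) ℂ := by
  have h : ((√2 : ℝ) : ℂ)⁻¹ * ((√2 : ℝ) : ℂ)⁻¹ = 1 / 2 := by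
    rw [← mul_inv, ← Complex.ofReal_mul, Real.mul_self_sqrt (by norm_num)]
    norm_num
  rw [Matrix.mem_specialUnitaryGroup_iff, Matrix.mem_unitaryGroup_iff]
  refine ⟨?_, by simp only [Matrix.det_fin_two_of]; linear_combination 2 * h⟩
  ext i j
  fin_cases i <;> fin_cases j <;>
    simp [Matrix.mul_apply, Fin.sum_univ_two, Matrix.star_apply] <;> linear_combination 2 * h

/-- Sym^a has no invariants for a ≠ 0: a diagonal element leaves only the middle monomial, and a
rotation by π/4 excludes that one. -/
lemma eq_zero_of_substitution_eq {a : ℕ} (ha : a ≠ 0) {W : MvPolynomial (Fin 2) ℂ}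
    (hW : W.IsHomogeneous a)
    (h : ∀ g : SU2, substitution (g : Matrix (Fin 2) (Fin 2) ℂ) W = W) : W = 0 := by
  have hc : ∀ i ≤ a, 2 * i ≠ a → coeff (binaryExponent a i) W = 0 := by
    intro i hi hia
    -- Order a + 1 separates the exponents 0, …, a, so invariance of X_0^i X_1^(a-i) under diag(u,
    -- ū), that is u^i = u^(a-i), forces i = a - i.
    set u : ℂ := Complex.exp (2 * Real.pi * Complex.I / ((a + 1 : ℕ) : ℂ)) with hu
    have hprim : IsPrimitiveRoot u (a + 1) := Complex.isPrimitiveRoot_exp (a + 1) (by omega)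
    have hnorm : ‖u‖ = 1 := hprim.norm'_eq_one (by omega)
    have huu : u * starRingEnd ℂ u = 1 := by
      rw [Complex.mul_conj, Complex.normSq_eq_norm_sq, hnorm]; simp
    have e := congrArg (coeff (binaryExponent a i)) (h ⟨_, diag_mem_SU2 hnorm⟩)
    conv_lhs at e => rw [sum_coeff_binaryExponent hW]
    simp only [map_sum, map_smul, substitution_monomial, coeff_sum, coeff_smul] at e
    rw [Finset.sum_eq_single ⟨i, Nat.lt_succ_iff.mpr hi⟩] at e
    · simp only [Matrix.of_apply, Matrix.cons_val', Matrix.cons_val_zero, Matrix.cons_val_one,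
        Matrix.cons_val_fin_one, map_zero, zero_mul, add_zero, zero_add, binaryExponent_zero,
        binaryExponent_one, mul_pow, ← map_pow, X_pow_eq_monomial, C_mul_monomial, monomial_mul,
        mul_one, smul_eq_mul] at e
      rw [coeff_monomial, ← binaryExponent, if_pos rfl] at e
      by_contra hne
      have e2 : u ^ i * (starRingEnd ℂ u) ^ (a - i) = 1 := by
        rw [← map_pow]
        exact mul_left_cancel₀ hne (by rw [e, mul_one])
      have e3 : u ^ i = u ^ (a - i) := by
        calc u ^ i = u ^ i * (u * starRingEnd ℂ u) ^ (a - i) := by rw [huu, one_pow, mul_one]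
          _ = u ^ i * (starRingEnd ℂ u) ^ (a - i) * u ^ (a - i) := by rw [mul_pow]; ring
          _ = _ := by rw [e2, one_mul]
      have := hprim.pow_inj (by omega) (by omega) e3
      omega
    · intro j _ hj
      simp only [Matrix.of_apply, Matrix.cons_val', Matrix.cons_val_zero, Matrix.cons_val_one,
        Matrix.cons_val_fin_one, map_zero, zero_mul, add_zero, zero_add, binaryExponent_zero,
        binaryExponent_one, mul_pow, ← map_pow, X_pow_eq_monomial, C_mul_monomial, monomial_mul,
        mul_one, smul_eq_mul]
      rw [coeff_monomial, if_neg, mul_zero]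
      intro h
      exact hj (Fin.ext (by simpa using DFunLike.congr_fun h 0))
    · simp
  by_cases hev : ∃ i, 2 * i = a
  · obtain ⟨i, hi⟩ := hev
    have hW' : W = coeff (binaryExponent a i) W • monomial (binaryExponent a i) 1 := by
      conv_lhs => rw [sum_coeff_binaryExponent hW]
      rw [Finset.sum_eq_single (⟨i, by omega⟩ : Fin (a + 1))]
      · intro j _ hj
        rw [hc j (Nat.lt_succ_iff.mp j.2), zero_smul]
        intro h
        exact hj (Fin.ext (by simp; omega))
      · simp
    -- At (0, 1) the monomial X_0^i X_1^i vanishes since i ≠ 0, while its rotated image has the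
    -- value 2^(-i).
    have e := congrArg (eval ![(0 : ℂ), 1]) (h ⟨_, rotation_mem_SU2⟩)
    have hai : a - i = i := by omega
    have hi0 : i ≠ 0 := by omega
    rw [hW', map_smul, substitution_monomial] at e
    simp [smul_eval, eval_monomial, hai, hi0, Finsupp.prod_fintype, Fin.prod_univ_two] at e
    rw [hW', e, zero_smul]
  · rw [sum_coeff_binaryExponent hW]
    refine Finset.sum_eq_zero fun i _ ↦ ?_
    rw [hc i (Nat.lt_succ_iff.mp i.2) fun h ↦ hev ⟨i, h⟩, zero_smul]

lemma measurable_mk : Measurable (ConjClasses.mk : SU2 → ConjClasses SU2) :=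
  measurable_iff_le_map.mpr le_rfl

lemma continuous_trSym_mk (a : ℕ) : Continuous fun g : SU2 ↦ trSym a (ConjClasses.mk g) := by
  simp only [trSym_mk, trace_symPow]
  exact continuous_finsetSum _ fun i _ ↦ continuous_coeff_substitution _ _

lemma measurable_trSym (a : ℕ) : Measurable (trSym a) :=
  fun _ hs ↦ (continuous_trSym_mk a).measurable hs

/-- Orthogonality of the nontrivial irreducible characters of `SU(2)` to the trivial one. -/
lemma integral_trSym {a : ℕ} (ha : a ≠ 0) : ∫ c, trSym a c ∂satoTate = 0 := by
  rw [satoTate, integral_map measurable_mk.aemeasurable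
    (measurable_trSym a).aestronglyMeasurable]
  simp only [trSym_mk, trace_symPow]
  rw [integral_finsetSum _ fun i _ ↦ integrable_coeff_substitution _ _]
  refine Finset.sum_eq_zero fun i _ ↦ ?_
  have hi : (i : ℕ) ≤ a := Nat.lt_succ_iff.mp i.2
  have hm : (monomial (binaryExponent a i) (1 : ℂ)).IsHomogeneous a :=
    isHomogeneous_monomial _ (degree_binaryExponent hi)
  rw [← coeff_averageForm _ hi, eq_zero_of_substitution_eq ha (isHomogeneous_averageForm a _)
    (substitution_averageForm hm), coeff_zero]

end HeckeMoments

end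

open scoped MatrixGroups UpperHalfPlane

noncomputable section

namespace HeckeMoments

open MeasureTheory ProbabilityTheory

/-! ### The random multiplicative function -/

lemma randomX_eq_factorization_prod (g : Nat.Primes → ConjClasses SU2) (n : ℕ) :
    randomX g n = n.factorization.prod fun p a ↦
      if hp : p.Prime then trSym a (g ⟨p, hp⟩) else 1 := by
  rw [randomX, Finsupp.prod, Nat.support_factorization, ← Finset.prod_attach n.primeFactors]
  exact Finset.prod_congr rfl fun p _ ↦ by rw [dif_pos (Nat.prime_of_mem_primeFactors p.2)]

lemma isHeckeMultiplicative_randomX (g : Nat.Primes → ConjClasses SU2) :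
    IsHeckeMultiplicative (randomX g) := by
  have := isHeckeMultiplicative_of_prime_pow
    (S := fun p a ↦ if hp : p.Prime then trSym a (g ⟨p, hp⟩) else 1) (fun p ↦ ?_)
    (fun p hp a b ↦ ?_)
  · simpa only [← randomX_eq_factorization_prod] using this
  · by_cases hp : p.Prime <;> simp [hp, trSym_zero]
  · simp only [hp, dif_pos]
    exact trSym_mul a b _

lemma conj_randomX (g : Nat.Primes → ConjClasses SU2) (n : ℕ) :
    starRingEnd ℂ (randomX g n) = randomX g n := by
  simp [randomX, map_prod, conj_trSym]

variable {Ω : Type*} [MeasurableSpace Ω] {μ : Measure Ω} [IsProbabilityMeasure μ]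
  {g : Nat.Primes → Ω → ConjClasses SU2}

lemma exists_norm_trSym_le (a : ℕ) : ∃ K, ∀ c, ‖trSym a c‖ ≤ K := by
  obtain ⟨K, hK⟩ := isCompact_univ.exists_bound_of_continuousOn
    (continuous_trSym_mk a).continuousOn
  refine ⟨K, fun c ↦ ?_⟩
  obtain ⟨x, rfl⟩ := ConjClasses.mk_surjective c
  exact hK x trivial

lemma integrable_randomX (hg : ∀ p, Measurable (g p)) (n : ℕ) :
    Integrable (fun ω ↦ randomX (fun p ↦ g p ω) n) μ := by
  choose K hK using exists_norm_trSym_le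
  have hm : Measurable fun ω ↦ randomX (fun p ↦ g p ω) n :=
    Finset.measurable_prod _ fun p _ ↦ (measurable_trSym _).comp (hg _)
  refine Integrable.of_bound hm.aestronglyMeasurable
    (∏ p ∈ n.primeFactors.attach, K (n.factorization p)) (ae_of_all _ fun ω ↦ ?_)
  rw [randomX, norm_prod]
  exact Finset.prod_le_prod (fun _ _ ↦ norm_nonneg _) fun p _ ↦ hK _ _

/-- The expectation of `X(n)` is `1` if `n = 1` and `0` otherwise. -/
lemma integral_randomX (hg : ∀ p, Measurable (g p)) (hind : iIndepFun g μ)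
    (hdist : ∀ p, μ.map (g p) = satoTate) {n : ℕ} (hn : n ≠ 0) :
    ∫ ω, randomX (fun p ↦ g p ω) n ∂μ = if n = 1 then 1 else 0 := by
  split_ifs with h1
  · simp [h1, (isHeckeMultiplicative_randomX _).map_one]
  · let q : n.primeFactors → Nat.Primes := fun p ↦ ⟨p, Nat.prime_of_mem_primeFactors p.2⟩
    have hq : Function.Injective q := fun a b h ↦
      Subtype.ext (congrArg (fun r : Nat.Primes ↦ (r : ℕ)) h)
    have h2 : ∀ ω, randomX (fun p ↦ g p ω) n =
        ∏ p : n.primeFactors, trSym (n.factorization p) (g (q p) ω) := fun ω ↦ rfl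
    simp only [h2]
    have hi : iIndepFun (fun (p : n.primeFactors) ω ↦ trSym (n.factorization p) (g (q p) ω)) μ :=
      (hind.precomp hq).comp (fun p ↦ trSym (n.factorization p)) fun p ↦ measurable_trSym _
    rw [hi.integral_fun_prod_eq_prod_integral
      fun p ↦ ((measurable_trSym _).comp (hg _)).aestronglyMeasurable]
    obtain ⟨p, hp⟩ := Nat.nonempty_primeFactors.mpr
      (show 1 < n by omega)
    -- One prime factor of n suffices: its exponent is positive, so its character has mean zero.
    refine Finset.prod_eq_zero (Finset.mem_univ ⟨p, hp⟩) ?_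
    have ha : n.factorization p ≠ 0 :=
      ((Nat.prime_of_mem_primeFactors hp).factorization_pos_of_dvd hn
        (Nat.dvd_of_mem_primeFactors hp)).ne'
    have := integral_trSym ha
    rwa [← hdist (q ⟨p, hp⟩), integral_map (hg _).aemeasurable
      (measurable_trSym _).aestronglyMeasurable] at this

end HeckeMoments

end

open scoped MatrixGroups UpperHalfPlane

noncomputable section

namespace HeckeMoments

open UpperHalfPlane EisensteinSeries ModularGroup

open scoped ModularForm Manifold Matrix

/-! ### Poincaré series -/

/-- The set of primitive integral vectors. -/
abbrev Primitive : Type := gammaSet 1 1 (0 : Fin 2 → ZMod 1)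

lemma exists_row_eq (v : Primitive) : ∃ γ : SL(2, ℤ), γ 1 = v.1 := by
  obtain ⟨γ, -, h⟩ := bottom_row_surj ((mem_gammaSet_one v.1).mp v.2)
  exact ⟨γ, h⟩

/-- An element of `SL(2, ℤ)` with a given primitive bottom row. -/
def completeRow (v : Primitive) : SL(2, ℤ) := (exists_row_eq v).choose

lemma completeRow_one (v : Primitive) : completeRow v 1 = v.1 := (exists_row_eq v).choose_spec

/-- The bottom row of an element of `SL(2, ℤ)`. -/
def bottomRow (γ : SL(2, ℤ)) : Primitive :=
  ⟨γ 1, (mem_gammaSet_one _).mpr (bottom_row_coprime γ)⟩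

lemma bottomRow_completeRow (v : Primitive) : bottomRow (completeRow v) = v :=
  Subtype.ext (completeRow_one v)

lemma bottomRow_mul (γ δ : SL(2, ℤ)) : (bottomRow (γ * δ)).1 = (bottomRow γ).1 ᵥ* δ.1 := by
  ext j
  simp [bottomRow, Matrix.mul_apply, Matrix.vecMul, dotProduct]

lemma exists_eq_T_zpow_mul {γ δ : SL(2, ℤ)} (h : γ 1 = δ 1) : ∃ t : ℤ, γ = T ^ t * δ := by
  have hγ := γ.det_coe
  have hδ := δ.det_coe
  rw [Matrix.det_fin_two] at hγ hδ
  have h0 : γ 1 0 = δ 1 0 := congrFun h 0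
  have h1 : γ 1 1 = δ 1 1 := congrFun h 1
  rw [h0, h1] at hγ
  -- The upper right entry of γδ⁻¹.
  refine ⟨γ 0 1 * δ 0 0 - γ 0 0 * δ 0 1, ?_⟩
  ext i j
  rw [Matrix.SpecialLinearGroup.coe_mul, coe_T_zpow, Matrix.mul_apply, Fin.sum_univ_two]
  fin_cases i <;> fin_cases j <;> simp [h0, h1]
  · linear_combination δ 0 0 * hγ - γ 0 0 * hδ
  · linear_combination δ 0 1 * hγ - γ 0 1 * hδ

/-- The function `z ↦ e(mz)` on the upper half-plane. -/
def expFun (m : ℕ) (z : ℍ) : ℂ := Function.Periodic.qParam 1 z ^ m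

lemma norm_expFun_le_one (m : ℕ) (z : ℍ) : ‖expFun m z‖ ≤ 1 := by
  rw [expFun, norm_pow]
  exact pow_le_one₀ (norm_nonneg _) (Function.Periodic.norm_qParam_lt_one one_pos z.im_pos).le

lemma expFun_T_zpow_smul (m : ℕ) (t : ℤ) (z : ℍ) : expFun m (T ^ t • z) = expFun m z := by
  have h : Function.Periodic.qParam 1 ((T ^ t • z : ℍ) : ℂ) =
      Function.Periodic.qParam 1 (z : ℂ) := by
    rw [coe_T_zpow_smul_eq, Function.Periodic.qParam, Function.Periodic.qParam,
      Complex.exp_eq_exp_iff_exists_int]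
    exact ⟨t, by simp; ring⟩
  rw [expFun, h, expFun]

lemma slash_expFun_apply (k : ℤ) (m : ℕ) (γ : SL(2, ℤ)) (z : ℍ) :
    (expFun m ∣[k] γ) z = eisSummand k (γ 1) z * expFun m (γ • z) := by
  rw [ModularForm.SL_slash_apply, mul_comm, eisSummand]
  congr 2

/-- The terms of the Poincaré series depend on the bottom row only, so the arbitrary choice in
`completeRow` is harmless. -/
lemma slash_expFun_eq {k : ℤ} {m : ℕ} {γ δ : SL(2, ℤ)} (h : γ 1 = δ 1) :
    expFun m ∣[k] γ = expFun m ∣[k] δ := by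
  obtain ⟨t, rfl⟩ := exists_eq_T_zpow_mul h
  ext z
  rw [slash_expFun_apply, slash_expFun_apply, h, mul_smul, expFun_T_zpow_smul]

/-- Since |e(mz)| ≤ 1, convergence is inherited from the Eisenstein series of the same weight. -/
lemma norm_slash_expFun_le (k : ℤ) (m : ℕ) (γ : SL(2, ℤ)) (z : ℍ) :
    ‖(expFun m ∣[k] γ) z‖ ≤ ‖eisSummand k (γ 1) z‖ := by
  rw [slash_expFun_apply, norm_mul]
  exact mul_le_of_le_one_right (norm_nonneg _) (norm_expFun_le_one _ _)

/-- The Poincaré series `∑_{γ ∈ Γ_∞ \ SL(2, ℤ)} e(m ·)|_k γ`. -/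
def poincare (k : ℤ) (m : ℕ) (z : ℍ) : ℂ := ∑' v : Primitive, (expFun m ∣[k] completeRow v) z

lemma summable_norm_slash_expFun {k : ℤ} (hk : 3 ≤ k) (m : ℕ) (z : ℍ) :
    Summable fun v : Primitive ↦ ‖(expFun m ∣[k] completeRow v) z‖ := by
  refine ((summable_norm_eisSummand hk z).subtype (gammaSet 1 1 0)).of_nonneg_of_le
    (fun _ ↦ norm_nonneg _) fun v ↦ ?_
  have := norm_slash_expFun_le k m (completeRow v) z
  rwa [completeRow_one] at this

lemma summable_slash_expFun {k : ℤ} (hk : 3 ≤ k) (m : ℕ) (z : ℍ) :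
    Summable fun v : Primitive ↦ (expFun m ∣[k] completeRow v) z :=
  (summable_norm_slash_expFun hk m z).of_norm

/-- Right multiplication by an element of `SL(2, ℤ)` on primitive vectors. -/
def primitiveEquiv (γ : SL(2, ℤ)) : Primitive ≃ Primitive :=
  (gammaSetEquiv 0 γ).trans (gammaSet_one_equiv 1 _ _)

lemma primitiveEquiv_apply (γ : SL(2, ℤ)) (v : Primitive) : (primitiveEquiv γ v).1 = v.1 ᵥ* γ.1 :=
  rfl

lemma poincare_slash (k : ℤ) (m : ℕ) (γ : SL(2, ℤ)) : poincare k m ∣[k] γ = poincare k m := by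
  ext z
  have h1 : ∀ v : Primitive, (expFun m ∣[k] completeRow v) (γ • z) * denom γ z ^ (-k) =
      (expFun m ∣[k] completeRow (primitiveEquiv γ v)) z := by
    intro v
    rw [← ModularForm.SL_slash_apply, ← SlashAction.slash_mul]
    refine congrFun (slash_expFun_eq ?_) z
    rw [completeRow_one, primitiveEquiv_apply, ← completeRow_one v]
    exact bottomRow_mul _ _
  rw [ModularForm.SL_slash_apply, poincare, poincare, ← tsum_mul_right, tsum_congr h1]
  exact (primitiveEquiv γ).tsum_eq fun v ↦ (expFun m ∣[k] completeRow v) z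

lemma mdifferentiable_expFun (m : ℕ) : MDiff (expFun m) := by
  intro z
  rw [mdifferentiableAt_iff]
  have : DifferentiableAt ℂ (fun w : ℂ ↦ Function.Periodic.qParam 1 w ^ m) z :=
    (Function.Periodic.differentiable_qParam.differentiableAt).pow m
  refine this.congr_of_eventuallyEq ?_
  filter_upwards [isOpen_upperHalfPlaneSet.mem_nhds z.2] with w hw
  simp [expFun, ofComplex_apply_of_im_pos hw]

lemma poincare_tendstoLocallyUniformly {k : ℤ} (hk : 3 ≤ k) (m : ℕ) :
    TendstoLocallyUniformly (fun (s : Finset Primitive) z ↦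
      ∑ v ∈ s, (expFun m ∣[k] completeRow v) z) (poincare k m) Filter.atTop := by
  have hk' : (2 : ℝ) < k := by norm_cast
  have p_sum : Summable fun x : Primitive ↦ ‖x.val‖ ^ (-k) :=
    mod_cast (summable_one_div_norm_rpow hk').subtype (· ∈ gammaSet 1 1 0)
  rw [tendstoLocallyUniformly_iff_forall_isCompact]
  intro K hK
  obtain ⟨A, B, hB, HABK⟩ := subset_verticalStrip_of_isCompact hK
  refine (tendstoUniformlyOn_tsum (hu := p_sum.mul_left <| r ⟨⟨A, B⟩, hB⟩ ^ (-k : ℝ))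
    (fun p z hz ↦ ?_)).mono HABK
  refine (norm_slash_expFun_le k m _ z).trans ?_
  rw [completeRow_one]
  simpa only [eisSummand, one_div, ← zpow_neg, norm_zpow, ← Real.rpow_intCast,
    Int.cast_neg] using summand_bound_of_mem_verticalStrip (by positivity) p.1 hB hz

lemma mdifferentiable_poincare {k : ℤ} (hk : 3 ≤ k) (m : ℕ) : MDiff (poincare k m) := by
  have h1 : TendstoLocallyUniformlyOn (fun (s : Finset Primitive) ↦
      (fun z ↦ ∑ v ∈ s, (expFun m ∣[k] completeRow v) z) ∘ ofComplex)
      (poincare k m ∘ ofComplex) Filter.atTop {z : ℂ | 0 < z.im} := by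
    rw [← upperHalfPlaneSet, ← range_coe, ← Set.image_univ]
    apply TendstoLocallyUniformlyOn.comp (s := ⊤) _ _ _ (OpenPartialHomeomorph.continuousOn_symm _)
    · simp only [Set.top_eq_univ, tendstoLocallyUniformlyOn_univ]
      exact poincare_tendstoLocallyUniformly hk m
    · simp only [Topology.IsOpenEmbedding.toOpenPartialHomeomorph_target, Set.top_eq_univ,
        Set.mapsTo_range_iff, Set.mem_univ, forall_const]
  rw [mdifferentiable_iff]
  refine h1.differentiableOn (Filter.Eventually.of_forall fun s ↦ ?_) isOpen_upperHalfPlaneSet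
  exact DifferentiableOn.fun_sum fun v _ ↦
    mdifferentiable_iff.mp ((mdifferentiable_expFun m).slash k (completeRow v : GL (Fin 2) ℝ))

/-! ### Small cell, large cell and cuspidality -/

lemma slash_expFun_completeRow_of_eq_zero {k : ℤ} (hk : Even k) (m : ℕ) {v : Primitive}
    (hv : v.1 0 = 0) (z : ℍ) : (expFun m ∣[k] completeRow v) z = expFun m z := by
  have h1 : v.1 1 = 1 ∨ v.1 1 = -1 := by
    have := (mem_gammaSet_one v.1).mp v.2
    rw [hv, isCoprime_zero_left] at this
    exact Int.isUnit_iff.mp this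
  rcases h1 with h1 | h1
  · have : completeRow v 1 = (1 : SL(2, ℤ)) 1 := by
      rw [completeRow_one]
      ext j
      fin_cases j <;> simp [hv, h1]
    rw [slash_expFun_eq this, SlashAction.slash_one]
  · have : completeRow v 1 = (-1 : SL(2, ℤ)) 1 := by
      rw [completeRow_one]
      ext j
      fin_cases j <;> simp [hv, h1]
    rw [slash_expFun_eq this, slash_expFun_apply, ModularGroup.SL_neg_smul, one_smul, eisSummand]
    simp [hk.neg_one_zpow]

/-- Four of the k powers of |cz + d| secure convergence with a constant independent of k and m. The
other k - 4 are bounded through |cz + d| ≥ Im z, valid as c ≠ 0, and give the decay in k. -/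
lemma tsum_norm_slash_expFun_compl_le {k : ℤ} (hk : 4 ≤ k) (m : ℕ) {z : ℍ}
    (hre : |z.re| ≤ 1) (him : 1 ≤ z.im) :
    ∑' v : {v : Primitive // v.1 0 ≠ 0}, ‖(expFun m ∣[k] completeRow v.1) z‖ ≤
      (∑' x : Fin 2 → ℤ, r ⟨⟨1, 1⟩, one_pos⟩ ^ (-4 : ℝ) * ‖x‖ ^ (-4 : ℝ)) * z.im ^ (4 - k) := by
  set G : (Fin 2 → ℤ) → ℝ := fun x ↦ r ⟨⟨1, 1⟩, one_pos⟩ ^ (-4 : ℝ) * ‖x‖ ^ (-4 : ℝ) with hG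
  have hGs : Summable G := (summable_one_div_norm_rpow (by norm_num)).mul_left _
  have hG0 : ∀ x, 0 ≤ G x := fun x ↦
    mul_nonneg (Real.rpow_nonneg (r_pos _).le _) (Real.rpow_nonneg (norm_nonneg _) _)
  have hterm : ∀ v : {v : Primitive // v.1 0 ≠ 0},
      ‖(expFun m ∣[k] completeRow v.1) z‖ ≤ G v.1.1 * z.im ^ (4 - k) := by
    intro v
    refine (norm_slash_expFun_le k m _ z).trans ?_
    rw [completeRow_one, eisSummand, norm_zpow]
    have h1 : z.im ≤ ‖(v.1.1 0 : ℂ) * z + v.1.1 1‖ := by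
      refine le_trans ?_ (Complex.abs_im_le_norm _)
      have : ((v.1.1 0 : ℂ) * z + v.1.1 1).im = v.1.1 0 * z.im := by simp
      rw [this, abs_mul, abs_of_pos z.im_pos]
      refine le_mul_of_one_le_left z.im_pos.le ?_
      exact_mod_cast Int.one_le_abs v.2
    have h0 : 0 < ‖(v.1.1 0 : ℂ) * z + v.1.1 1‖ := z.im_pos.trans_le h1
    have h2 := summand_bound_of_mem_verticalStrip (k := 4) (by norm_num) v.1.1 one_pos
      (show z ∈ verticalStrip 1 1 from ⟨hre, him⟩)
    have h3 : ‖(v.1.1 0 : ℂ) * z + v.1.1 1‖ ^ (4 - k) ≤ z.im ^ (4 - k) :=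
      by
      rw [← neg_sub, zpow_neg, zpow_neg]
      exact inv_anti₀ (zpow_pos z.im_pos _) (zpow_le_zpow_left₀ (by omega) z.im_pos.le h1)
    calc ‖(v.1.1 0 : ℂ) * z + v.1.1 1‖ ^ (-k)
        = ‖(v.1.1 0 : ℂ) * z + v.1.1 1‖ ^ (-4 : ℝ) * ‖(v.1.1 0 : ℂ) * z + v.1.1 1‖ ^ (4 - k) := by
          rw [← Real.rpow_intCast, ← Real.rpow_intCast, ← Real.rpow_add h0]
          congr 1
          push_cast
          ring
      _ ≤ _ := mul_le_mul h2 h3 (zpow_nonneg h0.le _) (hG0 _)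
  have hinj : Function.Injective fun v : {v : Primitive // v.1 0 ≠ 0} ↦ v.1.1 :=
    Subtype.val_injective.comp Subtype.val_injective
  have hs : Summable fun v : {v : Primitive // v.1 0 ≠ 0} ↦ G v.1.1 * z.im ^ (4 - k) :=
    (hGs.comp_injective hinj).mul_right _
  calc _ ≤ ∑' v : {v : Primitive // v.1 0 ≠ 0}, G v.1.1 * z.im ^ (4 - k) :=
        ((summable_norm_slash_expFun (by omega) m z).subtype _).tsum_le_tsum hterm hs
    _ = (∑' v : {v : Primitive // v.1 0 ≠ 0}, G v.1.1) * z.im ^ (4 - k) := tsum_mul_right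
    _ ≤ _ := mul_le_mul_of_nonneg_right (tsum_comp_le_tsum_of_inj hGs hG0 hinj)
        (zpow_nonneg z.im_pos.le _)

/-- The series runs over all rows, not rows up to sign: (0, 1) and (0, -1) both contribute e(mz),
whence the factor 2. -/
lemma poincare_eq_add_tsum {k : ℤ} (hk : 3 ≤ k) (hev : Even k) (m : ℕ) (z : ℍ) :
    poincare k m z = 2 * expFun m z +
      ∑' v : {v : Primitive // v.1 0 ≠ 0}, (expFun m ∣[k] completeRow v.1) z := by
  have hs := summable_slash_expFun hk m z
  set S : Set Primitive := {v | v.1 0 = 0} with hS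
  have h1 := Summable.tsum_add_tsum_compl (f := fun v : Primitive ↦
    (expFun m ∣[k] completeRow v) z) (s := S) (hs.subtype _) (hs.subtype _)
  rw [poincare, ← h1]
  refine congrArg₂ _ ?_ rfl
  let e : Fin 2 → S := ![⟨⟨![0, 1], (mem_gammaSet_one _).mpr isCoprime_one_right⟩, by simp [hS]⟩,
    ⟨⟨![0, -1], (mem_gammaSet_one _).mpr isCoprime_one_right.neg_right⟩, by simp [hS]⟩]
  have he : Function.Bijective e := by
    constructor
    · intro i j hij
      have h := congrArg (fun v : S ↦ v.1.1 1) hij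
      fin_cases i <;> fin_cases j <;> simp [e] at h ⊢
    · rintro ⟨v, hv⟩
      have h1 : v.1 1 = 1 ∨ v.1 1 = -1 := by
        have := (mem_gammaSet_one v.1).mp v.2
        rw [show v.1 0 = 0 from hv, isCoprime_zero_left] at this
        exact Int.isUnit_iff.mp this
      rcases h1 with h1 | h1
      · refine ⟨0, Subtype.ext (Subtype.ext (funext fun j ↦ ?_))⟩
        fin_cases j
        · exact (show v.1 0 = 0 from hv).symm
        · exact h1.symm
      · refine ⟨1, Subtype.ext (Subtype.ext (funext fun j ↦ ?_))⟩
        fin_cases j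
        · exact (show v.1 0 = 0 from hv).symm
        · exact h1.symm
  rw [← (Equiv.ofBijective e he).tsum_eq, tsum_fintype, Fin.sum_univ_two,
    slash_expFun_completeRow_of_eq_zero hev m (Equiv.ofBijective e he 0).2,
    slash_expFun_completeRow_of_eq_zero hev m (Equiv.ofBijective e he 1).2]
  ring

/-- An absolute constant bounding the contribution of the large cell to the Poincaré series. -/
def cellBound : ℝ := ∑' x : Fin 2 → ℤ, r ⟨⟨1, 1⟩, one_pos⟩ ^ (-4 : ℝ) * ‖x‖ ^ (-4 : ℝ)

lemma norm_poincare_sub_le {k : ℤ} (hk : 4 ≤ k) (hev : Even k) (m : ℕ) {z : ℍ}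
    (hre : |z.re| ≤ 1) (him : 1 ≤ z.im) :
    ‖poincare k m z - 2 * expFun m z‖ ≤ cellBound * z.im ^ (4 - k) := by
  rw [poincare_eq_add_tsum (by omega) hev, add_sub_cancel_left]
  exact (norm_tsum_le_tsum_norm ((summable_norm_slash_expFun (by omega) m z).subtype _)).trans
    (tsum_norm_slash_expFun_compl_le hk m hre him)

lemma poincare_T_zpow_smul (k : ℤ) (m : ℕ) (t : ℤ) (z : ℍ) :
    poincare k m (T ^ t • z) = poincare k m z := by
  have h := congrFun (poincare_slash k m (T ^ t)) z
  rw [ModularForm.SL_slash_apply] at h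
  have hd : denom (T ^ t : SL(2, ℤ)) z = 1 := by
    rw [ModularGroup.denom_apply, coe_T_zpow]
    simp
  rwa [hd, one_zpow, mul_one] at h

lemma isZeroAtImInfty_poincare {k : ℤ} (hk : 6 ≤ k) (hev : Even k) {m : ℕ} (hm : m ≠ 0) :
    IsZeroAtImInfty (poincare k m) := by
  have hbound : ∀ z : ℍ, 1 ≤ z.im → ‖poincare k m z‖ ≤
      2 * Real.exp (-2 * Real.pi * z.im) + cellBound * z.im ^ (4 - k) := by
    intro z hz
    -- Translation changes neither the series nor Im z, and reaches the range of Re z in which the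
    -- large cell is bounded.
    obtain ⟨n, hn⟩ := ModularGroup_T_zpow_mem_verticalStrip z one_pos
    set w := T ^ ((1 : ℕ) * n) • z with hw
    have him : w.im = z.im := im_T_zpow_smul z _
    have h1 := norm_poincare_sub_le (by omega) hev m (z := w) (by simpa using hn.1) (him ▸ hz)
    rw [← poincare_T_zpow_smul k m ((1 : ℕ) * n) z, ← hw]
    have h2 : ‖expFun m w‖ ≤ Real.exp (-2 * Real.pi * z.im) := by
      rw [expFun, norm_pow]
      refine (pow_le_of_le_one (norm_nonneg _)
        (Function.Periodic.norm_qParam_lt_one one_pos w.im_pos).le hm).trans ?_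
      rw [Function.Periodic.norm_qParam, div_one, coe_im, him]
    calc ‖poincare k m w‖ = ‖2 * expFun m w + (poincare k m w - 2 * expFun m w)‖ := by ring_nf
      _ ≤ ‖2 * expFun m w‖ + ‖poincare k m w - 2 * expFun m w‖ := norm_add_le _ _
      _ ≤ _ := by
        rw [norm_mul, Complex.norm_ofNat]
        rw [him] at h1
        gcongr
  have h0 : Filter.Tendsto (fun y : ℝ ↦ 2 * Real.exp (-2 * Real.pi * y) + cellBound * y ^ (4 - k))
      Filter.atTop (nhds 0) := by
    have h1 : Filter.Tendsto (fun y : ℝ ↦ Real.exp (-2 * Real.pi * y)) Filter.atTop (nhds 0) :=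
      Real.tendsto_exp_atBot.comp (Filter.tendsto_id.const_mul_atTop_of_neg
        (by linarith [Real.pi_pos]))
    have h2 : Filter.Tendsto (fun y : ℝ ↦ y ^ (4 - k)) Filter.atTop (nhds 0) :=
      tendsto_zpow_atTop_zero (by omega)
    simpa using (h1.const_mul 2).add (h2.const_mul cellBound)
  refine squeeze_zero_norm' ?_ (h0.comp Filter.tendsto_comap)
  have : ∀ᶠ z : ℍ in atImInfty, 1 ≤ z.im := Filter.tendsto_comap.eventually_ge_atTop 1
  filter_upwards [this] with z hz
  exact hbound z hz

/-- The Poincaré series as a cusp form. -/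
def poincareForm {k : ℕ} (hk : 6 ≤ k) (hev : Even k) {m : ℕ} (hm : m ≠ 0) :
    CuspForm 𝒮ℒ (k : ℤ) where
  toFun := poincare k m
  slash_action_eq' A hA := by
    obtain ⟨γ, rfl⟩ := hA
    exact poincare_slash k m γ
  holo' := mdifferentiable_poincare (by omega) m
  zero_at_cusps' {c} hc := by
    rw [Subgroup.IsArithmetic.isCusp_iff_isCusp_SL2Z] at hc
    rw [OnePoint.isZeroAt_iff_forall_SL2Z hc]
    intro γ _
    rw [poincare_slash]
    exact isZeroAtImInfty_poincare (by omega) (mod_cast hev) hm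

lemma poincareForm_apply {k : ℕ} (hk : 6 ≤ k) (hev : Even k) {m : ℕ} (hm : m ≠ 0) (z : ℍ) :
    poincareForm hk hev hm z = poincare k m z := rfl

end HeckeMoments

end

open scoped MatrixGroups UpperHalfPlane

noncomputable section

namespace HeckeMoments

open UpperHalfPlane EisensteinSeries ModularGroup

open scoped ModularForm Manifold Matrix

/-! ### Fourier coefficients -/

/-- The `n`-th Fourier coefficient as a linear functional on cusp forms. -/
def fourierCoeff {k : ℕ} (n : ℕ) : CuspForm 𝒮ℒ (k : ℤ) →ₗ[ℂ] ℂ where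
  toFun f := (qExpansion 1 f).coeff n
  map_add' f g := by
    rw [FunLike.coe_add, ModularForm.qExpansion_add one_pos one_mem_strictPeriods_SL, map_add]
  map_smul' c f := by
    rw [FunLike.coe_smul, ModularForm.qExpansion_smul one_pos one_mem_strictPeriods_SL]
    rfl

lemma fourierCoeff_apply {k : ℕ} (n : ℕ) (f : CuspForm 𝒮ℒ (k : ℤ)) :
    fourierCoeff n f = (qExpansion 1 f).coeff n := rfl

lemma fourierCoeff_zero {k : ℕ} (f : CuspForm 𝒮ℒ (k : ℤ)) : fourierCoeff 0 f = 0 :=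
  CuspFormClass.qExpansion_coeff_zero f one_pos one_mem_strictPeriods_SL

lemma hasSum_fourierCoeff {k : ℕ} (f : CuspForm 𝒮ℒ (k : ℤ)) (z : ℍ) :
    HasSum (fun n ↦ fourierCoeff n f * expFun n z) (f z) :=
  ModularForm.hasSum_qExpansion f one_pos one_mem_strictPeriods_SL z

lemma eq_zero_of_fourierCoeff {k : ℕ} {f : CuspForm 𝒮ℒ (k : ℤ)}
    (hf : ∀ n, n ≠ 0 → fourierCoeff n f = 0) : f = 0 := by
  ext z
  have h := hasSum_fourierCoeff f z
  have h0 : ∀ n, fourierCoeff n f = 0 := fun n ↦ by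
    by_cases hn : n = 0
    · rw [hn, fourierCoeff_zero]
    · exact hf n hn
  simp only [h0, zero_mul] at h
  simpa using h.unique hasSum_zero

lemma fourierCoeff_eq_of_hasSum {k : ℕ} {f : CuspForm 𝒮ℒ (k : ℤ)} {c : ℕ → ℂ}
    (h : ∀ z : ℍ, HasSum (fun n ↦ c n * expFun n z) (f z)) (n : ℕ) : fourierCoeff n f = c n :=
  (qExpansion_coeff_unique f one_pos
    (ModularFormClass.analyticAt_cuspFunction_zero f one_pos one_mem_strictPeriods_SL) h n).symm

lemma periodic_expFun (m : ℕ) : Function.Periodic (expFun m ∘ ofComplex) (1 : ℝ) := by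
  intro w
  by_cases hw : 0 < w.im
  · have hw' : 0 < (w + (1 : ℝ)).im := by simpa using hw
    have h := expFun_T_zpow_smul m 1 ⟨w, hw⟩
    simp only [Function.comp_apply, ofComplex_apply_of_im_pos hw, ofComplex_apply_of_im_pos hw']
    rw [← h]
    congr 1
    ext
    rw [coe_T_zpow_smul_eq]
    simp
  · have hw' : ¬ 0 < (w + (1 : ℝ)).im := by simpa using hw
    simp only [Function.comp_apply, ofComplex_apply_of_im_nonpos (not_lt.mp hw),
      ofComplex_apply_of_im_nonpos (not_lt.mp hw')]

lemma isBoundedAtImInfty_expFun (m : ℕ) : IsBoundedAtImInfty (expFun m) :=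
  isBoundedAtImInfty_iff.mpr ⟨1, 0, fun z _ ↦ norm_expFun_le_one m z⟩

lemma qExpansion_expFun_coeff (m n : ℕ) :
    (qExpansion 1 (expFun m)).coeff n = if n = m then 1 else 0 := by
  let _ : FunLike (ℍ → ℂ) ℍ ℂ := ⟨id, fun _ _ h ↦ h⟩
  have := qExpansion_coeff_unique (h := 1) (expFun m) (c := fun n ↦ if n = m then 1 else 0) one_pos
    (analyticAt_cuspFunction_zero (f := expFun m) one_pos (periodic_expFun m)
      (mdifferentiable_expFun m) (isBoundedAtImInfty_expFun m)) (fun z ↦ ?_) n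
  · exact this.symm
  · have h := hasSum_ite_eq m (expFun m z)
    refine h.congr_fun fun n ↦ ?_
    by_cases hn : n = m
    · simp [hn, expFun]
    · simp [hn]

/-- The Fourier coefficients of the Poincaré series: main term and error term. -/
lemma norm_fourierCoeff_poincareForm_sub_le {k : ℕ} (hk : 6 ≤ k) (hev : Even k) {m : ℕ}
    (hm : m ≠ 0) (n : ℕ) :
    ‖fourierCoeff n (poincareForm hk hev hm) - 2 * (if n = m then 1 else 0)‖ ≤
      Real.exp (4 * Real.pi * n) * (cellBound * 2 ^ (4 - (k : ℤ))) := by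
  -- The height of the segment of integration: it exceeds 1, so that the large cell decays
  -- geometrically in k. The price is |q^(-n)| = e^(4πn), affordable for n ≤ k^(1/3).
  have h2 : (0 : ℝ) < 2 := two_pos
  have e1 := ModularFormClass.qExpansion_coeff_eq_intervalIntegral (poincareForm hk hev hm)
    one_pos one_mem_strictPeriods_SL n h2
  have e2 := qExpansion_coeff_eq_intervalIntegral one_pos (periodic_expFun m)
    (mdifferentiable_expFun m) (isBoundedAtImInfty_expFun m) n h2
  simp only [UpperHalfPlane.coe_I] at e2
  rw [fourierCoeff_apply, ← qExpansion_expFun_coeff, e1, e2]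
  have hc : ∀ F : ℍ → ℂ, Continuous F → Continuous fun u : ℝ ↦
      1 / Function.Periodic.qParam 1 (u + (2 : ℝ) * Complex.I) ^ n *
        F ⟨u + (2 : ℝ) * Complex.I, by simp⟩ := by
    intro F hF
    fun_prop (disch := simp [Function.Periodic.qParam_ne_zero])
  have hc1 := (hc _ (CuspFormClass.holo (poincareForm hk hev hm)).continuous).intervalIntegrable
    (μ := MeasureTheory.volume) 0 1
  have hc2 := (hc _ (mdifferentiable_expFun m).continuous).intervalIntegrable
    (μ := MeasureTheory.volume) 0 1
  simp only [Complex.ofReal_one, div_one, one_mul]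
  rw [← intervalIntegral.integral_const_mul, ← intervalIntegral.integral_sub hc1
    (hc2.const_mul 2)]
  have := intervalIntegral.norm_integral_le_of_norm_le_const (a := (0 : ℝ)) (b := 1)
    (C := Real.exp (4 * Real.pi * n) * (cellBound * 2 ^ (4 - (k : ℤ))))
    (f := fun u : ℝ ↦ 1 / Function.Periodic.qParam 1 (u + (2 : ℝ) * Complex.I) ^ n *
        poincareForm hk hev hm ⟨u + (2 : ℝ) * Complex.I, by simp⟩ -
        2 * (1 / Function.Periodic.qParam 1 (u + (2 : ℝ) * Complex.I) ^ n *
        expFun m ⟨u + (2 : ℝ) * Complex.I, by simp⟩)) ?_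
  · simpa using this
  · intro u hu
    rw [Set.uIoc_of_le zero_le_one] at hu
    set z : ℍ := ⟨u + (2 : ℝ) * Complex.I, by simp⟩ with hz
    have hzre : z.re = u := by simp [hz, UpperHalfPlane.re]
    have hzim : z.im = 2 := by simp [hz, UpperHalfPlane.im]
    have h3 := norm_poincare_sub_le (k := k) (by omega) (mod_cast hev) m (z := z)
      (by rw [hzre, abs_of_pos hu.1]; exact hu.2) (by rw [hzim]; norm_num)
    rw [hzim] at h3
    have h4 : ‖(1 : ℂ) / Function.Periodic.qParam 1 (u + (2 : ℝ) * Complex.I) ^ n‖ =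
        Real.exp (4 * Real.pi * n) := by
      rw [norm_div, norm_one, norm_pow, Function.Periodic.norm_qParam, ← Real.exp_nat_mul,
        one_div, ← Real.exp_neg]
      congr 1
      simp
      ring
    rw [poincareForm_apply, mul_left_comm, ← mul_sub, norm_mul, h4]
    gcongr

end HeckeMoments

end

open scoped MatrixGroups UpperHalfPlane

noncomputable section

namespace HeckeMoments

open UpperHalfPlane EisensteinSeries ModularGroup

open scoped ModularForm Manifold Matrix

/-! ### Integral matrices of determinant `n` modulo translations -/

/-- The integral matrices of determinant `n`. -/
abbrev DetMatrix (n : ℕ) : Type := {A : Matrix (Fin 2) (Fin 2) ℤ // A.det = n}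

/-- Equality up to left multiplication by a power of `T`. -/
def translationSetoid (n : ℕ) : Setoid (DetMatrix n) where
  r A B := ∃ t : ℤ, A.1 = (T ^ t).1 * B.1
  iseqv :=
    { refl := fun A ↦ ⟨0, by simp⟩
      symm := by
        rintro A B ⟨t, h⟩
        refine ⟨-t, ?_⟩
        rw [h, ← Matrix.mul_assoc, ← Matrix.SpecialLinearGroup.coe_mul, ← zpow_add,
          neg_add_cancel, zpow_zero, Matrix.SpecialLinearGroup.coe_one, Matrix.one_mul]
      trans := by
        rintro A B C ⟨t, h⟩ ⟨s, h'⟩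
        refine ⟨t + s, ?_⟩
        rw [h, h', ← Matrix.mul_assoc, ← Matrix.SpecialLinearGroup.coe_mul, ← zpow_add] }

/-- The index set `{(a, d, b) : ad = n, 0 ≤ b < d}`. -/
def triIndex (n : ℕ) : Finset (Σ _ : ℕ × ℕ, ℕ) :=
  n.divisorsAntidiagonal.sigma fun ad ↦ Finset.range ad.2

/-- The upper triangular matrix attached to `(a, d, b)`. -/
def triMatrix (s : Σ _ : ℕ × ℕ, ℕ) : Matrix (Fin 2) (Fin 2) ℤ := !![(s.1.1 : ℤ), s.2; 0, s.1.2]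

lemma mem_triIndex {n : ℕ} {s : Σ _ : ℕ × ℕ, ℕ} :
    s ∈ triIndex n ↔ (s.1.1 * s.1.2 = n ∧ n ≠ 0) ∧ s.2 < s.1.2 := by
  simp [triIndex]

lemma det_triMatrix {n : ℕ} {s : Σ _ : ℕ × ℕ, ℕ} (hs : s ∈ triIndex n) :
    (triMatrix s).det = n := by
  rw [triMatrix, Matrix.det_fin_two_of, ← (mem_triIndex.mp hs).1.1]
  simp

lemma exists_T_zpow_mul_eq_triMatrix {n : ℕ} (hn : n ≠ 0) {B : Matrix (Fin 2) (Fin 2) ℤ}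
    (hB : B.det = n) (h10 : B 1 0 = 0) (h11 : 0 < B 1 1) :
    ∃ s ∈ triIndex n, ∃ t : ℤ, (T ^ t).1 * B = triMatrix s := by
  rw [Matrix.det_fin_two, h10, mul_zero, sub_zero] at hB
  have h00 : 0 < B 0 0 := by
    have : 0 < B 0 0 * B 1 1 := by rw [hB]; exact_mod_cast Nat.pos_of_ne_zero hn
    exact pos_of_mul_pos_left this h11.le
  obtain ⟨a, ha⟩ := Int.eq_ofNat_of_zero_le h00.le
  obtain ⟨d, hd⟩ := Int.eq_ofNat_of_zero_le h11.le
  obtain ⟨b, hb⟩ := Int.eq_ofNat_of_zero_le (Int.emod_nonneg (B 0 1) h11.ne')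
  have hblt := Int.emod_lt_of_pos (B 0 1) h11
  refine ⟨⟨(a, d), b⟩, mem_triIndex.mpr ⟨⟨?_, hn⟩, ?_⟩, -(B 0 1 / B 1 1), ?_⟩
  · rw [ha, hd] at hB
    exact_mod_cast hB
  · rw [hb, hd] at hblt
    exact_mod_cast hblt
  · have hmod := Int.emod_def (B 0 1) (B 1 1)
    rw [hb] at hmod
    ext i j
    rw [coe_T_zpow, Matrix.mul_apply, Fin.sum_univ_two, triMatrix]
    fin_cases i <;> fin_cases j <;> simp [h10, ha, hd]
    rw [hmod, hd]
    ring

/-- The class of `γ_v U`. -/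
def leftClass (n : ℕ) (x : triIndex n × Primitive) : Quotient (translationSetoid n) :=
  Quotient.mk _ ⟨(completeRow x.2).1 * triMatrix x.1.1, by
    rw [Matrix.det_mul, (completeRow x.2).2, one_mul, det_triMatrix x.1.2]⟩

/-- The class of `U γ_v`. -/
def rightClass (n : ℕ) (x : triIndex n × Primitive) : Quotient (translationSetoid n) :=
  Quotient.mk _ ⟨triMatrix x.1.1 * (completeRow x.2).1, by
    rw [Matrix.det_mul, (completeRow x.2).2, mul_one, det_triMatrix x.1.2]⟩

/-- Uniqueness of the Hermite normal form: δ is upper triangular with positive diagonal, hence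
unipotent, and 0 ≤ b < d excludes a nonzero shift. -/
lemma eq_of_mul_triMatrix_eq {n : ℕ} {s s' : Σ _ : ℕ × ℕ, ℕ} (hs : s ∈ triIndex n)
    (hs' : s' ∈ triIndex n) {δ : SL(2, ℤ)} (h : δ.1 * triMatrix s = triMatrix s') :
    s = s' ∧ δ = 1 := by
  obtain ⟨⟨hn, hn0⟩, hb⟩ := mem_triIndex.mp hs
  obtain ⟨⟨hn', -⟩, hb'⟩ := mem_triIndex.mp hs'
  obtain ⟨⟨a, d⟩, b⟩ := s
  obtain ⟨⟨a', d'⟩, b'⟩ := s'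
  simp only at hn hn' hb hb'
  have ha : 0 < a := Nat.pos_of_ne_zero fun h ↦ hn0 (by rw [← hn, h, zero_mul])
  have ha' : 0 < a' := Nat.pos_of_ne_zero fun h ↦ hn0 (by rw [← hn', h, zero_mul])
  have e00 := congrFun (congrFun h 0) 0
  have e01 := congrFun (congrFun h 0) 1
  have e10 := congrFun (congrFun h 1) 0
  have e11 := congrFun (congrFun h 1) 1
  simp only [triMatrix, Matrix.mul_apply, Fin.sum_univ_two, Matrix.of_apply, Matrix.cons_val',
    Matrix.cons_val_zero, Matrix.cons_val_one, Matrix.cons_val_fin_one, mul_zero, add_zero]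
    at e00 e01 e10 e11
  have h10 : δ 1 0 = 0 := by
    rcases mul_eq_zero.mp e10 with h | h
    · exact h
    · omega
  have hdet := δ.det_coe
  rw [Matrix.det_fin_two, h10, mul_zero, sub_zero] at hdet
  have h00pos : 0 < δ 0 0 := by
    have : 0 < δ 0 0 * (a : ℤ) := by rw [e00]; exact_mod_cast ha'
    exact pos_of_mul_pos_left this (by positivity)
  have h00 : δ 0 0 = 1 := by
    rcases Int.isUnit_iff.mp (IsUnit.of_mul_eq_one _ hdet) with h | h <;> omega
  have h11 : δ 1 1 = 1 := by rw [h00, one_mul] at hdet; exact hdet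
  rw [h00, one_mul] at e00 e01
  rw [h10, h11, zero_mul, zero_add, one_mul] at e11
  have haa : a = a' := by exact_mod_cast e00
  have hdd : d = d' := by exact_mod_cast e11
  subst haa hdd
  have h01 : δ 0 1 = 0 := by
    have h1 : |(b' : ℤ) - b| < d := by rw [abs_lt]; omega
    have h2 : (b' : ℤ) - b = δ 0 1 * d := by rw [← e01]; ring
    have h3 : (b' : ℤ) - b = 0 := Int.eq_zero_of_abs_lt_dvd ⟨δ 0 1, by rw [h2, mul_comm]⟩ h1
    rw [h3] at h2
    rcases mul_eq_zero.mp h2.symm with h | h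
    · exact h
    · omega
  rw [h01, zero_mul, add_zero] at e01
  have hbb : b = b' := by exact_mod_cast e01
  refine ⟨by rw [hbb], ?_⟩
  ext i j
  fin_cases i <;> fin_cases j <;> simp [h00, h01, h10, h11]

lemma T_zpow_mul_one (t : ℤ) (A : Matrix (Fin 2) (Fin 2) ℤ) (j : Fin 2) :
    ((T ^ t).1 * A) 1 j = A 1 j := by
  rw [coe_T_zpow, Matrix.mul_apply, Fin.sum_univ_two]
  simp

lemma bottomRow_T_zpow_mul (t : ℤ) (γ : SL(2, ℤ)) : bottomRow (T ^ t * γ) = bottomRow γ :=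
  Subtype.ext (funext fun j ↦ T_zpow_mul_one t γ.1 j)

lemma leftClass_injective (n : ℕ) : Function.Injective (leftClass n) := by
  rintro ⟨s, v⟩ ⟨s', v'⟩ h
  obtain ⟨t, ht⟩ := Quotient.exact h
  simp only at ht
  have h1 : ((T ^ t * completeRow v')⁻¹ * completeRow v).1 * triMatrix s.1 = triMatrix s'.1 := by
    rw [Matrix.SpecialLinearGroup.coe_mul, Matrix.mul_assoc, ht, ← Matrix.mul_assoc (T ^ t).1,
      ← Matrix.SpecialLinearGroup.coe_mul, ← Matrix.mul_assoc, ← Matrix.SpecialLinearGroup.coe_mul,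
      inv_mul_cancel, Matrix.SpecialLinearGroup.coe_one, Matrix.one_mul]
  obtain ⟨hs, hδ⟩ := eq_of_mul_triMatrix_eq s.2 s'.2 h1
  rw [inv_mul_eq_one] at hδ
  refine Prod.ext (Subtype.ext hs) ?_
  change v = v'
  rw [← bottomRow_completeRow v, ← bottomRow_completeRow v', ← hδ, bottomRow_T_zpow_mul]

lemma exists_primitive_smul_eq {x y : ℤ} (h : x ≠ 0 ∨ y ≠ 0) :
    ∃ v : Primitive, ∃ g : ℤ, 0 < g ∧ x = g * v.1 0 ∧ y = g * v.1 1 := by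
  have hg : x.gcd y ≠ 0 := by
    rw [Ne, Int.gcd_eq_zero_iff]
    tauto
  refine ⟨⟨![x / x.gcd y, y / x.gcd y], (mem_gammaSet_one _).mpr ?_⟩, x.gcd y, ?_, ?_, ?_⟩
  · exact Int.isCoprime_iff_gcd_eq_one.mpr (Int.gcd_div_gcd_div_gcd (Nat.pos_of_ne_zero hg))
  · exact_mod_cast Nat.pos_of_ne_zero hg
  · exact (Int.mul_ediv_cancel' (Int.gcd_dvd_left ..)).symm
  · exact (Int.mul_ediv_cancel' (Int.gcd_dvd_right ..)).symm

/-- Reduction to Hermite normal form from the left; inverting the reducing matrix gives the row v.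
-/
lemma leftClass_surjective {n : ℕ} (hn : n ≠ 0) : Function.Surjective (leftClass n) := by
  intro q
  induction q using Quotient.inductionOn with
  | h A =>
    have hA := A.2
    rw [Matrix.det_fin_two] at hA
    have hnpos : (0 : ℤ) < n := by exact_mod_cast Nat.pos_of_ne_zero hn
    have hne : A.1 0 0 ≠ 0 ∨ A.1 1 0 ≠ 0 := by
      by_contra! h
      rw [h.1, h.2] at hA
      simp at hA
      omega
    obtain ⟨v, g, hg, h0, h1⟩ := exists_primitive_smul_eq hne
    -- The first column of A is g(v_0, v_1); the primitive row (-v_1, v_0) is orthogonal to it.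
    obtain ⟨γ, hγ⟩ : ∃ γ : SL(2, ℤ), (γ.1 * A.1) 1 0 = 0 := by
      have hp : IsCoprime (-(v.1 1)) (v.1 0) := ((mem_gammaSet_one _).mp v.2).symm.neg_left
      refine ⟨completeRow ⟨![-(v.1 1), v.1 0], (mem_gammaSet_one _).mpr hp⟩, ?_⟩
      have hr := completeRow_one ⟨![-(v.1 1), v.1 0], (mem_gammaSet_one _).mpr hp⟩
      rw [Matrix.mul_apply, Fin.sum_univ_two, congrFun hr 0, congrFun hr 1, h0, h1]
      simp
      ring
    obtain ⟨δ, hδ, hδ'⟩ : ∃ δ : SL(2, ℤ), (δ.1 * A.1) 1 0 = 0 ∧ 0 < (δ.1 * A.1) 1 1 := by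
      have hdet : (γ.1 * A.1).det = n := by rw [Matrix.det_mul, γ.2, one_mul, A.2]
      rw [Matrix.det_fin_two, hγ, mul_zero, sub_zero] at hdet
      rcases lt_trichotomy ((γ.1 * A.1) 1 1) 0 with h | h | h
      · refine ⟨-γ, ?_, ?_⟩
        · rw [Matrix.SpecialLinearGroup.coe_neg, Matrix.neg_mul, Matrix.neg_apply, hγ, neg_zero]
        · rw [Matrix.SpecialLinearGroup.coe_neg, Matrix.neg_mul, Matrix.neg_apply]
          omega
      · rw [h, mul_zero] at hdet
        omega
      · exact ⟨γ, hγ, h⟩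
    obtain ⟨s, hs, t, ht⟩ := exists_T_zpow_mul_eq_triMatrix hn
      (show (δ.1 * A.1).det = n by rw [Matrix.det_mul, δ.2, one_mul, A.2]) hδ hδ'
    obtain ⟨u, hu⟩ := exists_eq_T_zpow_mul (γ := completeRow (bottomRow (T ^ t * δ)⁻¹))
      (δ := (T ^ t * δ)⁻¹) (completeRow_one _)
    refine ⟨(⟨s, hs⟩, bottomRow (T ^ t * δ)⁻¹), Quotient.sound ⟨u, ?_⟩⟩
    change (completeRow (bottomRow (T ^ t * δ)⁻¹)).1 * triMatrix s = (T ^ u).1 * A.1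
    rw [hu, ← ht, Matrix.SpecialLinearGroup.coe_mul, Matrix.mul_assoc, ← Matrix.mul_assoc (T ^ t).1,
      ← Matrix.SpecialLinearGroup.coe_mul, ← Matrix.mul_assoc ((T ^ t * δ)⁻¹).1,
      ← Matrix.SpecialLinearGroup.coe_mul, inv_mul_cancel, Matrix.SpecialLinearGroup.coe_one,
      Matrix.one_mul]

lemma mul_completeRow_one (s : Σ _ : ℕ × ℕ, ℕ) (v : Primitive) (j : Fin 2) :
    (triMatrix s * (completeRow v).1) 1 j = s.1.2 * v.1 j := by
  rw [← completeRow_one v, Matrix.mul_apply, Fin.sum_univ_two, triMatrix]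
  simp

/-- The bottom row of Uγ_v is d·v with v primitive. Its gcd recovers d, then v is known, and
uniqueness of the normal form gives the rest. -/
lemma rightClass_injective (n : ℕ) : Function.Injective (rightClass n) := by
  rintro ⟨s, v⟩ ⟨s', v'⟩ h
  obtain ⟨t, ht⟩ := Quotient.exact h
  simp only at ht
  have hd : 0 < s.1.1.2 := (Nat.zero_le _).trans_lt (mem_triIndex.mp s.2).2
  have hrow : ∀ j, (s.1.1.2 : ℤ) * v.1 j = s'.1.1.2 * v'.1 j := fun j ↦ by
    rw [← mul_completeRow_one, ← mul_completeRow_one, ht, T_zpow_mul_one]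
  have hgcd : s.1.1.2 = s'.1.1.2 := by
    have h1 : (v.1 0).gcd (v.1 1) = 1 := v.2.2
    have h2 : (v'.1 0).gcd (v'.1 1) = 1 := v'.2.2
    have h3 : ((s.1.1.2 : ℤ) * v.1 0).gcd ((s.1.1.2 : ℤ) * v.1 1) =
        ((s'.1.1.2 : ℤ) * v'.1 0).gcd ((s'.1.1.2 : ℤ) * v'.1 1) := by rw [hrow, hrow]
    rw [Int.gcd_mul_left, Int.gcd_mul_left, h1, h2] at h3
    simpa using h3
  have hv : v = v' := by
    refine Subtype.ext (funext fun j ↦ ?_)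
    have := hrow j
    rw [← hgcd] at this
    exact mul_left_cancel₀ (by exact_mod_cast hd.ne') this
  subst hv
  have h1 : triMatrix s.1 = (T ^ t).1 * triMatrix s'.1 := by
    have := congrArg (· * ((completeRow v)⁻¹).1) ht
    simpa only [← Matrix.mul_assoc, Matrix.mul_assoc _ (completeRow v).1,
      ← Matrix.SpecialLinearGroup.coe_mul, mul_inv_cancel, Matrix.SpecialLinearGroup.coe_one,
      Matrix.mul_one] using this
  exact Prod.ext (Subtype.ext (eq_of_mul_triMatrix_eq s'.2 s.2 h1.symm).1.symm) rfl

/-- If the bottom row of A is g·v with v primitive and g > 0, then Aγ_v⁻¹ is upper triangular with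
lower right entry g. -/
lemma rightClass_surjective {n : ℕ} (hn : n ≠ 0) : Function.Surjective (rightClass n) := by
  intro q
  induction q using Quotient.inductionOn with
  | h A =>
    have hA := A.2
    rw [Matrix.det_fin_two] at hA
    have hnpos : (0 : ℤ) < n := by exact_mod_cast Nat.pos_of_ne_zero hn
    have hne : A.1 1 0 ≠ 0 ∨ A.1 1 1 ≠ 0 := by
      by_contra! h
      rw [h.1, h.2] at hA
      simp at hA
      omega
    obtain ⟨v, g, hg, h0, h1⟩ := exists_primitive_smul_eq hne
    have hr0 : completeRow v 1 0 = v.1 0 := congrFun (completeRow_one v) 0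
    have hr1 : completeRow v 1 1 = v.1 1 := congrFun (completeRow_one v) 1
    have hdet := (completeRow v).det_coe
    rw [Matrix.det_fin_two, hr0, hr1] at hdet
    set B := A.1 * ((completeRow v)⁻¹).1 with hB
    have hB10 : B 1 0 = 0 := by
      rw [hB, Matrix.SpecialLinearGroup.coe_inv, Matrix.adjugate_fin_two, Matrix.mul_apply,
        Fin.sum_univ_two, h0, h1]
      simp [hr0, hr1]
      ring
    have hB11 : B 1 1 = g := by
      rw [hB, Matrix.SpecialLinearGroup.coe_inv, Matrix.adjugate_fin_two, Matrix.mul_apply,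
        Fin.sum_univ_two, h0, h1]
      simp
      linear_combination g * hdet
    obtain ⟨s, hs, t, ht⟩ := exists_T_zpow_mul_eq_triMatrix hn
      (show B.det = n by rw [hB, Matrix.det_mul, ((completeRow v)⁻¹).2, mul_one, A.2]) hB10
      (by rw [hB11]; exact hg)
    refine ⟨(⟨s, hs⟩, v), Quotient.sound ⟨t, ?_⟩⟩
    change triMatrix s * (completeRow v).1 = (T ^ t).1 * A.1
    rw [← ht, hB, Matrix.mul_assoc, Matrix.mul_assoc, ← Matrix.SpecialLinearGroup.coe_mul,
      inv_mul_cancel, Matrix.SpecialLinearGroup.coe_one, Matrix.mul_one]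

/-- The bijection `(U, v) ↔ (V, w)` given by `T^ℤ γ_v U = T^ℤ V γ_w`. -/
def classEquiv {n : ℕ} (hn : n ≠ 0) : triIndex n × Primitive ≃ triIndex n × Primitive :=
  (Equiv.ofBijective _ ⟨leftClass_injective n, leftClass_surjective hn⟩).trans
    (Equiv.ofBijective _ ⟨rightClass_injective n, rightClass_surjective hn⟩).symm

/-- This lets a sum over the products γ_v U be rearranged into a sum over the products Uγ_v. -/
lemma classEquiv_spec {n : ℕ} (hn : n ≠ 0) {E : Type*} {Φ : Matrix (Fin 2) (Fin 2) ℤ → E}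
    (hΦ : ∀ A : DetMatrix n, ∀ t : ℤ, Φ ((T ^ t).1 * A.1) = Φ A.1) (x : triIndex n × Primitive) :
    Φ (triMatrix (classEquiv hn x).1.1 * (completeRow (classEquiv hn x).2).1) =
      Φ ((completeRow x.2).1 * triMatrix x.1.1) := by
  have h : rightClass n (classEquiv hn x) = leftClass n x :=
    (Equiv.ofBijective _ ⟨rightClass_injective n, rightClass_surjective hn⟩).apply_symm_apply _
  obtain ⟨t, ht⟩ := Quotient.exact h
  simp only at ht
  rw [ht]
  exact hΦ ⟨_, by rw [Matrix.det_mul, (completeRow x.2).2, one_mul, det_triMatrix x.1.2]⟩ t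

end HeckeMoments

end

open scoped MatrixGroups UpperHalfPlane

noncomputable section

namespace HeckeMoments

open UpperHalfPlane EisensteinSeries ModularGroup

open scoped ModularForm Manifold Matrix

/-! ### Hecke operators, Poincaré series and Fourier expansions -/

/-- `e(mAz) j(A, z)^(-k)` for an integral matrix `A`. -/
def matrixTerm (k : ℤ) (m : ℕ) (z : ℍ) (A : Matrix (Fin 2) (Fin 2) ℤ) : ℂ :=
  ((A 1 0 : ℂ) * z + A 1 1) ^ (-k) *
    Function.Periodic.qParam 1 (((A 0 0 : ℂ) * z + A 0 1) / ((A 1 0 : ℂ) * z + A 1 1)) ^ m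

lemma qParam_one_add_intCast (w : ℂ) (t : ℤ) :
    Function.Periodic.qParam 1 (w + t) = Function.Periodic.qParam 1 w := by
  rw [Function.Periodic.qParam, Function.Periodic.qParam, Complex.exp_eq_exp_iff_exists_int]
  exact ⟨t, by simp; ring⟩

lemma denom_ne_zero_of_det_ne_zero {A : Matrix (Fin 2) (Fin 2) ℤ} (hA : A.det ≠ 0) (z : ℍ) :
    (A 1 0 : ℂ) * z + A 1 1 ≠ 0 := by
  intro h
  have him := congrArg Complex.im h
  simp only [Complex.add_im, Complex.mul_im, Complex.intCast_re, Complex.intCast_im, zero_mul,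
    add_zero, Complex.zero_im, mul_eq_zero, Int.cast_eq_zero] at him
  have h10 : A 1 0 = 0 := him.resolve_right z.im_pos.ne'
  rw [h10] at h
  have h11 : A 1 1 = 0 := by simpa using h
  exact hA (by rw [Matrix.det_fin_two, h10, h11]; ring)

lemma T_zpow_mul_zero (t : ℤ) (A : Matrix (Fin 2) (Fin 2) ℤ) (j : Fin 2) :
    ((T ^ t).1 * A) 0 j = A 0 j + t * A 1 j := by
  have : (T ^ t).1 = !![1, t; 0, 1] := coe_T_zpow t
  rw [this, Matrix.mul_apply, Fin.sum_univ_two]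
  simp

lemma matrixTerm_T_zpow_mul (k : ℤ) (m : ℕ) (z : ℍ) {A : Matrix (Fin 2) (Fin 2) ℤ}
    (hA : A.det ≠ 0) (t : ℤ) : matrixTerm k m z ((T ^ t).1 * A) = matrixTerm k m z A := by
  have h0 := denom_ne_zero_of_det_ne_zero hA z
  rw [matrixTerm, matrixTerm, T_zpow_mul_one, T_zpow_mul_one, T_zpow_mul_zero, T_zpow_mul_zero,
    ← qParam_one_add_intCast (((A 0 0 : ℂ) * z + A 0 1) / ((A 1 0 : ℂ) * z + A 1 1)) t]
  congr 3
  push_cast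
  field_simp
  ring

lemma im_tri_pos {n : ℕ} {s : Σ _ : ℕ × ℕ, ℕ} (hs : s ∈ triIndex n) (z : ℍ) :
    0 < (((s.1.1 : ℂ) * z + s.2) / s.1.2).im := by
  obtain ⟨⟨h1, h2⟩, h3⟩ := mem_triIndex.mp hs
  have ha : 0 < s.1.1 := Nat.pos_of_ne_zero fun h ↦ h2 (by rw [← h1, h, zero_mul])
  have hd : 0 < s.1.2 := (Nat.zero_le _).trans_lt h3
  have : (((s.1.1 : ℂ) * z + s.2) / s.1.2).im = s.1.1 * z.im / s.1.2 := by
    rw [Complex.div_natCast_im]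
    simp
  rw [this]
  have := z.im_pos
  positivity

lemma matrixTerm_mul_triMatrix (k : ℤ) (m : ℕ) (z : ℍ) {n : ℕ} {s : Σ _ : ℕ × ℕ, ℕ}
    (hs : s ∈ triIndex n) (γ : SL(2, ℤ)) :
    matrixTerm k m z (γ.1 * triMatrix s) = (s.1.2 : ℂ) ^ (-k) *
      (expFun m ∣[k] γ) (ofComplex (((s.1.1 : ℂ) * z + s.2) / s.1.2)) := by
  have hd : (s.1.2 : ℂ) ≠ 0 :=
    Nat.cast_ne_zero.mpr ((Nat.zero_le _).trans_lt (mem_triIndex.mp hs).2).ne'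
  have hw := im_tri_pos hs z
  rw [slash_expFun_apply, ofComplex_apply_of_im_pos hw, eisSummand, expFun, matrixTerm, ← mul_assoc,
    ← mul_zpow]
  have e : ∀ i, ((γ.1 * triMatrix s) i 0 : ℂ) * z + (γ.1 * triMatrix s) i 1 =
      s.1.2 * ((γ i 0 : ℂ) * ((s.1.1 * z + s.2) / s.1.2) + γ i 1) := by
    intro i
    simp only [triMatrix, Matrix.mul_apply, Fin.sum_univ_two, Matrix.of_apply, Matrix.cons_val',
      Matrix.cons_val_zero, Matrix.cons_val_one, Matrix.cons_val_fin_one]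
    push_cast
    field_simp
    ring
  rw [e, e, mul_div_mul_left _ _ hd, coe_specialLinearGroup_apply]
  simp

lemma matrixTerm_triMatrix_mul (k : ℤ) (m : ℕ) (z : ℍ) {n : ℕ} {s : Σ _ : ℕ × ℕ, ℕ}
    (hs : s ∈ triIndex n) (γ : SL(2, ℤ)) :
    matrixTerm k m z (triMatrix s * γ.1) = (s.1.2 : ℂ) ^ (-k) * eisSummand k (γ 1) z *
      Function.Periodic.qParam 1 (((s.1.1 : ℂ) * (γ • z : ℍ) + s.2) / s.1.2) ^ m := by
  have hd : (s.1.2 : ℂ) ≠ 0 :=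
    Nat.cast_ne_zero.mpr ((Nat.zero_le _).trans_lt (mem_triIndex.mp hs).2).ne'
  have hγ := denom_ne_zero_of_det_ne_zero (A := γ.1) (by rw [γ.2]; exact one_ne_zero) z
  have e1 : ((triMatrix s * γ.1) 1 0 : ℂ) * z + (triMatrix s * γ.1) 1 1 =
      s.1.2 * ((γ 1 0 : ℂ) * z + γ 1 1) := by
    simp [triMatrix, Matrix.mul_apply, Fin.sum_univ_two]
    ring
  have e0 : ((triMatrix s * γ.1) 0 0 : ℂ) * z + (triMatrix s * γ.1) 0 1 =
      s.1.1 * ((γ 0 0 : ℂ) * z + γ 0 1) + s.2 * ((γ 1 0 : ℂ) * z + γ 1 1) := by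
    simp [triMatrix, Matrix.mul_apply, Fin.sum_univ_two]
    ring
  rw [matrixTerm, eisSummand, e0, e1, mul_zpow]
  congr 3
  rw [coe_specialLinearGroup_apply]
  simp only [algebraMap_int_eq, eq_intCast, Complex.ofReal_intCast]
  change (γ 1 0 : ℂ) * z + γ 1 1 ≠ 0 at hγ
  generalize (γ 1 0 : ℂ) * z + γ 1 1 = w at hγ ⊢
  field_simp

/-- A geometric sum of powers of ζ^m with ζ = e(1/d), which survives only if d ∣ m. -/
lemma sum_range_qParam_pow {d : ℕ} (hd : d ≠ 0) (m a : ℕ) (z : ℍ) :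
    ∑ b ∈ Finset.range d, Function.Periodic.qParam 1 (((a : ℂ) * z + b) / d) ^ m =
      if d ∣ m then (d : ℂ) * expFun (m / d * a) z else 0 := by
  have hd' : (d : ℂ) ≠ 0 := Nat.cast_ne_zero.mpr hd
  have hprim := Complex.isPrimitiveRoot_exp d hd
  set ζ := Complex.exp (2 * Real.pi * Complex.I / d) with hζ
  have h1 : ∀ b : ℕ, Function.Periodic.qParam 1 (((a : ℂ) * z + b) / d) ^ m =
      Function.Periodic.qParam 1 ((a : ℂ) * z / d) ^ m * (ζ ^ m) ^ b := by
    intro b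
    rw [hζ, Function.Periodic.qParam, Function.Periodic.qParam, ← Complex.exp_nat_mul,
      ← Complex.exp_nat_mul, ← Complex.exp_nat_mul, ← Complex.exp_nat_mul, ← Complex.exp_add]
    congr 1
    simp
    ring
  simp_rw [h1]
  rw [← Finset.mul_sum]
  split_ifs with hdm
  · obtain ⟨c, rfl⟩ := hdm
    rw [pow_mul ζ, hprim.pow_eq_one, one_pow]
    simp only [one_pow, Finset.sum_const, Finset.card_range, nsmul_eq_mul, mul_one]
    rw [mul_comm, Nat.mul_div_cancel_left _ (Nat.pos_of_ne_zero hd), expFun,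
      Function.Periodic.qParam, Function.Periodic.qParam, ← Complex.exp_nat_mul,
      ← Complex.exp_nat_mul]
    congr 2
    push_cast
    field_simp
  · have hne : ζ ^ m ≠ 1 := fun h ↦ hdm ((hprim.pow_eq_one_iff_dvd m).mp h)
    have := mul_geom_sum (ζ ^ m) d
    rw [← pow_mul, mul_comm m d, pow_mul, hprim.pow_eq_one, one_pow, sub_self, mul_eq_zero] at this
    rw [this.resolve_left (sub_ne_zero.mpr hne), mul_zero]

lemma natCast_mul_zpow_eq (a : ℕ) {d : ℕ} (hd : d ≠ 0) (k : ℤ) :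
    ((a * d : ℕ) : ℂ) ^ (k - 1) * ((d : ℂ) ^ (-k) * d) = (a : ℂ) ^ (k - 1) := by
  have hd' : (d : ℂ) ≠ 0 := Nat.cast_ne_zero.mpr hd
  rw [Nat.cast_mul, mul_zpow, mul_assoc, ← zpow_add_one₀ hd', ← zpow_add₀ hd',
    show k - 1 + (-k + 1) = 0 by ring, zpow_zero, mul_one]

lemma heckeOperator_eq_sum_triIndex (k : ℤ) (n : ℕ) (f : ℍ → ℂ) (z : ℍ) :
    heckeOperator k n f z = (n : ℂ) ^ (k - 1) * ∑ s ∈ triIndex n,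
      (s.1.2 : ℂ) ^ (-k) * f (ofComplex (((s.1.1 : ℂ) * z + s.2) / s.1.2)) := by
  rw [heckeOperator, triIndex, Finset.sum_sigma]

/-- Termwise, T_n P_m is a sum over γ_v U. Rearranged over Uγ_v, the triangular matrix acts last,
the sum over b detects d ∣ m, and each pair (a, d) leaves the Poincaré series of index ma/d. -/
lemma heckeOperator_poincare {k : ℤ} (hk : 3 ≤ k) {n : ℕ} (hn : n ≠ 0) (m : ℕ) (z : ℍ) :
    heckeOperator k n (poincare k m) z = ∑ ad ∈ n.divisorsAntidiagonal,
      if ad.2 ∣ m then (ad.1 : ℂ) ^ (k - 1) * poincare k (m / ad.2 * ad.1) z else 0 := by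
  set F : triIndex n × Primitive → ℂ :=
    fun x ↦ matrixTerm k m z ((completeRow x.2).1 * triMatrix x.1.1) with hF
  set G : triIndex n × Primitive → ℂ :=
    fun x ↦ matrixTerm k m z (triMatrix x.1.1 * (completeRow x.2).1) with hG
  have hFG : ∀ x, G (classEquiv hn x) = F x :=
    classEquiv_spec hn fun A t ↦ matrixTerm_T_zpow_mul k m z (by rw [A.2]; exact_mod_cast hn) t
  have hFs : Summable F := by
    refine Summable.of_norm ((summable_prod_of_nonneg fun _ ↦ norm_nonneg _).mpr
      ⟨fun s ↦ ?_, Summable.of_finite⟩)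
    simp only [hF, matrixTerm_mul_triMatrix k m z s.2, norm_mul]
    exact (summable_norm_slash_expFun hk m _).mul_left _
  have hGs : Summable G := by
    rw [← (classEquiv hn).summable_iff]
    exact hFs.congr fun x ↦ (hFG x).symm
  have hsum : ∑' x, F x = ∑' x, G x := by
    rw [← (classEquiv hn).tsum_eq G]
    exact tsum_congr fun x ↦ (hFG x).symm
  rw [hFs.tsum_prod, hGs.tsum_prod, tsum_fintype, tsum_fintype,
    ← Summable.tsum_finsetSum fun s _ ↦ hGs.prod_factor s] at hsum
  have hl : ∑ s ∈ triIndex n, (s.1.2 : ℂ) ^ (-k) *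
      poincare k m (ofComplex (((s.1.1 : ℂ) * z + s.2) / s.1.2)) =
        ∑ s : triIndex n, ∑' v, F (s, v) := by
    rw [← Finset.sum_coe_sort (triIndex n)]
    refine Finset.sum_congr rfl fun s _ ↦ ?_
    simp only [hF, matrixTerm_mul_triMatrix k m z s.2]
    rw [tsum_mul_left, poincare]
  have hr : ∀ v, (n : ℂ) ^ (k - 1) * ∑ s : triIndex n, G (s, v) =
      ∑ ad ∈ n.divisorsAntidiagonal, (if ad.2 ∣ m then (ad.1 : ℂ) ^ (k - 1) *
        (expFun (m / ad.2 * ad.1) ∣[k] completeRow v) z else 0) := by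
    intro v
    have : ∀ s : triIndex n, G (s, v) = (s.1.1.2 : ℂ) ^ (-k) * eisSummand k (completeRow v 1) z *
      Function.Periodic.qParam 1
        (((s.1.1.1 : ℂ) * (completeRow v • z : ℍ) + s.1.2) / s.1.1.2) ^ m :=
      fun s ↦ matrixTerm_triMatrix_mul k m z s.2 _
    simp_rw [this]
    rw [Finset.sum_coe_sort (triIndex n) fun s ↦ (s.1.2 : ℂ) ^ (-k) *
      eisSummand k (completeRow v 1) z * Function.Periodic.qParam 1
        (((s.1.1 : ℂ) * (completeRow v • z : ℍ) + s.2) / s.1.2) ^ m, triIndex, Finset.sum_sigma,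
      Finset.mul_sum]
    refine Finset.sum_congr rfl fun ad had ↦ ?_
    obtain ⟨h1, h2⟩ := Nat.mem_divisorsAntidiagonal.mp had
    have ha : ad.1 ≠ 0 := fun h ↦ h2 (by rw [← h1, h, zero_mul])
    have hd : ad.2 ≠ 0 := fun h ↦ h2 (by rw [← h1, h, mul_zero])
    change _ * ∑ b ∈ Finset.range ad.2, (ad.2 : ℂ) ^ (-k) * eisSummand k (completeRow v 1) z *
      Function.Periodic.qParam 1 (((ad.1 : ℂ) * (completeRow v • z : ℍ) + b) / ad.2) ^ m = _
    rw [← Finset.mul_sum, sum_range_qParam_pow hd]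
    split_ifs with hdm
    · rw [slash_expFun_apply, ← natCast_mul_zpow_eq ad.1 hd, h1]
      ring
    · ring
  rw [heckeOperator_eq_sum_triIndex, hl, hsum, ← tsum_mul_left, tsum_congr hr,
    Summable.tsum_finsetSum]
  · refine Finset.sum_congr rfl fun ad _ ↦ ?_
    split_ifs
    · rw [tsum_mul_left, poincare]
    · exact tsum_zero
  · intro ad _
    split_ifs
    · exact (summable_slash_expFun hk _ z).mul_left _
    · exact summable_zero

/-- The action of the Hecke operators on Fourier expansions. -/
lemma hasSum_heckeOperator {k : ℕ} (hk : k ≠ 0) (n : ℕ) {f : ℍ → ℂ} {c : ℕ → ℂ}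
    (h : ∀ z : ℍ, HasSum (fun r ↦ c r * expFun r z) (f z)) (z : ℍ) :
    HasSum (fun r ↦ seqHecke (k - 1) n c r * expFun r z) (heckeOperator k n f z) := by
  have key : ∀ ad ∈ n.divisorsAntidiagonal,
      HasSum (fun r ↦ (ad.1 : ℂ) ^ (k - 1) * seqV ad.1 (seqU ad.2 c) r * expFun r z)
        ((n : ℂ) ^ ((k : ℤ) - 1) * ∑ b ∈ Finset.range ad.2,
          (ad.2 : ℂ) ^ (-(k : ℤ)) * f (ofComplex (((ad.1 : ℂ) * z + b) / ad.2))) := by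
    intro ad had
    obtain ⟨h1, h2⟩ := Nat.mem_divisorsAntidiagonal.mp had
    have ha : ad.1 ≠ 0 := fun h ↦ h2 (by rw [← h1, h, zero_mul])
    have hd : ad.2 ≠ 0 := fun h ↦ h2 (by rw [← h1, h, mul_zero])
    have hs : HasSum (fun r ↦ c r *
        (if ad.2 ∣ r then (ad.2 : ℂ) * expFun (r / ad.2 * ad.1) z else 0))
        (∑ b ∈ Finset.range ad.2, f (ofComplex (((ad.1 : ℂ) * z + b) / ad.2))) := by
      have := hasSum_sum (s := Finset.range ad.2) fun b _ ↦
        h (ofComplex (((ad.1 : ℂ) * z + b) / ad.2))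
      refine this.congr_fun fun r ↦ ?_
      rw [← sum_range_qParam_pow hd, Finset.mul_sum]
      refine Finset.sum_congr rfl fun b hb ↦ ?_
      rw [expFun, ofComplex_apply_of_im_pos (im_tri_pos (n := n) (s := ⟨ad, b⟩)
        (Finset.mem_sigma.mpr ⟨had, hb⟩) z)]
    have hinj : Function.Injective fun s : ℕ ↦ ad.2 * s :=
      fun _ _ h ↦ Nat.eq_of_mul_eq_mul_left (Nat.pos_of_ne_zero hd) h
    have hinj' : Function.Injective fun s : ℕ ↦ ad.1 * s :=
      fun _ _ h ↦ Nat.eq_of_mul_eq_mul_left (Nat.pos_of_ne_zero ha) h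
    -- Only r = ds survives on one side and only r = as on the other; both sums are reindexed by s.
    rw [← hinj.hasSum_iff fun r hr ↦ by
      rw [if_neg fun ⟨s, hs⟩ ↦ hr ⟨s, hs.symm⟩, mul_zero]] at hs
    rw [← hinj'.hasSum_iff fun r hr ↦ by
      rw [seqV, LinearMap.coe_mk, AddHom.coe_mk, if_neg fun ⟨s, hs⟩ ↦ hr ⟨s, hs.symm⟩, mul_zero,
        zero_mul]]
    rw [← Finset.mul_sum]
    have := (hs.mul_left ((ad.2 : ℂ) ^ (-(k : ℤ)))).mul_left ((n : ℂ) ^ ((k : ℤ) - 1))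
    refine this.congr_fun fun r ↦ ?_
    have e := natCast_mul_zpow_eq ad.1 hd k
    rw [h1] at e
    have hk' : (ad.1 : ℂ) ^ (k - 1) = (ad.1 : ℂ) ^ ((k : ℤ) - 1) := by
      rw [← zpow_natCast, Nat.cast_pred (Nat.pos_of_ne_zero hk)]
    simp only [Function.comp_apply, seqV, seqU, LinearMap.coe_mk, AddHom.coe_mk, dvd_mul_right,
      if_true, Nat.mul_div_cancel_left _ (Nat.pos_of_ne_zero ha),
      Nat.mul_div_cancel_left _ (Nat.pos_of_ne_zero hd)]
    rw [hk', ← e, mul_comm r ad.1]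
    ring
  rw [heckeOperator, Finset.mul_sum]
  refine (hasSum_sum key).congr_fun fun r ↦ ?_
  rw [← Finset.sum_mul, Nat.sum_divisorsAntidiagonal
    fun a d ↦ (a : ℂ) ^ (k - 1) * seqV a (seqU d c) r, seqHecke, LinearMap.sum_apply,
    Finset.sum_apply]
  rfl

end HeckeMoments

end

open scoped MatrixGroups UpperHalfPlane

noncomputable section

namespace HeckeMoments

open UpperHalfPlane ModularGroup MeasureTheory

open scoped ModularForm ENNReal

/-! ### The invariant measure in coordinates -/

lemma measurableEmbedding_re_im : MeasurableEmbedding fun z : ℍ ↦ (z.re, z.im) :=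
  Complex.measurableEquivRealProd.measurableEmbedding.comp measurableEmbedding_coe

lemma map_re_im_comap_coe :
    ((volume : Measure ℂ).comap UpperHalfPlane.coe).map (fun z : ℍ ↦ (z.re, z.im)) =
      (volume : Measure (ℝ × ℝ)).restrict (Set.univ ×ˢ Set.Ioi 0) := by
  have h1 : (fun z : ℍ ↦ (z.re, z.im)) = Complex.measurableEquivRealProd ∘ UpperHalfPlane.coe := rfl
  rw [h1, ← Measure.map_map Complex.measurableEquivRealProd.measurable measurable_coe,
    measurableEmbedding_coe.map_comap]
  have h2 : Set.range UpperHalfPlane.coe =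
      Complex.measurableEquivRealProd ⁻¹' (Set.univ ×ˢ Set.Ioi 0) := by
    ext z
    simp [UpperHalfPlane.range_coe, upperHalfPlaneSet]
  rw [h2]
  exact (Complex.volume_preserving_equiv_real_prod.restrict_preimage_emb
    Complex.measurableEquivRealProd.measurableEmbedding _).map_eq

lemma measurable_density :
    Measurable fun z : ℍ ↦ ((1 / NNReal.mk z.im z.im_pos.le : NNReal) ^ 2) := by
  have : Measurable fun z : ℍ ↦ NNReal.mk z.im z.im_pos.le :=
    (UpperHalfPlane.continuous_im.measurable).subtype_mk
  fun_prop

lemma integrable_comp_re_im_iff {E : Type*} [NormedAddCommGroup E] [NormedSpace ℝ E]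
    {G : ℝ × ℝ → E} : Integrable (fun z : ℍ ↦ G (z.re, z.im)) ↔
      IntegrableOn (fun p ↦ (p.2 ^ 2)⁻¹ • G p) (Set.univ ×ˢ Set.Ioi 0) := by
  rw [volume_def, integrable_withDensity_iff_integrable_smul measurable_density, IntegrableOn,
    ← map_re_im_comap_coe, measurableEmbedding_re_im.integrable_map_iff]
  refine iff_of_eq (congrArg₂ _ (funext fun z ↦ ?_) rfl)
  rw [NNReal.smul_def]
  simp

lemma integral_comp_re_im {E : Type*} [NormedAddCommGroup E] [NormedSpace ℝ E] (G : ℝ × ℝ → E) :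
    ∫ z : ℍ, G (z.re, z.im) = ∫ p in Set.univ ×ˢ Set.Ioi 0, (p.2 ^ 2)⁻¹ • G p := by
  rw [volume_def, integral_withDensity_eq_integral_smul measurable_density,
    ← map_re_im_comap_coe, measurableEmbedding_re_im.integral_map]
  refine integral_congr_ae (ae_of_all _ fun z ↦ ?_)
  simp only [NNReal.smul_def]
  simp

lemma restrict_univ_prod_Ioi : (volume : Measure (ℝ × ℝ)).restrict (Set.univ ×ˢ Set.Ioi 0) =
    (volume : Measure ℝ).prod ((volume : Measure ℝ).restrict (Set.Ioi 0)) := by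
  rw [Measure.volume_eq_prod, ← Measure.prod_restrict, Measure.restrict_univ]

lemma half_le_im_of_mem_fd {z : ℍ} (hz : z ∈ fd) : 1 / 2 ≤ z.im := by
  have := three_le_four_mul_im_sq_of_mem_fd hz
  nlinarith [z.im_pos]

lemma measurableSet_fd : MeasurableSet fd := isClosed_fd.measurableSet

/-- Comparison with the half-strip |x| ≤ 1/2, y ≥ 1/2, which has finite area for dx dy / y². -/
lemma volume_fd_lt_top : volume fd < ∞ := by
  set G : ℝ × ℝ → ℝ := fun p ↦ (Set.Icc (-(1 / 2) : ℝ) (1 / 2)).indicator 1 p.1 *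
    (Set.Ici (1 / 2 : ℝ)).indicator 1 p.2 with hG
  have hint : Integrable (fun z : ℍ ↦ G (z.re, z.im)) := by
    rw [integrable_comp_re_im_iff, IntegrableOn, restrict_univ_prod_Ioi]
    have h1 : Integrable ((Set.Icc (-(1 / 2) : ℝ) (1 / 2)).indicator (1 : ℝ → ℝ)) :=
      (integrableOn_const (by simp)).integrable_indicator measurableSet_Icc
    have h2 : Integrable (fun y : ℝ ↦ (y ^ 2)⁻¹ * (Set.Ici (1 / 2 : ℝ)).indicator 1 y)
        (volume.restrict (Set.Ioi 0)) := by
      refine Integrable.restrict ?_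
      have : IntegrableOn (fun y : ℝ ↦ (y ^ 2)⁻¹) (Set.Ici (1 / 2 : ℝ)) := by
        rw [integrableOn_Ici_iff_integrableOn_Ioi]
        refine (integrableOn_Ioi_rpow_of_lt (a := -2) (by norm_num) (by norm_num)).congr_fun
          (fun y hy ↦ ?_) measurableSet_Ioi
        have : 0 < y := lt_trans (by norm_num) (Set.mem_Ioi.mp hy)
        simp only
        rw [Real.rpow_neg this.le, Real.rpow_two]
      refine (this.integrable_indicator measurableSet_Ici).congr (ae_of_all _ fun y ↦ ?_)
      by_cases hy : y ∈ Set.Ici (1 / 2 : ℝ) <;> simp [Set.indicator]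
    refine (h1.mul_prod h2).congr (ae_of_all _ fun p ↦ ?_)
    simp only [hG, smul_eq_mul]
    ring
  have hle : Integrable (fd.indicator (1 : ℍ → ℝ)) := by
    refine hint.mono' (measurable_one.indicator measurableSet_fd).aestronglyMeasurable
      (ae_of_all _ fun z ↦ ?_)
    by_cases hz : z ∈ fd
    · have h1 : z.re ∈ Set.Icc (-(1 / 2) : ℝ) (1 / 2) := abs_le.mp hz.2
      have h2 : z.im ∈ Set.Ici (1 / 2 : ℝ) := half_le_im_of_mem_fd hz
      simp only [hG]
      rw [Set.indicator_of_mem hz, Set.indicator_of_mem h1, Set.indicator_of_mem h2]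
      simp
    · rw [Set.indicator_of_notMem hz, norm_zero]
      exact mul_nonneg (Set.indicator_nonneg (fun _ _ ↦ zero_le_one) _)
        (Set.indicator_nonneg (fun _ _ ↦ zero_le_one) _)
  have h3 := (integrable_indicator_iff measurableSet_fd).mp hle
  have h4 := (integrable_const_iff (c := (1 : ℝ))).mp h3
  simpa [isFiniteMeasure_iff] using h4

/-- The boundary lies on two vertical lines and the unit circle. -/
lemma volume_fd_diff_fdo : volume (fd \ fdo) = 0 := by
  rw [volume_eq_lintegral]
  refine setLIntegral_measure_zero _ _ (measure_mono_null
    (t := {z : ℂ | z.re = 1 / 2} ∪ {z : ℂ | z.re = -(1 / 2)} ∪ Metric.sphere 0 1) ?_ ?_)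
  · rintro _ ⟨z, ⟨⟨h1, h2⟩, h3⟩, rfl⟩
    by_contra! h
    simp only [Set.mem_union, Set.mem_ofPred_eq, mem_sphere_zero_iff_norm, not_or] at h
    refine h3 ⟨lt_of_le_of_ne h1 fun h' ↦ h.2 ?_, lt_of_le_of_ne h2 fun h' ↦ ?_⟩
    · rw [Complex.normSq_eq_norm_sq] at h'
      nlinarith [norm_nonneg (z : ℂ)]
    · rcases (abs_eq (by norm_num)).mp h' with h' | h'
      · exact h.1.1 h'
      · exact h.1.2 h'
  · have hre : ∀ a : ℝ, volume {z : ℂ | z.re = a} = 0 := fun a ↦ by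
      rw [← Complex.frontier_setOfPred_re_le]
      exact (convex_halfSpace_re_le a).addHaar_frontier _
    exact measure_union_null (measure_union_null (hre _) (hre _)) (Measure.addHaar_sphere _ _ _)

/-! ### Unfolding -/

lemma measurePreserving_smul_SL (γ : SL(2, ℤ)) : MeasurePreserving fun z : ℍ ↦ γ • z :=
  measurePreserving_smul (γ : GL (Fin 2) ℝ) volume

lemma measurableEmbedding_smul_SL (γ : SL(2, ℤ)) : MeasurableEmbedding fun z : ℍ ↦ γ • z :=
  measurableEmbedding_const_smul (γ : GL (Fin 2) ℝ)

instance : Countable SL(2, ℤ) :=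
  have : Countable (Matrix (Fin 2) (Fin 2) ℤ) := inferInstanceAs (Countable (Fin 2 → Fin 2 → ℤ))
  Subtype.countable

lemma neg_ne_self_SL (γ : SL(2, ℤ)) : γ ≠ -γ := by
  intro h
  have h1 := γ.2
  have h2 : ∀ i j, γ i j = 0 := fun i j ↦ by
    have : γ i j = -γ i j := congrFun₂ (congrArg Subtype.val h) i j
    omega
  rw [Matrix.det_fin_two] at h1
  simp [h2] at h1

/-- Almost every point lies in exactly two of the translates of the fundamental domain indexed
by `SL(2, ℤ)`. -/
lemma ae_exists_inv_smul_mem_fd_iff : ∀ᵐ z : ℍ, ∃ δ : SL(2, ℤ), ∀ γ : SL(2, ℤ),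
    γ⁻¹ • z ∈ fd ↔ γ = δ ∨ γ = -δ := by
  have h : ∀ᵐ z : ℍ, ∀ γ : SL(2, ℤ), γ • z ∉ fd \ fdo := by
    rw [ae_all_iff]
    intro γ
    have := (measurePreserving_smul_SL γ).quasiMeasurePreserving.preimage_null volume_fd_diff_fdo
    exact measure_eq_zero_iff_ae_notMem.mp this
  filter_upwards [h] with z hz
  obtain ⟨δ, hδ⟩ := exists_smul_mem_fd z
  have hδ' : δ • z ∈ fdo := by
    by_contra h'
    exact hz δ ⟨hδ, h'⟩
  refine ⟨δ⁻¹, fun γ ↦ ⟨fun hγ ↦ ?_, ?_⟩⟩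
  · have h1 : (γ⁻¹ * δ⁻¹) • (δ • z) ∈ fd := by rwa [mul_smul, inv_smul_smul]
    rcases eq_one_or_neg_one_of_mem_fdo_mem_fd hδ' h1 with h2 | h2
    · left
      rw [← mul_inv_rev, inv_eq_one] at h2
      exact eq_inv_of_mul_eq_one_right h2
    · right
      have h3 : (δ * γ)⁻¹ = -1 := by rw [mul_inv_rev, h2]
      rw [inv_eq_iff_eq_inv] at h3
      have h4 : (-1 : SL(2, ℤ))⁻¹ = -1 := by rw [inv_eq_iff_mul_eq_one]; simp
      rw [h4] at h3
      rw [← mul_neg_one, ← h3, inv_mul_cancel_left]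
  · rintro (rfl | rfl)
    · rwa [inv_inv]
    · have h4 : (-δ⁻¹ : SL(2, ℤ))⁻¹ = -δ := by rw [inv_eq_iff_mul_eq_one]; simp
      rw [h4, SL_neg_smul]
      exact hδ

open scoped Classical in
lemma tsum_indicator_inv_smul {E : Type*} [AddCommMonoid E] [TopologicalSpace E] {z : ℍ}
    {δ : SL(2, ℤ)} (h : ∀ γ : SL(2, ℤ), γ⁻¹ • z ∈ fd ↔ γ = δ ∨ γ = -δ) (c : E) :
    ∑' γ : SL(2, ℤ), (if γ⁻¹ • z ∈ fd then c else 0) = c + c := by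
  rw [tsum_eq_sum (s := {δ, -δ})]
  · rw [Finset.sum_pair (neg_ne_self_SL δ), if_pos ((h _).mpr (Or.inl rfl)),
      if_pos ((h _).mpr (Or.inr rfl))]
  · intro γ hγ
    rw [if_neg]
    rw [h]
    simpa using hγ

open scoped Classical in
lemma setLIntegral_comp_smul (H : ℍ → ℝ≥0∞) (γ : SL(2, ℤ)) :
    ∫⁻ z in fd, H (γ • z) = ∫⁻ z, (if γ⁻¹ • z ∈ fd then H z else 0) := by
  rw [← lintegral_indicator measurableSet_fd,
    ← (measurePreserving_smul_SL γ).lintegral_comp_emb (measurableEmbedding_smul_SL γ)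
      fun z ↦ if γ⁻¹ • z ∈ fd then H z else 0]
  refine lintegral_congr fun z ↦ ?_
  rw [inv_smul_smul, Set.indicator_apply]

open scoped Classical in
lemma setIntegral_comp_smul (H : ℍ → ℂ) (γ : SL(2, ℤ)) :
    ∫ z in fd, H (γ • z) = ∫ z, (if γ⁻¹ • z ∈ fd then H z else 0) := by
  rw [← integral_indicator measurableSet_fd,
    ← (measurePreserving_smul_SL γ).integral_comp (measurableEmbedding_smul_SL γ)
      fun z ↦ if γ⁻¹ • z ∈ fd then H z else 0]
  refine integral_congr_ae (ae_of_all _ fun z ↦ ?_)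
  simp only [inv_smul_smul, Set.indicator_apply]

/-- Unfolding an integral over the fundamental domain. -/
lemma setIntegral_fd_tsum {H : ℍ → ℂ} (hH : Integrable H) (hm : Measurable H) :
    ∫ z in fd, ∑' γ : SL(2, ℤ), H (γ • z) = 2 * ∫ z, H z := by
  classical
  have hmeas : ∀ γ : SL(2, ℤ), MeasurableSet {z : ℍ | γ⁻¹ • z ∈ fd} := fun γ ↦
    (measurePreserving_smul_SL γ⁻¹).measurable measurableSet_fd
  -- Almost every point lies in two translates, so this total is 2∫|H|. It justifies both
  -- interchanges of sum and integral.
  have hlin : ∑' γ : SL(2, ℤ), ∫⁻ z, ‖(if γ⁻¹ • z ∈ fd then H z else 0)‖ₑ ≠ ∞ := by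
    have h1 : ∀ γ : SL(2, ℤ), ∀ z : ℍ, ‖(if γ⁻¹ • z ∈ fd then H z else 0)‖ₑ =
        if γ⁻¹ • z ∈ fd then ‖H z‖ₑ else 0 := fun γ z ↦ by split_ifs <;> simp
    simp_rw [h1]
    rw [← lintegral_tsum fun γ ↦ (Measurable.ite (hmeas γ) hm.enorm measurable_const).aemeasurable]
    have h2 : ∀ᵐ z : ℍ, ∑' γ : SL(2, ℤ), (if γ⁻¹ • z ∈ fd then ‖H z‖ₑ else 0) =
        ‖H z‖ₑ + ‖H z‖ₑ := by
      filter_upwards [ae_exists_inv_smul_mem_fd_iff] with z ⟨δ, hδ⟩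
      exact tsum_indicator_inv_smul hδ _
    rw [lintegral_congr_ae h2, lintegral_add_left hm.enorm]
    exact ENNReal.add_ne_top.mpr ⟨hH.2.ne, hH.2.ne⟩
  rw [integral_tsum]
  · simp_rw [setIntegral_comp_smul]
    rw [← integral_tsum _ hlin]
    · have h2 : ∀ᵐ z : ℍ, ∑' γ : SL(2, ℤ), (if γ⁻¹ • z ∈ fd then H z else 0) = 2 * H z := by
        filter_upwards [ae_exists_inv_smul_mem_fd_iff] with z ⟨δ, hδ⟩
        rw [tsum_indicator_inv_smul hδ, two_mul]
      rw [integral_congr_ae h2, integral_const_mul]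
    · exact fun γ ↦ (Measurable.ite (hmeas γ) hm measurable_const).aestronglyMeasurable
  · exact fun γ ↦ (hm.comp (measurePreserving_smul_SL γ).measurable).aestronglyMeasurable
  · convert! hlin using 3 with γ
    rw [setLIntegral_comp_smul (fun z ↦ ‖H z‖ₑ)]
    refine lintegral_congr fun z ↦ ?_
    split_ifs <;> simp

end HeckeMoments

end

open scoped MatrixGroups UpperHalfPlane

noncomputable section

namespace HeckeMoments

open UpperHalfPlane ModularGroup MeasureTheory

open scoped ModularForm ENNReal ComplexConjugate

/-! ### Inner products with Poincaré series -/

/-- The decomposition of `SL(2, ℤ)` into cosets of the translations. -/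
def cosetEquiv : Primitive × ℤ ≃ SL(2, ℤ) :=
  Equiv.ofBijective (fun x ↦ T ^ x.2 * completeRow x.1) <| by
    constructor
    · rintro ⟨v, t⟩ ⟨v', t'⟩ h
      simp only at h
      have hv : v = v' := by
        rw [← bottomRow_completeRow v, ← bottomRow_completeRow v', ← bottomRow_T_zpow_mul t, h,
          bottomRow_T_zpow_mul]
      subst hv
      have ht : (T ^ t) 0 1 = (T ^ t') 0 1 := by rw [mul_right_cancel h]
      rw [coe_T_zpow, coe_T_zpow] at ht
      simpa using ht
    · intro γ
      obtain ⟨t, ht⟩ := exists_eq_T_zpow_mul (γ := γ) (δ := completeRow (bottomRow γ))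
        (by rw [completeRow_one]; rfl)
      exact ⟨(bottomRow γ, t), ht.symm⟩

lemma cosetEquiv_apply (x : Primitive × ℤ) : cosetEquiv x = T ^ x.2 * completeRow x.1 := rfl

/-- The strip `0 ≤ re z < 1`. -/
def strip : Set ℍ := {z | z.re ∈ Set.Ico (0 : ℝ) 1}

lemma measurableSet_strip : MeasurableSet strip :=
  continuous_re.measurable measurableSet_Ico

/-- Exactly one translate of w lies in the strip, the one with t = -⌊Re w⌋. -/
lemma hasSum_indicator_strip {E : Type*} [AddCommMonoid E] [TopologicalSpace E] {h : ℍ → E}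
    (hT : ∀ (t : ℤ) z, h (T ^ t • z) = h z) (w : ℍ) :
    HasSum (fun t : ℤ ↦ strip.indicator h (T ^ t • w)) (h w) := by
  have hmem : ∀ t : ℤ, T ^ t • w ∈ strip ↔ t = -⌊w.re⌋ := by
    intro t
    have h1 : (T ^ t • w).re = w.re + t := re_T_zpow_smul w t
    rw [eq_neg_iff_add_eq_zero, add_comm, ← Int.floor_add_intCast, Int.floor_eq_iff, ← h1]
    simp only [Int.cast_zero, zero_add]
    rfl
  have := hasSum_single (f := fun t : ℤ ↦ strip.indicator h (T ^ t • w)) (-⌊w.re⌋) fun t ht ↦ by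
    rw [Set.indicator_of_notMem]
    rwa [hmem]
  rwa [Set.indicator_of_mem ((hmem _).mpr rfl), hT] at this

lemma cuspForm_slash {k : ℤ} (f : CuspForm 𝒮ℒ k) (γ : SL(2, ℤ)) : ⇑f ∣[k] γ = f := by
  rw [ModularForm.SL_slash]
  exact f.slash_action_eq' _ ⟨γ, rfl⟩

lemma petersson_slash_expFun {k : ℤ} (m : ℕ) (f : CuspForm 𝒮ℒ k) (γ : SL(2, ℤ)) (z : ℍ) :
    petersson k (expFun m ∣[k] γ) f z = petersson k (expFun m) f (γ • z) := by
  rw [← petersson_slash_SL, cuspForm_slash]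

lemma petersson_expFun_T_zpow_smul {k : ℤ} (m : ℕ) (f : CuspForm 𝒮ℒ k) (t : ℤ) (z : ℍ) :
    petersson k (expFun m) f (T ^ t • z) = petersson k (expFun m) f z := by
  have h : (T ^ t) 1 = (1 : SL(2, ℤ)) 1 := by
    rw [coe_T_zpow]
    ext j
    fin_cases j <;> simp
  rw [← petersson_slash_expFun, slash_expFun_eq h, SlashAction.slash_one]

/-- Cutting off to the strip replaces each coset of translations by a sum over its elements, so that
the unfolding over the whole of SL(2, ℤ) applies. -/
lemma petersson_poincare {k : ℤ} (hk : 3 ≤ k) (m : ℕ) (f : CuspForm 𝒮ℒ k) (z : ℍ) :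
    petersson k (poincare k m) f z =
      ∑' γ : SL(2, ℤ), strip.indicator (petersson k (expFun m) f) (γ • z) := by
  set h := petersson k (expFun m) f with hh
  have hT : ∀ (t : ℤ) z, h (T ^ t • z) = h z := petersson_expFun_T_zpow_smul (k := k) m f
  have hs : Summable fun x : Primitive × ℤ ↦ strip.indicator h (cosetEquiv x • z) := by
    refine Summable.of_norm ((summable_prod_of_nonneg fun _ ↦ norm_nonneg _).mpr ?_)
    have h1 : ∀ v : Primitive, HasSum
        (fun t : ℤ ↦ ‖strip.indicator h (cosetEquiv (v, t) • z)‖) ‖h (completeRow v • z)‖ := by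
      intro v
      have := hasSum_indicator_strip (h := fun w ↦ ‖h w‖) (fun t w ↦ by rw [hT t w])
        (completeRow v • z)
      refine this.congr_fun fun t ↦ ?_
      rw [norm_indicator_eq_indicator_norm, cosetEquiv_apply, mul_smul]
    refine ⟨fun v ↦ (h1 v).summable, ?_⟩
    simp_rw [(h1 _).tsum_eq, hh, ← petersson_slash_expFun, petersson, norm_mul, RCLike.norm_conj]
    exact ((summable_norm_slash_expFun hk m z).mul_right _).mul_right _
  rw [← cosetEquiv.tsum_eq, hs.tsum_prod]
  have h2 : ∀ v : Primitive, ∑' t : ℤ, strip.indicator h (cosetEquiv (v, t) • z) =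
      conj ((expFun m ∣[k] completeRow v) z) * f z * z.im ^ k := by
    intro v
    simp_rw [cosetEquiv_apply, mul_smul]
    rw [(hasSum_indicator_strip hT (completeRow v • z)).tsum_eq, hh, ← petersson_slash_expFun,
      petersson]
  simp_rw [h2]
  rw [tsum_mul_right, tsum_mul_right, petersson, poincare]
  congr 2
  exact ((summable_slash_expFun hk m z).hasSum.star.tsum_eq).symm

lemma norm_expFun (m : ℕ) (z : ℍ) : ‖expFun m z‖ = Real.exp (-(2 * Real.pi * m * z.im)) := by
  rw [expFun, norm_pow, Function.Periodic.norm_qParam, ← Real.exp_nat_mul]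
  congr 1
  simp
  ring

lemma measurable_petersson {k : ℤ} (m : ℕ) (f : CuspForm 𝒮ℒ k) :
    Measurable (petersson k (expFun m) f) :=
  (petersson_continuous k (mdifferentiable_expFun m).continuous
    (CuspFormClass.holo f).continuous).measurable

/-- Hecke's bound |f| ≤ C y^(-k/2) leaves y^(k/2 - 2) e^(-2πmy), which is integrable at 0 since k/2
- 2 > -1. -/
lemma integrable_indicator_strip {k : ℕ} (hk : 6 ≤ k) {m : ℕ} (hm : m ≠ 0)
    (f : CuspForm 𝒮ℒ (k : ℤ)) :
    Integrable (strip.indicator (petersson k (expFun m) f)) := by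
  obtain ⟨C, hC⟩ := CuspFormClass.exists_bound f
  set G : ℝ × ℝ → ℝ := fun p ↦ (Set.Ico (0 : ℝ) 1).indicator 1 p.1 *
    (Real.exp (-(2 * Real.pi * m * p.2)) * (C / p.2 ^ (((k : ℤ) : ℝ) / 2)) * p.2 ^ k) with hG
  have hint : Integrable (fun z : ℍ ↦ G (z.re, z.im)) := by
    rw [integrable_comp_re_im_iff, IntegrableOn, restrict_univ_prod_Ioi]
    have h1 : Integrable ((Set.Ico (0 : ℝ) 1).indicator (1 : ℝ → ℝ)) :=
      (integrableOn_const (by simp)).integrable_indicator measurableSet_Ico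
    have hk' : (6 : ℝ) ≤ k := by exact_mod_cast hk
    have h2 := (integrableOn_rpow_mul_exp_neg_mul_rpow (p := 1) (s := (k : ℝ) / 2 - 2)
      (b := 2 * Real.pi * m) (by linarith) one_pos (by positivity)).integrable.const_mul C
    refine (h1.mul_prod h2).congr ?_
    rw [Filter.EventuallyEq, ← restrict_univ_prod_Ioi]
    filter_upwards [ae_restrict_mem (MeasurableSet.univ.prod measurableSet_Ioi)] with p hp
    have hp' : 0 < p.2 := hp.2
    simp only [hG, smul_eq_mul, Int.cast_natCast, Real.rpow_one, neg_mul]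
    have e : p.2 ^ ((k : ℝ) / 2 - 2) = (p.2 ^ 2)⁻¹ * (p.2 ^ k / p.2 ^ ((k : ℝ) / 2)) := by
      rw [Real.rpow_sub hp', Real.rpow_two, ← Real.rpow_natCast p.2 k, ← Real.rpow_sub hp',
        show (k : ℝ) - k / 2 = k / 2 by ring]
      field_simp
    rw [e]
    ring
  refine hint.mono' ((measurable_petersson m f).indicator measurableSet_strip).aestronglyMeasurable
    (ae_of_all _ fun z ↦ ?_)
  have him := z.im_pos
  by_cases hz : z ∈ strip
  · have hz' : z.re ∈ Set.Ico (0 : ℝ) 1 := hz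
    rw [Set.indicator_of_mem hz, hG, petersson, norm_mul, norm_mul, RCLike.norm_conj, norm_expFun]
    simp only
    rw [Set.indicator_of_mem hz', Pi.one_apply, one_mul]
    have : ‖(z.im : ℂ) ^ (k : ℤ)‖ = z.im ^ k := by
      rw [norm_zpow, Complex.norm_real, Real.norm_of_nonneg him.le, zpow_natCast]
    rw [this]
    gcongr
    exact hC z
  · have hz' : z.re ∉ Set.Ico (0 : ℝ) 1 := hz
    rw [Set.indicator_of_notMem hz, hG]
    simp only
    rw [Set.indicator_of_notMem hz', zero_mul, norm_zero]

/-- The conjugate of e(mz) is e^(-4πmy)/e(mz), so the integral over x is the m-th coefficient of f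
times e^(-4πmy). The integral over y is then a Gamma integral. -/
lemma integral_indicator_strip {k : ℕ} (hk : 6 ≤ k) {m : ℕ} (hm : m ≠ 0)
    (f : CuspForm 𝒮ℒ (k : ℤ)) :
    ∫ z, strip.indicator (petersson k (expFun m) f) z =
      ((Real.Gamma (k - 1) / (4 * Real.pi * m) ^ (k - 1) : ℝ) : ℂ) * fourierCoeff m f := by
  set h := petersson k (expFun m) f with hh
  set G : ℝ × ℝ → ℂ := fun p ↦ (Set.Ico (0 : ℝ) 1).indicator
    (fun x ↦ h (ofComplex (x + p.2 * Complex.I))) p.1 with hG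
  have hcoe : ∀ z : ℍ, strip.indicator h z = G (z.re, z.im) := by
    intro z
    have hz : ofComplex (z.re + z.im * Complex.I) = z := by
      rw [show (z.re : ℂ) + z.im * Complex.I = z from Complex.re_add_im z, ofComplex_apply]
    by_cases hz' : z ∈ strip
    · have hz'' : z.re ∈ Set.Ico (0 : ℝ) 1 := hz'
      simp only [hG]
      rw [Set.indicator_of_mem hz', Set.indicator_of_mem hz'', hz]
    · have hz'' : z.re ∉ Set.Ico (0 : ℝ) 1 := hz'
      simp only [hG]
      rw [Set.indicator_of_notMem hz', Set.indicator_of_notMem hz'']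
  have hint := integrable_indicator_strip hk hm f
  rw [← hh, funext hcoe, integrable_comp_re_im_iff, IntegrableOn, restrict_univ_prod_Ioi] at hint
  rw [funext hcoe, integral_comp_re_im, restrict_univ_prod_Ioi, integral_prod_symm _ hint]
  have hinner : ∀ y ∈ Set.Ioi (0 : ℝ), ∫ x : ℝ, (y ^ 2)⁻¹ • G (x, y) =
      ((y ^ ((k : ℝ) - 1 - 1) * Real.exp (-(4 * Real.pi * m * y)) : ℝ) : ℂ) *
        fourierCoeff m f := by
    intro y hy
    have hy' : 0 < y := hy
    have e1 := ModularFormClass.qExpansion_coeff_eq_intervalIntegral f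
      one_pos one_mem_strictPeriods_SL m hy'
    simp only [Complex.ofReal_one, div_one, one_mul] at e1
    rw [integral_smul, hG]
    simp only
    rw [integral_indicator measurableSet_Ico, integral_Ico_eq_integral_Ioc,
      ← intervalIntegral.integral_of_le zero_le_one, fourierCoeff_apply, e1,
      ← intervalIntegral.integral_const_mul, ← intervalIntegral.integral_smul]
    refine intervalIntegral.integral_congr fun x _ ↦ ?_
    have him : 0 < ((x : ℂ) + y * Complex.I).im := by simpa using hy'
    rw [ofComplex_apply_of_im_pos him, hh, petersson]
    set w : ℍ := ⟨x + y * Complex.I, him⟩ with hw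
    have hwim : w.im = y := by simp [hw, UpperHalfPlane.im]
    have hq : expFun m w ≠ 0 := pow_ne_zero _ (Function.Periodic.qParam_ne_zero _)
    have e2 : conj (expFun m w) = ((Real.exp (-(4 * Real.pi * m * y)) : ℝ) : ℂ) *
        (1 / expFun m w) := by
      rw [mul_one_div, eq_div_iff hq, Complex.conj_mul', norm_expFun, hwim, ← Complex.ofReal_pow,
        ← Real.exp_nat_mul]
      congr 2
      push_cast
      ring
    have e3 : (y ^ 2)⁻¹ * y ^ k = y ^ ((k : ℝ) - 1 - 1) := by
      rw [Real.rpow_sub hy', Real.rpow_sub hy', Real.rpow_one, Real.rpow_natCast]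
      field_simp
    rw [e2, hwim, ← e3, zpow_natCast, Complex.real_smul]
    change _ = _ * (1 / expFun m w * f w)
    push_cast
    ring
  have hk' : (6 : ℝ) ≤ k := by exact_mod_cast hk
  rw [setIntegral_congr_fun measurableSet_Ioi hinner, integral_mul_const, integral_complex_ofReal,
    Real.integral_rpow_mul_exp_neg_mul_Ioi (by linarith) (by positivity)]
  congr 2
  have : ((k : ℝ) - 1) = ((k - 1 : ℕ) : ℝ) := by rw [Nat.cast_pred (by omega)]
  conv_lhs => rw [this, Real.rpow_natCast]
  rw [one_div, inv_pow, this]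
  field_simp

/-- The Petersson inner product with a Poincaré series is a Fourier coefficient. -/
lemma peterssonInner_poincareForm {k : ℕ} (hk : 6 ≤ k) (hev : Even k) {m : ℕ} (hm : m ≠ 0)
    (f : CuspForm 𝒮ℒ (k : ℤ)) :
    peterssonInner (poincareForm hk hev hm) f =
      2 * ((Real.Gamma (k - 1) / (4 * Real.pi * m) ^ (k - 1) : ℝ) : ℂ) * fourierCoeff m f := by
  have h : ∀ z : ℍ, petersson k (poincareForm hk hev hm) f z =
      ∑' γ : SL(2, ℤ), strip.indicator (petersson k (expFun m) f) (γ • z) :=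
    petersson_poincare (by omega) m f
  rw [peterssonInner]
  simp_rw [h]
  rw [setIntegral_fd_tsum (integrable_indicator_strip hk hm f)
    ((measurable_petersson m f).indicator measurableSet_strip), integral_indicator_strip hk hm]
  ring

lemma integrableOn_petersson {k : ℤ} (f g : CuspForm 𝒮ℒ k) :
    IntegrableOn (petersson k f g) fd := by
  obtain ⟨C, hC⟩ := CuspFormClass.petersson_bounded_left k 𝒮ℒ f g
  have hc : Continuous (petersson k f g) :=
    petersson_continuous k (CuspFormClass.holo f).continuous (CuspFormClass.holo g).continuous
  exact Measure.integrableOn_of_bounded volume_fd_lt_top.ne hc.aestronglyMeasurable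
    (ae_of_all _ hC)

end HeckeMoments

end

open scoped MatrixGroups UpperHalfPlane

noncomputable section

namespace HeckeMoments

open scoped InnerProductSpace ComplexConjugate

/-! ### Commuting symmetric operators with multiplicity one -/

section HeckeSystem

variable {V : Type*} [NormedAddCommGroup V] [InnerProductSpace ℂ V]

/-- A commuting family of symmetric operators `T n` together with a separating family of
functionals `a n` such that `a n f = a 1 (T n f)`. -/
structure IsHeckeSystem (a : ℕ → V →ₗ[ℂ] ℂ) (T : ℕ → V →ₗ[ℂ] V) : Prop where
  symm : ∀ n, n ≠ 0 → (T n).IsSymmetric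
  comm : ∀ m n, m ≠ 0 → n ≠ 0 → Commute (T m) (T n)
  coeff_one : ∀ n, n ≠ 0 → ∀ f, a 1 (T n f) = a n f
  separating : ∀ f, (∀ n, n ≠ 0 → a n f = 0) → f = 0

/-- The common eigenvectors of the `T n`, normalized by `a 1 f = 1`. -/
def normalizedEigenvectors (a : ℕ → V →ₗ[ℂ] ℂ) (T : ℕ → V →ₗ[ℂ] V) : Set V :=
  {f | a 1 f = 1 ∧ ∀ n, n ≠ 0 → ∃ c : ℂ, T n f = c • f}

variable {a : ℕ → V →ₗ[ℂ] ℂ} {T : ℕ → V →ₗ[ℂ] V}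

namespace IsHeckeSystem

variable (h : IsHeckeSystem a T)

include h

lemma apply_eq_smul {f : V} (hf : f ∈ normalizedEigenvectors a T) {n : ℕ} (hn : n ≠ 0) :
    T n f = a n f • f := by
  obtain ⟨c, hc⟩ := hf.2 n hn
  have := h.coeff_one n hn f
  rw [hc, map_smul, hf.1, smul_eq_mul, mul_one] at this
  rw [hc, this]

omit h in
lemma ne_zero_of_mem {f : V} (hf : f ∈ normalizedEigenvectors a T) : f ≠ 0 := by
  rintro rfl
  simpa using hf.1

lemma conj_coeff {f : V} (hf : f ∈ normalizedEigenvectors a T) {n : ℕ} (hn : n ≠ 0) :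
    conj (a n f) = a n f := by
  have := h.symm n hn f f
  rw [h.apply_eq_smul hf hn, inner_smul_left, inner_smul_right] at this
  exact mul_right_cancel₀ (inner_self_ne_zero.mpr (ne_zero_of_mem hf)) this

/-- Multiplicity one: if f and g are not orthogonal, their real eigenvalues a_n agree for all n ≠ 0,
and the a_n separate vectors. -/
lemma inner_eq_zero {f g : V} (hf : f ∈ normalizedEigenvectors a T)
    (hg : g ∈ normalizedEigenvectors a T) (hfg : f ≠ g) : ⟪f, g⟫_ℂ = 0 := by
  by_contra hne
  refine hfg (sub_eq_zero.mp (h.separating _ fun n hn ↦ ?_))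
  have := h.symm n hn f g
  rw [h.apply_eq_smul hf hn, h.apply_eq_smul hg hn, inner_smul_left, inner_smul_right,
    h.conj_coeff hf hn] at this
  rw [map_sub, mul_right_cancel₀ hne this, sub_self]

variable [FiniteDimensional ℂ V]

lemma finite : (normalizedEigenvectors a T).Finite := by
  have hli : LinearIndependent ℂ ((↑) : normalizedEigenvectors a T → V) :=
    linearIndependent_of_ne_zero_of_inner_eq_zero (fun f ↦ ne_zero_of_mem f.2)
      fun f g hfg ↦ h.inner_eq_zero f.2 g.2 fun h' ↦ hfg (Subtype.ext h')
  exact hli.set_finite_of_isNoetherian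

/-- Joint eigenspaces span. A joint eigenvector with a_1 = 0 has a_n = a_1 ∘ T_n = 0 for all n ≠ 0,
hence is zero; any other can be normalized. -/
lemma span_eq_top : Submodule.span ℂ (normalizedEigenvectors a T) = ⊤ := by
  have htop := LinearMap.IsSymmetric.iSup_iInf_eq_top_of_commute (𝕜 := ℂ) (E := V)
    (ι := {n : ℕ // n ≠ 0})
    (T := fun n ↦ T n.1) (fun n ↦ h.symm n.1 n.2) fun m n _ ↦ h.comm m.1 n.1 m.2 n.2
  rw [eq_top_iff, ← htop]
  refine iSup_le fun χ v hv ↦ ?_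
  have hv' : ∀ n (hn : n ≠ 0), T n v = χ ⟨n, hn⟩ • v := fun n hn ↦
    Module.End.mem_eigenspace_iff.mp ((Submodule.mem_iInf _).mp hv ⟨n, hn⟩)
  by_cases h1 : a 1 v = 0
  · have : v = 0 := h.separating v fun n hn ↦ by
      rw [← h.coeff_one n hn, hv' n hn, map_smul, h1, smul_zero]
    rw [this]
    exact Submodule.zero_mem _
  · have hmem : (a 1 v)⁻¹ • v ∈ normalizedEigenvectors a T := by
      refine ⟨by rw [map_smul, smul_eq_mul, inv_mul_cancel₀ h1], fun n hn ↦ ⟨χ ⟨n, hn⟩, ?_⟩⟩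
      rw [map_smul, hv' n hn, smul_comm]
    have := Submodule.smul_mem _ (a 1 v) (Submodule.subset_span (R := ℂ) hmem)
    rwa [smul_inv_smul₀ h1] at this

/-- The expansion in normalized eigenvectors of the vector which represents `a 1`. -/
lemma eq_sum_smul {p : V} {c : ℂ} (hp : ∀ f, ⟪p, f⟫_ℂ = conj c * a 1 f) :
    p = ∑ f ∈ h.finite.toFinset, (c / ⟪f, f⟫_ℂ) • f := by
  rw [← sub_eq_zero]
  set w := p - ∑ f ∈ h.finite.toFinset, (c / ⟪f, f⟫_ℂ) • f with hw
  suffices hs : ∀ g ∈ Submodule.span ℂ (normalizedEigenvectors a T), ⟪w, g⟫_ℂ = 0 by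
    exact inner_self_eq_zero.mp (hs w (by rw [h.span_eq_top]; trivial))
  intro g hg
  induction hg using Submodule.span_induction with
  | zero => exact inner_zero_right _
  | add x y _ _ hx hy => rw [inner_add_right, hx, hy, add_zero]
  | smul r x _ hx => rw [inner_smul_right, hx, mul_zero]
  | mem g hg =>
    rw [hw, inner_sub_left, hp, hg.1, mul_one, sum_inner,
      Finset.sum_eq_single_of_mem g (by simpa using hg)]
    · rw [inner_smul_left, map_div₀, inner_self_conj,
        div_mul_cancel₀ _ (inner_self_ne_zero.mpr (ne_zero_of_mem hg)), sub_self]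
    · intro f hf hfg
      rw [inner_smul_left, h.inner_eq_zero (by simpa using hf) hg hfg, mul_zero]

end IsHeckeSystem

end HeckeSystem

end HeckeMoments

end

open scoped MatrixGroups UpperHalfPlane

noncomputable section

namespace HeckeMoments

open UpperHalfPlane ModularGroup MeasureTheory

open scoped ModularForm ComplexConjugate

/-! ### The Petersson inner product -/

lemma peterssonInner_conj_symm {k : ℕ} (f g : CuspForm 𝒮ℒ (k : ℤ)) :
    conj (peterssonInner g f) = peterssonInner f g := by
  rw [peterssonInner, peterssonInner, ← integral_conj]
  exact integral_congr_ae (ae_of_all _ fun z ↦ (petersson_symm _ _ _ z).symm)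

lemma peterssonInner_add_left {k : ℕ} (f g h : CuspForm 𝒮ℒ (k : ℤ)) :
    peterssonInner (f + g) h = peterssonInner f h + peterssonInner g h := by
  rw [peterssonInner, peterssonInner, peterssonInner,
    ← integral_add (integrableOn_petersson f h) (integrableOn_petersson g h)]
  refine integral_congr_ae (ae_of_all _ fun z ↦ ?_)
  simp only [petersson, add_apply, map_add]
  ring

lemma peterssonInner_smul_left {k : ℕ} (c : ℂ) (f g : CuspForm 𝒮ℒ (k : ℤ)) :
    peterssonInner (c • f) g = conj c * peterssonInner f g := by
  rw [peterssonInner, peterssonInner, ← integral_const_mul]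
  refine integral_congr_ae (ae_of_all _ fun z ↦ ?_)
  simp only [petersson, smul_apply, smul_eq_mul, map_mul]
  ring

lemma petersson_self_eq_ofReal (k : ℕ) (f : ℍ → ℂ) (z : ℍ) :
    petersson k f f z = ((‖f z‖ ^ 2 * z.im ^ k : ℝ) : ℂ) := by
  rw [petersson, Complex.conj_mul', zpow_natCast]
  push_cast
  rfl

lemma re_peterssonInner_self_nonneg {k : ℕ} (f : CuspForm 𝒮ℒ (k : ℤ)) :
    0 ≤ (peterssonInner f f).re := by
  simp_rw [peterssonInner, petersson_self_eq_ofReal]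
  rw [integral_complex_ofReal, Complex.ofReal_re]
  exact integral_nonneg fun z ↦ by have := z.im_pos; positivity

/-- The Petersson inner product is a positive semidefinite Hermitian form. -/
@[reducible]
def peterssonPreCore (k : ℕ) : PreInnerProductSpace.Core ℂ (CuspForm 𝒮ℒ (k : ℤ)) where
  inner := peterssonInner
  conj_inner_symm f g := peterssonInner_conj_symm f g
  re_inner_nonneg f := re_peterssonInner_self_nonneg f
  add_left := peterssonInner_add_left
  smul_left f g c := peterssonInner_smul_left c f g

/-- The constant `2 Γ(k - 1) / (4πm)^(k-1)`. -/
def unfoldingConst (k m : ℕ) : ℝ := 2 * (Real.Gamma (k - 1) / (4 * Real.pi * m) ^ (k - 1))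

lemma unfoldingConst_pos {k m : ℕ} (hk : 6 ≤ k) (hm : m ≠ 0) : 0 < unfoldingConst k m := by
  have hk' : (6 : ℝ) ≤ k := by exact_mod_cast hk
  have := Real.Gamma_pos_of_pos (show (0 : ℝ) < k - 1 by linarith)
  rw [unfoldingConst]
  positivity

section

variable {k : ℕ} (hk : 6 ≤ k) (hev : Even k)

lemma peterssonInner_poincareForm_eq {m : ℕ} (hm : m ≠ 0) (f : CuspForm 𝒮ℒ (k : ℤ)) :
    peterssonInner (poincareForm hk hev hm) f = unfoldingConst k m * fourierCoeff m f := by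
  rw [peterssonInner_poincareForm, unfoldingConst]
  push_cast
  ring

include hk hev in
lemma eq_zero_of_forall_peterssonInner_poincareForm {f : CuspForm 𝒮ℒ (k : ℤ)}
    (hf : ∀ m (hm : m ≠ 0), peterssonInner (poincareForm hk hev hm) f = 0) : f = 0 := by
  refine eq_zero_of_fourierCoeff fun m hm ↦ ?_
  have := hf m hm
  rw [peterssonInner_poincareForm_eq, mul_eq_zero, Complex.ofReal_eq_zero] at this
  exact this.resolve_left (unfoldingConst_pos hk hm).ne'

include hk hev in
-- Cauchy–Schwarz already holds for the semidefinite form and forces ⟨P_m, f⟩ = 0 for every m, so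
-- all coefficients of f vanish.
lemma eq_zero_of_peterssonInner_self {f : CuspForm 𝒮ℒ (k : ℤ)} (hf : peterssonInner f f = 0) :
    f = 0 := by
  refine eq_zero_of_forall_peterssonInner_poincareForm hk hev fun m hm ↦ ?_
  let c : PreInnerProductSpace.Core ℂ (CuspForm 𝒮ℒ (k : ℤ)) := peterssonPreCore k
  have h : ‖peterssonInner (poincareForm hk hev hm) f‖ *
      ‖peterssonInner f (poincareForm hk hev hm)‖ ≤
      (peterssonInner (poincareForm hk hev hm) (poincareForm hk hev hm)).re *
        (peterssonInner f f).re :=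
    InnerProductSpace.Core.inner_mul_inner_self_le (𝕜 := ℂ) (poincareForm hk hev hm) f
  rw [hf, Complex.zero_re, mul_zero, ← peterssonInner_conj_symm f, RCLike.norm_conj] at h
  exact norm_eq_zero.mp (mul_self_eq_zero.mp (le_antisymm h (mul_self_nonneg _)))

/-- The Petersson inner product is an inner product. -/
@[reducible]
def peterssonCore : InnerProductSpace.Core ℂ (CuspForm 𝒮ℒ (k : ℤ)) where
  __ := peterssonPreCore k
  definite _ h := eq_zero_of_peterssonInner_self hk hev h

instance finiteDimensional_cuspForm (k : ℤ) : FiniteDimensional ℂ (CuspForm 𝒮ℒ k) :=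
  FiniteDimensional.of_injective (CuspForm.toModularFormₗ (Γ := 𝒮ℒ) (k := k))
    CuspForm.toModularFormₗ_injective

/-- A form orthogonal to every P_m has no nonzero coefficient. Linear statements about T_n may
therefore be checked on Poincaré series. -/
lemma span_poincareForm :
    Submodule.span ℂ {f | ∃ m, ∃ hm : m ≠ 0, f = poincareForm hk hev hm} = ⊤ := by
  let _ : NormedAddCommGroup (CuspForm 𝒮ℒ (k : ℤ)) := (peterssonCore hk hev).toNormedAddCommGroup
  let _ : InnerProductSpace ℂ (CuspForm 𝒮ℒ (k : ℤ)) :=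
    InnerProductSpace.ofCore (peterssonPreCore k)
  rw [← Submodule.orthogonal_eq_bot_iff, eq_bot_iff]
  intro f hf
  rw [Submodule.mem_orthogonal] at hf
  exact eq_zero_of_forall_peterssonInner_poincareForm hk hev fun m hm ↦
    hf _ (Submodule.subset_span ⟨m, hm, rfl⟩)

/-! ### Hecke operators on cusp forms -/

lemma heckeOperator_add (k : ℤ) (n : ℕ) (f g : ℍ → ℂ) :
    heckeOperator k n (f + g) = heckeOperator k n f + heckeOperator k n g := by
  ext z
  simp only [heckeOperator, Pi.add_apply, mul_add, Finset.sum_add_distrib]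

lemma heckeOperator_smul (k : ℤ) (n : ℕ) (c : ℂ) (f : ℍ → ℂ) :
    heckeOperator k n (c • f) = c • heckeOperator k n f := by
  ext z
  simp only [heckeOperator, Pi.smul_apply, smul_eq_mul, Finset.mul_sum]
  exact Finset.sum_congr rfl fun _ _ ↦ Finset.sum_congr rfl fun _ _ ↦ by ring

lemma div_mul_ne_zero_of_mem {m n : ℕ} (hm : m ≠ 0) {ad : ℕ × ℕ}
    (had : ad ∈ n.divisorsAntidiagonal) (hd : ad.2 ∣ m) : m / ad.2 * ad.1 ≠ 0 := by
  obtain ⟨h1, h2⟩ := Nat.mem_divisorsAntidiagonal.mp had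
  refine mul_ne_zero (Nat.div_ne_zero_iff_of_dvd hd |>.mpr ⟨hm, ?_⟩) ?_
  · rintro h
    exact h2 (by rw [← h1, h, mul_zero])
  · rintro h
    exact h2 (by rw [← h1, h, zero_mul])

open scoped Classical in
/-- The Poincaré series of index `m`, or `0` if `m = 0`. -/
def poincareOrZero (m : ℕ) : CuspForm 𝒮ℒ (k : ℤ) :=
  if hm : m ≠ 0 then poincareForm hk hev hm else 0

lemma poincareOrZero_eq {m : ℕ} (hm : m ≠ 0) :
    poincareOrZero hk hev m = poincareForm hk hev hm := dif_pos hm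

lemma peterssonInner_poincareOrZero {m : ℕ} (hm : m ≠ 0) (f : CuspForm 𝒮ℒ (k : ℤ)) :
    peterssonInner (poincareOrZero hk hev m) f = unfoldingConst k m * fourierCoeff m f := by
  rw [poincareOrZero_eq hk hev hm, peterssonInner_poincareForm_eq]

lemma heckeOperator_poincareForm {m n : ℕ} (hm : m ≠ 0) (hn : n ≠ 0) :
    heckeOperator k n (poincareForm hk hev hm) =
      ⇑(∑ ad ∈ n.divisorsAntidiagonal, if ad.2 ∣ m then
        (ad.1 : ℂ) ^ (k - 1) • poincareOrZero hk hev (m / ad.2 * ad.1) else 0) := by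
  ext z
  have h := heckeOperator_poincare (k := k) (by omega) hn m z
  refine h.trans ?_
  rw [FunLike.coe_sum, Finset.sum_apply]
  refine Finset.sum_congr rfl fun ad had ↦ ?_
  split_ifs with hd
  · rw [poincareOrZero_eq hk hev (div_mul_ne_zero_of_mem hm had hd), smul_apply,
      poincareForm_apply, smul_eq_mul, ← zpow_natCast, Nat.cast_pred (by omega)]
  · rfl

include hk hev in
-- On the spanning set T_n P_m is a combination of Poincaré series, so modularity and vanishing at
-- the cusp need no separate check.
lemma exists_cuspForm_eq_heckeOperator {n : ℕ} (hn : n ≠ 0) (f : CuspForm 𝒮ℒ (k : ℤ)) :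
    ∃ g : CuspForm 𝒮ℒ (k : ℤ), ⇑g = heckeOperator k n f := by
  have hf : f ∈ Submodule.span ℂ {f | ∃ m, ∃ hm : m ≠ 0, f = poincareForm hk hev hm} := by
    rw [span_poincareForm]
    trivial
  induction hf using Submodule.span_induction with
  | zero =>
    refine ⟨0, ?_⟩
    have := heckeOperator_smul k n 0 (0 : CuspForm 𝒮ℒ (k : ℤ))
    rw [zero_smul, zero_smul] at this
    exact this.symm
  | add x y _ _ hx hy =>
    obtain ⟨g, hg⟩ := hx
    obtain ⟨g', hg'⟩ := hy
    exact ⟨g + g', by rw [FunLike.coe_add, FunLike.coe_add, heckeOperator_add, hg, hg']⟩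
  | smul r x _ hx =>
    obtain ⟨g, hg⟩ := hx
    exact ⟨r • g, by rw [FunLike.coe_smul, FunLike.coe_smul, heckeOperator_smul, hg]⟩
  | mem x hx =>
    obtain ⟨m, hm, rfl⟩ := hx
    exact ⟨_, (heckeOperator_poincareForm hk hev hm hn).symm⟩

open scoped Classical in
/-- The Hecke operator `T_n` on cusp forms (and `0` for `n = 0`). -/
def heckeEnd (n : ℕ) : CuspForm 𝒮ℒ (k : ℤ) →ₗ[ℂ] CuspForm 𝒮ℒ (k : ℤ) :=
  if hn : n ≠ 0 then
    { toFun := fun f ↦ (exists_cuspForm_eq_heckeOperator hk hev hn f).choose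
      map_add' := fun f g ↦ DFunLike.coe_injective <| by
        rw [(exists_cuspForm_eq_heckeOperator hk hev hn _).choose_spec, FunLike.coe_add,
          FunLike.coe_add, (exists_cuspForm_eq_heckeOperator hk hev hn f).choose_spec,
          (exists_cuspForm_eq_heckeOperator hk hev hn g).choose_spec, heckeOperator_add]
      map_smul' := fun c f ↦ DFunLike.coe_injective <| by
        rw [RingHom.id_apply, (exists_cuspForm_eq_heckeOperator hk hev hn _).choose_spec,
          FunLike.coe_smul, FunLike.coe_smul,
          (exists_cuspForm_eq_heckeOperator hk hev hn f).choose_spec, heckeOperator_smul] }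
  else 0

lemma coe_heckeEnd {n : ℕ} (hn : n ≠ 0) (f : CuspForm 𝒮ℒ (k : ℤ)) :
    ⇑(heckeEnd hk hev n f) = heckeOperator k n f := by
  rw [heckeEnd, dif_pos hn]
  exact (exists_cuspForm_eq_heckeOperator hk hev hn f).choose_spec

lemma fourierCoeff_heckeEnd {n : ℕ} (hn : n ≠ 0) (f : CuspForm 𝒮ℒ (k : ℤ)) (r : ℕ) :
    fourierCoeff r (heckeEnd hk hev n f) = seqHecke (k - 1) n (fun s ↦ fourierCoeff s f) r := by
  refine fourierCoeff_eq_of_hasSum (fun z ↦ ?_) r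
  rw [coe_heckeEnd hk hev hn]
  exact hasSum_heckeOperator (by omega) n (hasSum_fourierCoeff f) z

/-! ### Self-adjointness and commutation of the Hecke operators -/

lemma sum_divisorsAntidiagonal_ite {E : Type*} [AddCommMonoid E] {m n : ℕ} (hm : m ≠ 0)
    (hn : n ≠ 0) (F : ℕ → ℕ → E) :
    (∑ ad ∈ n.divisorsAntidiagonal, if ad.2 ∣ m then F ad.2 (m / ad.2 * ad.1) else 0) =
      ∑ d ∈ (m.gcd n).divisors, F d (m * n / d ^ 2) := by
  rw [Nat.sum_divisorsAntidiagonal' (n := n) fun a d ↦ if d ∣ m then F d (m / d * a) else 0,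
    ← Finset.sum_filter]
  have : n.divisors.filter (· ∣ m) = (m.gcd n).divisors := by
    ext d
    simp only [Finset.mem_filter, Nat.mem_divisors, Nat.dvd_gcd_iff, Ne, Nat.gcd_eq_zero_iff]
    tauto
  rw [this]
  refine Finset.sum_congr rfl fun d hd ↦ ?_
  obtain ⟨h1, h2⟩ := (Nat.dvd_gcd_iff.mp (Nat.dvd_of_mem_divisors hd))
  rw [Nat.div_mul_div_comm h1 h2, sq]

lemma peterssonInner_zero_left (f : CuspForm 𝒮ℒ (k : ℤ)) : peterssonInner 0 f = 0 := by
  have := peterssonInner_smul_left 0 0 f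
  rwa [zero_smul, map_zero, zero_mul] at this

lemma peterssonInner_sum_left {ι : Type*} (s : Finset ι) (F : ι → CuspForm 𝒮ℒ (k : ℤ))
    (f : CuspForm 𝒮ℒ (k : ℤ)) :
    peterssonInner (∑ i ∈ s, F i) f = ∑ i ∈ s, peterssonInner (F i) f := by
  classical
  induction s using Finset.induction_on with
  | empty => rw [Finset.sum_empty, Finset.sum_empty, peterssonInner_zero_left]
  | insert i s hi ih => rw [Finset.sum_insert hi, Finset.sum_insert hi, peterssonInner_add_left, ih]

lemma unfoldingConst_mul {m n : ℕ} (hm : m ≠ 0) {ad : ℕ × ℕ}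
    (had : ad ∈ n.divisorsAntidiagonal) (hd : ad.2 ∣ m) :
    (ad.1 : ℝ) ^ (k - 1) * unfoldingConst k (m / ad.2 * ad.1) =
      unfoldingConst k m * (ad.2 : ℝ) ^ (k - 1) := by
  obtain ⟨h1, h2⟩ := Nat.mem_divisorsAntidiagonal.mp had
  obtain ⟨c, rfl⟩ := hd
  have ha : ad.1 ≠ 0 := fun h ↦ h2 (by rw [← h1, h, zero_mul])
  have hd : ad.2 ≠ 0 := fun h ↦ h2 (by rw [← h1, h, mul_zero])
  have hc : c ≠ 0 := fun h ↦ hm (by rw [h, mul_zero])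
  rw [Nat.mul_div_cancel_left _ (Nat.pos_of_ne_zero hd), unfoldingConst, unfoldingConst]
  push_cast
  simp only [mul_pow]
  field_simp

/-- Both sides are combinations of the coefficients of g at mn/d². They match because the unfolding
constant is proportional to m^(1-k), which turns a^(k-1) into d^(k-1). -/
lemma peterssonInner_heckeEnd_poincareForm {m n : ℕ} (hm : m ≠ 0) (hn : n ≠ 0)
    (g : CuspForm 𝒮ℒ (k : ℤ)) :
    peterssonInner (heckeEnd hk hev n (poincareForm hk hev hm)) g =
      peterssonInner (poincareForm hk hev hm) (heckeEnd hk hev n g) := by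
  have h1 : heckeEnd hk hev n (poincareForm hk hev hm) =
      ∑ ad ∈ n.divisorsAntidiagonal, if ad.2 ∣ m then
        (ad.1 : ℂ) ^ (k - 1) • poincareOrZero hk hev (m / ad.2 * ad.1) else 0 :=
    DFunLike.coe_injective <| by
      rw [coe_heckeEnd hk hev hn, heckeOperator_poincareForm hk hev hm hn]
  rw [h1, peterssonInner_sum_left, peterssonInner_poincareForm_eq, fourierCoeff_heckeEnd hk hev hn,
    seqHecke_apply _ _ hn, Finset.mul_sum,
    ← sum_divisorsAntidiagonal_ite hm hn fun d r ↦
      (unfoldingConst k m : ℂ) * ((d : ℂ) ^ (k - 1) * fourierCoeff r g)]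
  refine Finset.sum_congr rfl fun ad had ↦ ?_
  split_ifs with hd
  · have h2 := congrArg (fun x : ℝ ↦ (x : ℂ)) (unfoldingConst_mul (k := k) hm had hd)
    simp only [Complex.ofReal_mul, Complex.ofReal_pow, Complex.ofReal_natCast] at h2
    rw [peterssonInner_smul_left, peterssonInner_poincareOrZero hk hev
      (div_mul_ne_zero_of_mem hm had hd), map_pow, Complex.conj_natCast, ← mul_assoc, ← mul_assoc,
      h2]
  · exact peterssonInner_zero_left g

lemma peterssonInner_heckeEnd {n : ℕ} (hn : n ≠ 0) (f g : CuspForm 𝒮ℒ (k : ℤ)) :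
    peterssonInner (heckeEnd hk hev n f) g = peterssonInner f (heckeEnd hk hev n g) := by
  have hf : f ∈ Submodule.span ℂ {f | ∃ m, ∃ hm : m ≠ 0, f = poincareForm hk hev hm} := by
    rw [span_poincareForm]
    trivial
  induction hf using Submodule.span_induction with
  | zero => rw [map_zero, peterssonInner_zero_left, peterssonInner_zero_left]
  | add x y _ _ hx hy => rw [map_add, peterssonInner_add_left, peterssonInner_add_left, hx, hy]
  | smul r x _ hx => rw [map_smul, peterssonInner_smul_left, peterssonInner_smul_left, hx]
  | mem x hx =>
    obtain ⟨m, hm, rfl⟩ := hx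
    exact peterssonInner_heckeEnd_poincareForm hk hev hm hn g

lemma commute_heckeEnd {m n : ℕ} (hm : m ≠ 0) (hn : n ≠ 0) :
    Commute (heckeEnd hk hev m) (heckeEnd hk hev n) := by
  refine LinearMap.ext fun f ↦ sub_eq_zero.mp (eq_zero_of_fourierCoeff fun r _ ↦ ?_)
  rw [map_sub, sub_eq_zero, Module.End.mul_apply, Module.End.mul_apply,
    fourierCoeff_heckeEnd hk hev hm, fourierCoeff_heckeEnd hk hev hn]
  simp_rw [fourierCoeff_heckeEnd hk hev hm, fourierCoeff_heckeEnd hk hev hn]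
  exact congrFun (LinearMap.congr_fun (commute_seqHecke (k - 1) hm hn).eq
    fun s ↦ fourierCoeff s f) r

lemma heckeForms_eq :
    heckeForms k = {f | fourierCoeff 1 f = 1 ∧
      ∀ n, n ≠ 0 → ∃ c : ℂ, heckeEnd hk hev n f = c • f} := by
  ext f
  refine and_congr Iff.rfl (forall_congr' fun n ↦ ?_)
  rw [Nat.one_le_iff_ne_zero]
  refine forall_congr' fun hn ↦ exists_congr fun c ↦ ?_
  rw [← DFunLike.coe_fn_eq, coe_heckeEnd hk hev hn, funext_iff]
  rfl

end

end HeckeMoments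

end

open scoped MatrixGroups UpperHalfPlane

noncomputable section

namespace HeckeMoments

open UpperHalfPlane MeasureTheory

open scoped ComplexConjugate

/-! ### Hecke eigenforms -/

section

variable {k : ℕ} (hk : 6 ≤ k) (hev : Even k)

/-- The Hecke operators and Fourier coefficients on cusp forms form a Hecke system. -/
lemma isHeckeSystem_heckeEnd :
    let _ : NormedAddCommGroup (CuspForm 𝒮ℒ (k : ℤ)) := (peterssonCore hk hev).toNormedAddCommGroup
    let _ : InnerProductSpace ℂ (CuspForm 𝒮ℒ (k : ℤ)) :=
      InnerProductSpace.ofCore (peterssonPreCore k)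
    IsHeckeSystem (V := CuspForm 𝒮ℒ (k : ℤ)) fourierCoeff (heckeEnd hk hev) := by
  intro _ _
  refine ⟨fun n hn f g ↦ peterssonInner_heckeEnd hk hev hn f g,
    fun m n hm hn ↦ commute_heckeEnd hk hev hm hn, fun n hn f ↦ ?_,
    fun f hf ↦ eq_zero_of_fourierCoeff hf⟩
  rw [fourierCoeff_heckeEnd hk hev hn, seqHecke_apply _ _ hn]
  simp

include hk hev

lemma finite_heckeForms : (heckeForms k).Finite := by
  let _ : NormedAddCommGroup (CuspForm 𝒮ℒ (k : ℤ)) := (peterssonCore hk hev).toNormedAddCommGroup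
  let _ : InnerProductSpace ℂ (CuspForm 𝒮ℒ (k : ℤ)) := InnerProductSpace.ofCore (peterssonPreCore k)
  rw [heckeForms_eq hk hev]
  exact (isHeckeSystem_heckeEnd hk hev).finite

lemma conj_fourierCoeff {f : CuspForm 𝒮ℒ (k : ℤ)} (hf : f ∈ heckeForms k) {n : ℕ} (hn : n ≠ 0) :
    conj (fourierCoeff n f) = fourierCoeff n f := by
  let _ : NormedAddCommGroup (CuspForm 𝒮ℒ (k : ℤ)) := (peterssonCore hk hev).toNormedAddCommGroup
  let _ : InnerProductSpace ℂ (CuspForm 𝒮ℒ (k : ℤ)) := InnerProductSpace.ofCore (peterssonPreCore k)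
  rw [heckeForms_eq hk hev] at hf
  exact (isHeckeSystem_heckeEnd hk hev).conj_coeff hf hn

lemma fourierCoeff_mul {f : CuspForm 𝒮ℒ (k : ℤ)} (hf : f ∈ heckeForms k) {m n : ℕ} (hn : n ≠ 0) :
    fourierCoeff m f * fourierCoeff n f =
      ∑ d ∈ (m.gcd n).divisors, (d : ℂ) ^ (k - 1) * fourierCoeff (m * n / d ^ 2) f := by
  let _ : NormedAddCommGroup (CuspForm 𝒮ℒ (k : ℤ)) := (peterssonCore hk hev).toNormedAddCommGroup
  let _ : InnerProductSpace ℂ (CuspForm 𝒮ℒ (k : ℤ)) := InnerProductSpace.ofCore (peterssonPreCore k)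
  rw [heckeForms_eq hk hev] at hf
  have h1 : heckeEnd hk hev n f = fourierCoeff n f • f :=
    (isHeckeSystem_heckeEnd hk hev).apply_eq_smul hf hn
  have h2 := fourierCoeff_heckeEnd hk hev hn f m
  rw [h1, map_smul, smul_eq_mul, seqHecke_apply _ _ hn] at h2
  rw [mul_comm, h2]

omit hev in
-- The 2 is that of the unfolding over ±γ; it cancels against the 2 in the main term of the Poincaré
-- series.
lemma harmonicWeight_eq (f : CuspForm 𝒮ℒ (k : ℤ)) :
    (unfoldingConst k 1 : ℂ) / peterssonInner f f = 2 * harmonicWeight f := by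
  have h : peterssonInner f f = ((peterssonInner f f).re : ℂ) :=
    (Complex.conj_eq_iff_re.mp (peterssonInner_conj_symm f f)).symm
  have hz : (4 * Real.pi) ^ ((k : ℤ) - 1) = (4 * Real.pi) ^ (k - 1) := by
    rw [← zpow_natCast, Nat.cast_pred (by omega)]
  rw [h, harmonicWeight, unfoldingConst, hz]
  push_cast
  rw [mul_one, mul_div_assoc, div_div]

/-- The harmonic average of the Fourier coefficients of the Hecke forms. -/
lemma sum_harmonicWeight_mul_fourierCoeff (m : ℕ) :
    ∑ f ∈ (finite_heckeForms hk hev).toFinset, (harmonicWeight f : ℂ) * fourierCoeff m f =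
      fourierCoeff m (poincareForm hk hev one_ne_zero) / 2 := by
  have h : poincareForm hk hev one_ne_zero = ∑ f ∈ (finite_heckeForms hk hev).toFinset,
      ((unfoldingConst k 1 : ℂ) / peterssonInner f f) • f := by
    let _ : NormedAddCommGroup (CuspForm 𝒮ℒ (k : ℤ)) :=
      (peterssonCore hk hev).toNormedAddCommGroup
    let _ : InnerProductSpace ℂ (CuspForm 𝒮ℒ (k : ℤ)) :=
      InnerProductSpace.ofCore (peterssonPreCore k)
    have h1 := (isHeckeSystem_heckeEnd hk hev).eq_sum_smul
      (p := poincareForm hk hev one_ne_zero) (c := unfoldingConst k 1) fun f ↦ by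
        rw [Complex.conj_ofReal]
        exact peterssonInner_poincareForm_eq hk hev one_ne_zero f
    refine h1.trans (Finset.sum_congr ?_ fun _ _ ↦ rfl)
    ext f
    rw [Set.Finite.mem_toFinset, Set.Finite.mem_toFinset, heckeForms_eq hk hev]
    rfl
  rw [h, map_sum, Finset.sum_div]
  refine Finset.sum_congr rfl fun f _ ↦ ?_
  rw [map_smul, harmonicWeight_eq hk, smul_eq_mul]
  ring

omit hk hev in
lemma eigenvalue_eq (f : CuspForm 𝒮ℒ (k : ℤ)) (n : ℕ) :
    eigenvalue f n = fourierCoeff n f / (((n : ℝ) ^ (((k : ℝ) - 1) / 2) : ℝ) : ℂ) := rfl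

lemma conj_eigenvalue {f : CuspForm 𝒮ℒ (k : ℤ)} (hf : f ∈ heckeForms k) {n : ℕ} (hn : n ≠ 0) :
    conj (eigenvalue f n) = eigenvalue f n := by
  rw [eigenvalue_eq, map_div₀, conj_fourierCoeff hk hev hf hn, Complex.conj_ofReal]

lemma isHeckeMultiplicative_eigenvalue {f : CuspForm 𝒮ℒ (k : ℤ)} (hf : f ∈ heckeForms k) :
    IsHeckeMultiplicative (eigenvalue f) := by
  refine ⟨?_, fun m n hm hn ↦ ?_⟩
  · rw [eigenvalue_eq, fourierCoeff_apply, hf.1]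
    simp
  · rw [eigenvalue_eq, eigenvalue_eq, div_mul_div_comm, fourierCoeff_mul hk hev hf hn,
      Finset.sum_div]
    refine Finset.sum_congr rfl fun d hd ↦ ?_
    have hdpos : (0 : ℝ) < d := by exact_mod_cast Nat.pos_of_mem_divisors hd
    have hsq := sq_dvd_mul_of_mem_divisors_gcd hd
    have hmn : (0 : ℝ) < m * n := by
      have := Nat.pos_of_ne_zero hm
      have := Nat.pos_of_ne_zero hn
      positivity
    have e1 : ((m * n / d ^ 2 : ℕ) : ℝ) = m * n / (d : ℝ) ^ 2 := by
      rw [Nat.cast_div hsq (by push_cast; positivity)]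
      push_cast
      rfl
    have e2 : ((d : ℝ) ^ 2) ^ (((k : ℝ) - 1) / 2) = (d : ℝ) ^ (k - 1) := by
      rw [← Real.rpow_natCast, ← Real.rpow_mul hdpos.le, ← Real.rpow_natCast,
        Nat.cast_pred (by omega)]
      congr 1
      push_cast
      ring
    -- The normalization by n^((k-1)/2) absorbs exactly the weight d^(k-1) of the unnormalized
    -- relations.
    have e3 : (m : ℝ) ^ (((k : ℝ) - 1) / 2) * (n : ℝ) ^ (((k : ℝ) - 1) / 2) =
        (d : ℝ) ^ (k - 1) * ((m * n / d ^ 2 : ℕ) : ℝ) ^ (((k : ℝ) - 1) / 2) := by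
      rw [← Real.mul_rpow (Nat.cast_nonneg _) (Nat.cast_nonneg _), e1,
        Real.div_rpow hmn.le (by positivity), e2]
      field_simp
    have hd0 : (d : ℂ) ≠ 0 := by exact_mod_cast hdpos.ne'
    rw [eigenvalue_eq, ← Complex.ofReal_mul, e3]
    push_cast
    rw [mul_div_mul_left _ _ (pow_ne_zero _ hd0)]

/-- The Petersson formula with a crude bound for the error term. -/
lemma norm_sum_harmonicWeight_mul_eigenvalue_sub_le {m : ℕ} (hm : m ≠ 0) :
    ‖∑ f ∈ (finite_heckeForms hk hev).toFinset, (harmonicWeight f : ℂ) * eigenvalue f m -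
      (if m = 1 then 1 else 0)‖ ≤ Real.exp (4 * Real.pi * m) * (cellBound * 2 ^ (4 - (k : ℤ))) := by
  have hm1 : (1 : ℝ) ≤ m := by exact_mod_cast Nat.one_le_iff_ne_zero.mpr hm
  have hk' : (6 : ℝ) ≤ k := by exact_mod_cast hk
  set r : ℝ := (m : ℝ) ^ (((k : ℝ) - 1) / 2) with hr
  have hr1 : 1 ≤ r := Real.one_le_rpow hm1 (by linarith)
  have h1 : ∑ f ∈ (finite_heckeForms hk hev).toFinset, (harmonicWeight f : ℂ) * eigenvalue f m -
      (if m = 1 then 1 else 0) = (fourierCoeff m (poincareForm hk hev one_ne_zero) -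
        2 * (if m = 1 then 1 else 0)) / ((2 * r : ℝ) : ℂ) := by
    simp only [eigenvalue_eq, ← hr]
    have : ∀ f : CuspForm 𝒮ℒ (k : ℤ), (harmonicWeight f : ℂ) * (fourierCoeff m f / (r : ℂ)) =
        harmonicWeight f * fourierCoeff m f / r := fun f ↦ (mul_div_assoc _ _ _).symm
    simp only [this]
    rw [← Finset.sum_div, sum_harmonicWeight_mul_fourierCoeff hk hev, sub_div]
    have hr0 : (r : ℂ) ≠ 0 := by exact_mod_cast (by linarith : r ≠ 0)
    split_ifs with h
    · have : r = 1 := by rw [hr, h]; simp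
      rw [this]
      simp
    · push_cast
      rw [mul_zero, zero_div, sub_zero, sub_zero, div_div]
  rw [h1, norm_div, Complex.norm_real, Real.norm_of_nonneg (by linarith)]
  -- The saving from the division by 2m^((k-1)/2) ≥ 1 is discarded.
  refine (div_le_self (norm_nonneg _) (by linarith)).trans ?_
  exact norm_fourierCoeff_poincareForm_sub_le hk hev one_ne_zero m

end

/-! ### Moments -/

lemma ofReal_norm_pow_two_mul {S : ℂ} (hS : conj S = S) (l : ℕ) :
    ((‖S‖ ^ (2 * l) : ℝ) : ℂ) = S ^ (2 * l) := by
  rw [pow_mul, pow_mul, Complex.ofReal_pow, Complex.ofReal_pow, ← Complex.conj_mul', hS, sq]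

lemma conj_sum_Icc {L : ℕ → ℂ} (hL : ∀ n, n ≠ 0 → conj (L n) = L n) (N : ℕ) :
    conj (∑ n ∈ Finset.Icc 1 N, L n) = ∑ n ∈ Finset.Icc 1 N, L n := by
  rw [map_sum]
  exact Finset.sum_congr rfl fun n hn ↦
    hL n (Nat.one_le_iff_ne_zero.mp (Finset.mem_Icc.mp hn).1)

/-- Linearization of an even moment of a real sequence satisfying the Hecke relations. -/
lemma IsHeckeMultiplicative.ofReal_norm_sum_pow {L : ℕ → ℂ} (hL : IsHeckeMultiplicative L)
    (hreal : ∀ n, n ≠ 0 → conj (L n) = L n) (N l : ℕ) :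
    ((‖∑ n ∈ Finset.Icc 1 N, L n‖ ^ (2 * l) : ℝ) : ℂ) =
      ((heckeExpansion N (2 * l)).map L).sum := by
  rw [ofReal_norm_pow_two_mul (conj_sum_Icc hreal N), hL.sum_pow]

lemma integral_multiset_sum {Ω : Type*} [MeasurableSpace Ω] {μ : Measure Ω} {F : ℕ → Ω → ℂ}
    (hF : ∀ n, Integrable (F n) μ) (M : Multiset ℕ) :
    Integrable (fun ω ↦ (M.map fun n ↦ F n ω).sum) μ ∧
      ∫ ω, (M.map fun n ↦ F n ω).sum ∂μ = (M.map fun n ↦ ∫ ω, F n ω ∂μ).sum := by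
  induction M using Multiset.induction_on with
  | empty => simp
  | cons a M ih =>
    simp only [Multiset.map_cons, Multiset.sum_cons]
    exact ⟨(hF a).add ih.1, by rw [integral_add (hF a) ih.1, ih.2]⟩

lemma norm_multiset_sum_sub_le {F G : ℕ → ℂ} {ε : ℝ} (M : Multiset ℕ)
    (h : ∀ m ∈ M, ‖F m - G m‖ ≤ ε) : ‖(M.map F).sum - (M.map G).sum‖ ≤ M.card * ε := by
  induction M using Multiset.induction_on with
  | empty => simp
  | cons a M ih =>
    have h1 := h a (Multiset.mem_cons_self a M)
    have h2 := ih fun m hm ↦ h m (Multiset.mem_cons_of_mem hm)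
    simp only [Multiset.map_cons, Multiset.sum_cons, Multiset.card_cons, add_sub_add_comm]
    push_cast
    linarith [norm_add_le (F a - G a) ((M.map F).sum - (M.map G).sum)]

lemma norm_multiset_sum_ite_le (M : Multiset ℕ) :
    ‖(M.map fun m ↦ if m = 1 then (1 : ℂ) else 0).sum‖ ≤ M.card := by
  have := norm_multiset_sum_sub_le (F := fun m ↦ if m = 1 then (1 : ℂ) else 0) (G := fun _ ↦ 0)
    (ε := 1) M fun m _ ↦ by split_ifs <;> simp
  simpa using this

lemma ofReal_harmonicSum {k : ℕ} (hk : 6 ≤ k) (hev : Even k) (α : CuspForm 𝒮ℒ (k : ℤ) → ℝ) :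
    (harmonicSum k α : ℂ) = ∑ f ∈ (finite_heckeForms hk hev).toFinset,
      (harmonicWeight f : ℂ) * (α f : ℂ) := by
  rw [harmonicSum, finsum_mem_eq_finite_toFinset_sum _ (finite_heckeForms hk hev)]
  push_cast
  rfl

lemma sum_mul_multiset_sum {ι : Type*} (s : Finset ι) (w : ι → ℂ) (L : ι → ℕ → ℂ)
    (M : Multiset ℕ) : ∑ i ∈ s, w i * (M.map (L i)).sum =
      (M.map fun m ↦ ∑ i ∈ s, w i * L i m).sum := by
  induction M using Multiset.induction_on with
  | empty => simp
  | cons a M ih =>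
    simp only [Multiset.map_cons, Multiset.sum_cons, mul_add, Finset.sum_add_distrib, ih]

lemma cellBound_nonneg : 0 ≤ cellBound :=
  tsum_nonneg fun _ ↦ mul_nonneg (Real.rpow_nonneg (EisensteinSeries.r_pos _).le _)
    (Real.rpow_nonneg (norm_nonneg _) _)

/-! ### Size of the error term -/

/-- For large k, e^(4πk^(1/3)) ≤ 2^(k/2), so the whole is O(k 2^(-k/2)). The factor 4k is what the
final estimate loses against k^(-1/3). -/
lemma exists_forall_error_le : ∃ k₀ : ℕ, ∀ k : ℕ, k₀ ≤ k →
    4 * k * (Real.exp (4 * Real.pi * (k : ℝ) ^ (1 / 3 : ℝ)) *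
      (cellBound * 2 ^ (4 - (k : ℤ)))) ≤ 1 := by
  have hlog : 0 < Real.log 2 := Real.log_pos one_lt_two
  have h1 : ∀ᶠ t : ℝ in Filter.atTop, 4 * Real.pi * t ^ (1 / 3 : ℝ) ≤ Real.log 2 / 2 * t := by
    have := (tendsto_rpow_neg_atTop (y := 2 / 3) (by norm_num)).eventually_le_const
      (show 0 < Real.log 2 / 2 / (4 * Real.pi) by positivity)
    filter_upwards [this, Filter.eventually_gt_atTop 0] with t ht ht0
    have e : t ^ (1 / 3 : ℝ) = t ^ (-(2 / 3) : ℝ) * t := by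
      rw [← Real.rpow_add_one ht0.ne']
      norm_num
    rw [le_div_iff₀ (by positivity)] at ht
    rw [e]
    nlinarith
  have h2 : Filter.Tendsto (fun t : ℝ ↦ 64 * cellBound * (2 / Real.log 2) *
      ((Real.log 2 / 2 * t) ^ 1 * Real.exp (-(Real.log 2 / 2 * t)))) Filter.atTop (nhds 0) := by
    have h := ((Real.tendsto_pow_mul_exp_neg_atTop_nhds_zero 1).comp
      (Filter.tendsto_id.const_mul_atTop (show 0 < Real.log 2 / 2 by positivity))).const_mul
        (64 * cellBound * (2 / Real.log 2))
    rwa [mul_zero] at h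
  obtain ⟨k₀, hk₀⟩ := Filter.eventually_atTop.mp
    (tendsto_natCast_atTop_atTop.eventually (h1.and (h2.eventually_le_const one_pos)))
  refine ⟨k₀, fun k hk ↦ ?_⟩
  obtain ⟨h3, h4⟩ := hk₀ k hk
  refine le_trans ?_ h4
  have e : (2 : ℝ) ^ (4 - (k : ℤ)) = 16 * Real.exp (-(Real.log 2 * k)) := by
    rw [zpow_sub₀ two_ne_zero, zpow_natCast, ← Real.exp_log (show (0 : ℝ) < 2 ^ k by positivity),
      Real.log_pow, Real.exp_neg, mul_comm (Real.log 2)]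
    norm_num
    rw [div_eq_mul_inv]
  calc 4 * k * (Real.exp (4 * Real.pi * (k : ℝ) ^ (1 / 3 : ℝ)) * (cellBound * 2 ^ (4 - (k : ℤ))))
      ≤ 4 * k * (Real.exp (Real.log 2 / 2 * k) * (cellBound * 2 ^ (4 - (k : ℤ)))) := by
        have := cellBound_nonneg
        gcongr
    _ = 64 * cellBound * k * (Real.exp (Real.log 2 / 2 * k) * Real.exp (-(Real.log 2 * k))) := by
        rw [e]
        ring
    _ = _ := by
        rw [← Real.exp_add, show Real.log 2 / 2 * k + -(Real.log 2 * k) = -(Real.log 2 / 2 * k) by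
          ring]
        field_simp

/-- In A/B - D = ((A - D) - D(B - 1))/B both numerator terms are at most Kε, and B ≥ 1/2. -/
lemma abs_div_sub_le {A B D ε K : ℝ} (hB : |B - 1| ≤ ε) (hε : ε ≤ 1 / 2) (hA : |A - D| ≤ K * ε)
    (hD : |D| ≤ K) : |A / B - D| ≤ 4 * K * ε := by
  have hB' : 1 / 2 ≤ B := by linarith [(abs_le.mp hB).1]
  have hB0 : 0 < B := by linarith
  have hε0 : 0 ≤ ε := (abs_nonneg _).trans hB
  have hK0 : 0 ≤ K := (abs_nonneg _).trans hD
  have h1 : A / B - D = ((A - D) - D * (B - 1)) / B := by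
    field_simp
    ring
  rw [h1, abs_div, abs_of_pos hB0, div_le_iff₀ hB0]
  calc |(A - D) - D * (B - 1)| ≤ |A - D| + |D * (B - 1)| := abs_sub _ _
    _ ≤ K * ε + K * ε := by
        rw [abs_mul]
        gcongr
    _ ≤ 4 * K * ε * B := by nlinarith [mul_nonneg hK0 hε0]

end HeckeMoments

end

/-! ### Comparison of the moments -/

theorem mainTheorem7 :
    ∃ C : ℝ, ∃ k₀ : ℕ, ∀ k : ℕ, k₀ ≤ k → Even k →
      ∀ x : ℝ, 2 ≤ x → ∀ ℓ : ℕ, 1 ≤ ℓ → x ^ (6 * ℓ) ≤ (k : ℝ) →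
      ∀ (Ω : Type*) [MeasurableSpace Ω] (μ : MeasureTheory.Measure Ω)
        [MeasureTheory.IsProbabilityMeasure μ]
        (g : Nat.Primes → Ω → ConjClasses HeckeMoments.SU2),
        (∀ p, Measurable (g p)) → ProbabilityTheory.iIndepFun g μ →
        (∀ p, μ.map (g p) = HeckeMoments.satoTate) →
        |HeckeMoments.harmonicSum k
              (fun f ↦ ‖∑ n ∈ Finset.Icc 1 ⌊x⌋₊, HeckeMoments.eigenvalue f n‖ ^ (2 * ℓ))
            / HeckeMoments.harmonicSum k (fun _ ↦ 1)
          - ∫ ω, ‖∑ n ∈ Finset.Icc 1 ⌊x⌋₊,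
              HeckeMoments.randomX (fun p ↦ g p ω) n‖ ^ (2 * ℓ) ∂μ|
          ≤ C * (k : ℝ) ^ (-(1 / 3 : ℝ)) := by
  obtain ⟨k₁, hk₁⟩ := HeckeMoments.exists_forall_error_le
  -- Weight at least 6 makes the Poincaré series cusp forms; beyond `k₁` the error is small enough
  -- for C = 1.
  refine ⟨1, max k₁ 6, fun k hk hev x hx l hl hxk Ω _ μ _ g hg hind hdist ↦ ?_⟩
  have hk6 : 6 ≤ k := (le_max_right _ _).trans hk
  have herr := hk₁ k ((le_max_left _ _).trans hk)
  set ε : ℝ := Real.exp (4 * Real.pi * (k : ℝ) ^ (1 / 3 : ℝ)) *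
    (HeckeMoments.cellBound * 2 ^ (4 - (k : ℤ))) with hε
  set N := ⌊x⌋₊ with hN
  set M := HeckeMoments.heckeExpansion N (2 * l) with hM
  set A := HeckeMoments.harmonicSum k
    (fun f ↦ ‖∑ n ∈ Finset.Icc 1 N, HeckeMoments.eigenvalue f n‖ ^ (2 * l)) with hA
  set B := HeckeMoments.harmonicSum k (fun _ ↦ 1) with hB
  set D := ∫ ω, ‖∑ n ∈ Finset.Icc 1 N, HeckeMoments.randomX (fun p ↦ g p ω) n‖ ^ (2 * l) ∂μ with hD
  have hkR : (6 : ℝ) ≤ k := by exact_mod_cast hk6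
  have hk0 : (0 : ℝ) < k := by linarith
  have hε0 : 0 ≤ ε := by
    have := HeckeMoments.cellBound_nonneg
    positivity
  have hNx : (N : ℝ) ≤ x := Nat.floor_le (by linarith)
  -- This bounds the indices in the expansion; its square, `hx4`, bounds their number.
  have hx2 : x ^ (2 * l) ≤ (k : ℝ) ^ (1 / 3 : ℝ) := by
    have h := Real.rpow_le_rpow (by positivity) hxk (show (0 : ℝ) ≤ 1 / 3 by norm_num)
    rwa [show 6 * l = 2 * l * 3 by ring, pow_mul, ← Real.rpow_natCast (x ^ (2 * l)),
      ← Real.rpow_mul (by positivity), show ((3 : ℕ) : ℝ) * (1 / 3) = 1 by norm_num,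
      Real.rpow_one] at h
  have hx4 : x ^ (4 * l) ≤ (k : ℝ) ^ (2 / 3 : ℝ) := by
    calc x ^ (4 * l) = (x ^ (2 * l)) ^ 2 := by ring
      _ ≤ ((k : ℝ) ^ (1 / 3 : ℝ)) ^ 2 := by gcongr
      _ = (k : ℝ) ^ (2 / 3 : ℝ) := by
          rw [← Real.rpow_natCast, ← Real.rpow_mul hk0.le]
          norm_num
  have hcard : (M.card : ℝ) ≤ (k : ℝ) ^ (2 / 3 : ℝ) := by
    refine le_trans ?_ hx4
    calc (M.card : ℝ) ≤ ((N ^ 2) ^ (2 * l) : ℕ) := by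
          exact_mod_cast HeckeMoments.card_heckeExpansion_le N (2 * l)
      _ = (N : ℝ) ^ (4 * l) := by
          push_cast
          ring
      _ ≤ x ^ (4 * l) := by gcongr
  have hΔ : ∀ m : ℕ, m ≠ 0 → (m : ℝ) ≤ (k : ℝ) ^ (1 / 3 : ℝ) →
      ‖∑ f ∈ (HeckeMoments.finite_heckeForms hk6 hev).toFinset,
        (HeckeMoments.harmonicWeight f : ℂ) * HeckeMoments.eigenvalue f m -
          (if m = 1 then 1 else 0)‖ ≤ ε := by
    intro m hm hmk
    refine (HeckeMoments.norm_sum_harmonicWeight_mul_eigenvalue_sub_le hk6 hev hm).trans ?_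
    have := HeckeMoments.cellBound_nonneg
    rw [hε]
    gcongr
  -- The total mass is the harmonic sum of λ_f(1) = 1, that is Petersson's formula at m = 1.
  have hB1 : |B - 1| ≤ ε := by
    have h1 := hΔ 1 one_ne_zero (by
      rw [Nat.cast_one]
      exact Real.one_le_rpow (by linarith) (by norm_num))
    have h2 : (B : ℂ) = ∑ f ∈ (HeckeMoments.finite_heckeForms hk6 hev).toFinset,
        (HeckeMoments.harmonicWeight f : ℂ) * HeckeMoments.eigenvalue f 1 := by
      rw [hB, HeckeMoments.ofReal_harmonicSum hk6 hev]
      refine Finset.sum_congr rfl fun f hf ↦ ?_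
      rw [(HeckeMoments.isHeckeMultiplicative_eigenvalue hk6 hev
        ((Set.Finite.mem_toFinset _).mp hf)).map_one, Complex.ofReal_one]
    rw [if_pos rfl, ← h2, ← Complex.ofReal_one, ← Complex.ofReal_sub, Complex.norm_real] at h1
    exact h1
  have hAsum : (A : ℂ) = (M.map fun m ↦ ∑ f ∈ (HeckeMoments.finite_heckeForms hk6 hev).toFinset,
      (HeckeMoments.harmonicWeight f : ℂ) * HeckeMoments.eigenvalue f m).sum := by
    rw [hA, HeckeMoments.ofReal_harmonicSum hk6 hev, ← HeckeMoments.sum_mul_multiset_sum]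
    refine Finset.sum_congr rfl fun f hf ↦ ?_
    have hf' := (Set.Finite.mem_toFinset _).mp hf
    rw [(HeckeMoments.isHeckeMultiplicative_eigenvalue hk6 hev hf').ofReal_norm_sum_pow
      fun n hn ↦ HeckeMoments.conj_eigenvalue hk6 hev hf' hn]
  have hDsum : (D : ℂ) = (M.map fun m ↦ if m = 1 then (1 : ℂ) else 0).sum := by
    rw [hD, ← integral_complex_ofReal]
    have h1 : ∀ ω, ((‖∑ n ∈ Finset.Icc 1 N, HeckeMoments.randomX (fun p ↦ g p ω) n‖ ^ (2 * l) : ℝ) :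
        ℂ) = (M.map fun m ↦ HeckeMoments.randomX (fun p ↦ g p ω) m).sum := fun ω ↦
      (HeckeMoments.isHeckeMultiplicative_randomX _).ofReal_norm_sum_pow
        (fun n _ ↦ HeckeMoments.conj_randomX _ n) N l
    simp_rw [h1]
    rw [(HeckeMoments.integral_multiset_sum (fun n ↦ HeckeMoments.integrable_randomX hg n) M).2]
    refine congrArg _ (Multiset.map_congr rfl fun m hm ↦ ?_)
    exact HeckeMoments.integral_randomX hg hind hdist
      (HeckeMoments.ne_zero_and_le_of_mem_heckeExpansion N (2 * l) m hm).1
  have hAD : |A - D| ≤ (k : ℝ) ^ (2 / 3 : ℝ) * ε := by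
    have h1 : ‖(A : ℂ) - (D : ℂ)‖ ≤ M.card * ε := by
      rw [hAsum, hDsum]
      refine HeckeMoments.norm_multiset_sum_sub_le M fun m hm ↦ ?_
      obtain ⟨h2, h3⟩ := HeckeMoments.ne_zero_and_le_of_mem_heckeExpansion N (2 * l) m hm
      refine hΔ m h2 (le_trans ?_ hx2)
      calc (m : ℝ) ≤ (N : ℝ) ^ (2 * l) := by exact_mod_cast h3
        _ ≤ x ^ (2 * l) := by gcongr
    rw [← Complex.ofReal_sub, Complex.norm_real] at h1
    exact h1.trans (by gcongr)
  have hDle : |D| ≤ (k : ℝ) ^ (2 / 3 : ℝ) := by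
    have h1 := HeckeMoments.norm_multiset_sum_ite_le M
    rw [← hDsum, Complex.norm_real] at h1
    exact h1.trans hcard
  -- The condition ε ≤ 1/2 follows from 4kε ≤ 1 and k ≥ 6.
  refine (HeckeMoments.abs_div_sub_le hB1 (by nlinarith) hAD hDle).trans ?_
  have hsplit : (k : ℝ) ^ (2 / 3 : ℝ) = k * (k : ℝ) ^ (-(1 / 3) : ℝ) := by
    rw [mul_comm, ← Real.rpow_add_one hk0.ne']
    norm_num
  rw [hsplit]
  calc 4 * (k * (k : ℝ) ^ (-(1 / 3) : ℝ)) * ε = 4 * k * ε * (k : ℝ) ^ (-(1 / 3) : ℝ) := by ring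
    _ ≤ 1 * (k : ℝ) ^ (-(1 / 3) : ℝ) := by gcongr
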